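/- In the CONGEST model, $n$ vertices with identifiers $0,\dots,n-1$ communicate in synchronous rounds over a connected network; in each round each vertex may send, over each incident edge, a (possibly different) message of at most $B(n)=O(\log n)$ bits, local computation is unrestricted, and each vertex initially knows $n$, its identifier and its incident edges (with their directions and other endpoints). The network is the input graph itself, or, for a directed loopless input graph, its underlying undirected graph (messages travel in both directions along an arc). Algorithms may be deterministic or randomized (with private or shared coins); an algorithm solves a problem in $T$ rounds if on every $n$-vertex input with connected network the outputs after $T$ rounds are correct with probability at least $2/3$. Deciding a property means that all vertices accept if the property holds and at least one vertex rejects otherwise. Finding a Hamiltonian path or cycle means that, if the input graph has one, then the edges (arcs) selected by the vertices, each vertex selecting some of its incident edges (arcs), are exactly those of one such path or cycle; if there is none, the outputs are not restricted. **Theorem.** For each of the following six problems, every CONGEST algorithm takes $\Omega(n^2/\log^4 n)$ rounds: deciding the existence of, or finding, 1. a Hamiltonian path in an undirected graph; 2. a Hamiltonian cycle in an undirected graph; 3. a directed Hamiltonian cycle in a directed graph. That is, for every bandwidth function $B(n)=O(\log n)$ and each of the six problems there are $c>0$ and $n_0$ such that for all $n\ge n_0$, every algorithm with bandwidth $B(n)$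 that solves the problem on $n$-vertex graphs in $T$ rounds satisfies $T\ge c\,n^2/\log^4 n$. -/

import Mathlib

open Filter Asymptotics

/-- Messages of at most `B` bits. The empty string may be read as "no message". -/
abbrev CongestMsg (B : ℕ) : Type := {w : List Bool // w.length ≤ B}

/-- The silent (empty) message. -/
def CongestMsg.silent (B : ℕ) : CongestMsg B := ⟨[], Nat.zero_le B⟩

/-- A distributed problem on networks with `n` vertices, the identifiers being `0, …, n - 1`.
Every instance has a communication network and gives a local input to each vertex; `valid` is the
set of admissible instances; `correct G o` says that `o`, the family of the outputs of
the vertices, is a correct solution of the instance `G`. -/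
structure DistributedProblem (n : ℕ) where
  Instance : Type
  LocalInput : Type
  Output : Type
  network : Instance → SimpleGraph (Fin n)
  localInput : Instance → Fin n → LocalInput
  valid : Instance → Prop
  correct : Instance → (Fin n → Output) → Prop

/-- A (randomized) CONGEST algorithm for `n`-vertex networks with bandwidth `B` bits per edge,
direction and round. Local computation is unrestricted. What a vertex does is a function of its
identifier `v`, its local input, its random tape and the messages it has received so far: a list
with one entry for each past round, the latest round first, each entry giving the message
received from each other vertex.

`law` is the joint law of the random tapes of the `n` vertices. It is arbitrary: independent
tapes of independent fair bits are the usual private coins, equal tapes are shared coins, and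
a deterministic algorithm is one that ignores the tapes. -/
structure CongestAlgorithm {n : ℕ} (P : DistributedProblem n) (B : ℕ) where
  /-- The message that `v` sends to `u` in the next round. -/
  send : (v : Fin n) → P.LocalInput → (ℕ → Bool) → List (Fin n → CongestMsg B) →
    (u : Fin n) → CongestMsg B
  /-- The output of `v`, should the algorithm stop now. -/
  output : (v : Fin n) → P.LocalInput → (ℕ → Bool) → List (Fin n → CongestMsg B) → P.Output
  send_measurable : ∀ v x h u m, MeasurableSet {τ : ℕ → Bool | send v x τ h u = m}
  output_measurable : ∀ v x h o, MeasurableSet {τ : ℕ → Bool | output v x τ h = o}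
  law : MeasureTheory.Measure (Fin n → ℕ → Bool)
  law_prob : MeasureTheory.IsProbabilityMeasure law

namespace CongestAlgorithm

variable {n B : ℕ} {P : DistributedProblem n}

open Classical in
/-- The messages that each vertex has received in the first `t` synchronous rounds, on the
instance `G` and with random tapes `ω`. Messages travel along edges of the network only. -/
noncomputable def history (A : CongestAlgorithm P B) (G : P.Instance) (ω : Fin n → ℕ → Bool) :
    ℕ → Fin n → List (Fin n → CongestMsg B)
  | 0, _ => []
  | t + 1, v =>
    (fun u => if (P.network G).Adj u v
      then A.send u (P.localInput G u) (ω u) (A.history G ω t u) v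
      else CongestMsg.silent B) :: A.history G ω t v

/-- The outputs of the vertices after `T` rounds. -/
noncomputable def outputs (A : CongestAlgorithm P B) (G : P.Instance) (ω : Fin n → ℕ → Bool)
    (T : ℕ) (v : Fin n) : P.Output :=
  A.output v (P.localInput G v) (ω v) (A.history G ω T v)

/-- `A` solves the problem in `T` rounds: on every admissible instance the outputs
after `T` rounds are correct with probability at least `2 / 3`. -/
def Solves (A : CongestAlgorithm P B) (T : ℕ) : Prop :=
  ∀ G, P.valid G → 2 / 3 ≤ A.law.real {ω | P.correct G (A.outputs G ω T)}

end CongestAlgorithm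

/-- Every CONGEST algorithm for the problem takes `Ω(f n)` rounds: for each bandwidth
`B n = O(log n)` there is a constant `c > 0` such that, for all large `n`, no algorithm
solves the problem on `n` vertices in fewer than `c * f n` rounds. -/
def RequiresRounds (P : (n : ℕ) → DistributedProblem n) (f : ℕ → ℝ) : Prop :=
  ∀ B : ℕ → ℕ, (fun n => (B n : ℝ)) =O[atTop] (fun n : ℕ => Real.log n) →
    ∃ c : ℝ, 0 < c ∧ ∀ᶠ n in atTop, ∀ (A : CongestAlgorithm (P n) (B n)) (T : ℕ),
      A.Solves T → c * f n ≤ T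

/-- The usual way in which a network decides a property: if it holds then all
vertices accept, if it fails then at least one vertex rejects. -/
def DecisionCorrect {n : ℕ} (property : Prop) (o : Fin n → Bool) : Prop :=
  (∀ v, o v = true) ↔ property

/-! ### Undirected graphs -/

/-- The edges selected by at least one of their endpoints, when vertex `v` selects its edges
to the vertices in `o v`. -/
def selectedEdges {n : ℕ} (o : Fin n → Set (Fin n)) : Set (Sym2 (Fin n)) :=
  {e | ∃ v, ∃ u ∈ o v, e = s(v, u)}

/-- `S` is the set of edges of a Hamiltonian path of `G`. -/
def IsHamPathEdgeSet {n : ℕ} (G : SimpleGraph (Fin n)) (S : Set (Sym2 (Fin n))) : Prop :=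
  ∃ (a b : Fin n) (p : G.Walk a b), p.IsHamiltonian ∧ S = {e | e ∈ p.edges}

/-- `S` is the set of edges of a Hamiltonian cycle of `G`. -/
def IsHamCycleEdgeSet {n : ℕ} (G : SimpleGraph (Fin n)) (S : Set (Sym2 (Fin n))) : Prop :=
  ∃ (a : Fin n) (p : G.Walk a a), p.IsHamiltonianCycle ∧ S = {e | e ∈ p.edges}

/-- Deciding whether an undirected connected graph has an edge set as described by `Q`. The graph
is the network, and each vertex initially knows its neighbours. -/
def undirectedDecision (Q : {n : ℕ} → SimpleGraph (Fin n) → Set (Sym2 (Fin n)) → Prop) (n : ℕ) :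
    DistributedProblem n where
  Instance := SimpleGraph (Fin n)
  LocalInput := Set (Fin n)
  Output := Bool
  network := fun G => G
  localInput := fun G v => G.neighborSet v
  valid := fun G => G.Connected
  correct := fun G o => DecisionCorrect (∃ S, Q G S) o

/-- Finding an edge set as described by `Q` in an undirected connected graph, if there is one (if
there is none, the outputs are not restricted). Each vertex outputs a set of its
edges, given by their other endpoints. -/
def undirectedFinding (Q : {n : ℕ} → SimpleGraph (Fin n) → Set (Sym2 (Fin n)) → Prop) (n : ℕ) :
    DistributedProblem n where
  Instance := SimpleGraph (Fin n)
  LocalInput := Set (Fin n)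
  Output := Set (Fin n)
  network := fun G => G
  localInput := fun G v => G.neighborSet v
  valid := fun G => G.Connected
  correct := fun G o => (∃ S, Q G S) → Q G (selectedEdges o)

/-! ### Directed graphs -/

/-- The underlying undirected graph of a directed graph: messages travel in both directions
along an arc. -/
def underlyingGraph {n : ℕ} (G : Digraph (Fin n)) : SimpleGraph (Fin n) :=
  SimpleGraph.fromRel G.Adj

/-- The arcs selected by at least one of their endpoints, when `v` selects its arcs to
the vertices in `(o v).1` and its arcs from the vertices in `(o v).2`. -/
def selectedArcs {n : ℕ} (o : Fin n → Set (Fin n) × Set (Fin n)) : Set (Fin n × Fin n) :=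
  {a | a.2 ∈ (o a.1).1 ∨ a.1 ∈ (o a.2).2}

/-- `S` is the set of arcs of a directed Hamiltonian cycle of `G`: for some enumeration
`p 0, …, p (n - 1)` of all vertices there are arcs from each `p i` to `p (i + 1 mod n)`, and they
form `S`. -/
def IsDirectedHamCycleArcSet {n : ℕ} (G : Digraph (Fin n)) (S : Set (Fin n × Fin n)) : Prop :=
  ∃ p : Equiv.Perm (Fin n), (∀ i, G.Adj (p i) (p (finRotate n i))) ∧
    S = Set.range fun i => (p i, p (finRotate n i))

/-- Deciding whether a directed loopless graph, the underlying graph of which is connected and is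
the network, has a directed Hamiltonian cycle. Each vertex initially knows its out-neighbours and
its in-neighbours. -/
def directedHamCycleDecision (n : ℕ) : DistributedProblem n where
  Instance := Digraph (Fin n)
  LocalInput := Set (Fin n) × Set (Fin n)
  Output := Bool
  network := underlyingGraph
  localInput := fun G v => ({u | G.Adj v u}, {u | G.Adj u v})
  valid := fun G => (∀ v, ¬ G.Adj v v) ∧ (underlyingGraph G).Connected
  correct := fun G o => DecisionCorrect (∃ S, IsDirectedHamCycleArcSet G S) o

/-- Finding a directed Hamiltonian cycle, if there is one (if there is none, the
outputs are not restricted). Each vertex outputs a set of its outgoing and a set of its incoming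
arcs, given by their other endpoints. -/
def directedHamCycleFinding (n : ℕ) : DistributedProblem n where
  Instance := Digraph (Fin n)
  LocalInput := Set (Fin n) × Set (Fin n)
  Output := Set (Fin n) × Set (Fin n)
  network := underlyingGraph
  localInput := fun G v => ({u | G.Adj v u}, {u | G.Adj u v})
  valid := fun G => (∀ v, ¬ G.Adj v v) ∧ (underlyingGraph G).Connected
  correct := fun G o => (∃ S, IsDirectedHamCycleArcSet G S) →
    IsDirectedHamCycleArcSet G (selectedArcs o)

/-- Deciding whether there is a Hamiltonian path. -/
def hamPathDecision : (n : ℕ) → DistributedProblem n := undirectedDecision IsHamPathEdgeSet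

/-- Finding a Hamiltonian path. -/
def hamPathFinding : (n : ℕ) → DistributedProblem n := undirectedFinding IsHamPathEdgeSet

/-- Deciding whether there is a Hamiltonian cycle. -/
def hamCycleDecision : (n : ℕ) → DistributedProblem n := undirectedDecision IsHamCycleEdgeSet

/-- Finding a Hamiltonian cycle. -/
def hamCycleFinding : (n : ℕ) → DistributedProblem n := undirectedFinding IsHamCycleEdgeSet

/-!
The lower bounds are reductions from set disjointness in two-party communication.

*Disjointness.* A deterministic protocol is represented by the map from inputs to leaves, the
fibres of which are combinatorial rectangles. On the hard distribution each coordinate is given to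
one of the players by a fair coin, and this player gets a uniform bit, the other one a `0`; so the
inputs are disjoint, and setting both bits of one coordinate to `1` makes them meet. If there are
`N` leaves, then by the level-one inequality (`sum_sq_bias_le`) the squared Hellinger distances
between the laws of the leaf for the two values of a bit, summed over the `K` bits, are at most
`4 log N` (`sum_hellinger_le`). The laws for the four values of a pair of bits are products, so the
cut-and-paste argument (`sq_advantage_le`) turns this into a bound on the advantage in
distinguishing meeting from disjoint inputs, whence `log N` is at least linear in `K`
(`card_le_log_of_advantage`).

*Simulation.* In a family of networks in which the two halves of the vertices depend on the inputs
`x` and `y` of the two players and are joined by few edges, the messages on these edges form the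
transcript of a protocol (`TwoPartyFamily.transcript_mixed`). An algorithm for a problem whose
correct outputs tell whether `x` and `y` meet therefore needs a number of rounds that is at least
`K` divided by the number of bits that cross the cut in a round (`card_le_of_solves`). For the
finding problems, a Hamiltonian path names a common element, which the first player can announce.

*Graphs.* The coordinates are pairs of `l`-bit indices, so `K = 4 ^ l`, while the graphs have
`O(l * 2 ^ l)` vertices and a cut of `O(l)` edges. As in the reduction from satisfiability to
directed Hamiltonian cycles, each of the `2 * l` bits has a row of vertices that can be traversed in
two directions, half of it on either side of the cut, and both players have a clause vertex for
each value of each index, which a row can visit if its direction differs from the bit of the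
value. So the rows visit all clause vertices but those of the pair given by their
directions. These have to be visited on a separate path, which passes through an arc that is
present only if the pair is in `x` on one side, and in `y` on the other side. That each tour names
a common pair uses only the neighbourhoods of single vertices and the absence of 2-cycles
(`GadgetVertex.exists_mem_of_isSuccessor`); conversely each common pair gives a Hamiltonian path
(`GadgetVertex.traverses_of_mem`).

Replacing vertices by paths of at least three vertices makes the gadget undirected
(`IsTour.isSuccessor`). The start and the end of the gadget are leaves of the resulting
graph, so its Hamiltonian paths are the Hamiltonian cycles of the graph with one more edge between
the leaves. For directed cycles, all edges of the latter graph are doubled.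
-/

/-! ### Set disjointness -/

section Disjointness

open Finset

variable {ι : Type*} [Fintype ι] [DecidableEq ι]

/-- The sign of a bit: `1` for `true` and `-1` for `false`. -/
def bitSign (b : Bool) : ℝ := if b then 1 else -1

/-- The exponential moment of a linear form in independent uniform signs. -/
theorem sum_exp_linear_le (b : ι → ℝ) :
    ∑ z : ι → Bool, Real.exp (∑ j, b j * bitSign (z j)) ≤
      2 ^ Fintype.card ι * Real.exp ((∑ j, b j ^ 2) / 2) := by
  have h1 : ∑ z : ι → Bool, Real.exp (∑ j, b j * bitSign (z j)) =
      ∏ j, (2 * Real.cosh (b j)) := by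
    have := (Finset.prod_univ_sum (fun _ : ι => (univ : Finset Bool))
      (fun j c => Real.exp (b j * bitSign c))).symm
    simp only [Fintype.piFinset_univ] at this
    simp only [Real.exp_sum]
    rw [this]
    refine Finset.prod_congr rfl fun j _ => ?_
    rw [Fintype.sum_bool, Real.cosh_eq]
    simp [bitSign]
    ring
  rw [h1, Finset.prod_mul_distrib, Finset.prod_const, Finset.card_univ, Finset.sum_div,
    Real.exp_sum]
  gcongr with j
  exact Real.cosh_le_exp_half_sq _

/-- The level-one inequality: the coordinate biases of a nonempty set `S` of bit strings have small
total square if `S` is not too sparse. With `L` the linear form whose coefficients are the biases,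
the mean of `L` over `S` is the sum of the squares, and is bounded by the exponential moment of
`L` over all strings. -/
theorem sum_sq_bias_le (S : Finset (ι → Bool)) (hS : S.Nonempty) (b : ι → ℝ)
    (hb : ∀ j, ∑ z ∈ S, bitSign (z j) = #S * b j) :
    ∑ j, b j ^ 2 ≤ 2 * Real.log (2 ^ Fintype.card ι / #S) := by
  set W := ∑ j, b j ^ 2 with hW
  have hc : (0 : ℝ) < #S := by exact_mod_cast hS.card_pos
  have hL : ∑ z ∈ S, ∑ j, b j * bitSign (z j) = #S * W := by
    rw [Finset.sum_comm, hW, Finset.mul_sum]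
    refine Finset.sum_congr rfl fun j _ => ?_
    rw [← Finset.mul_sum, hb]; ring
  have h1 : (#S : ℝ) ≤ ∑ z ∈ S, Real.exp (∑ j, b j * bitSign (z j) - W) := by
    calc (#S : ℝ) = ∑ z ∈ S, (∑ j, b j * bitSign (z j) - W + 1) := by
          rw [Finset.sum_add_distrib, Finset.sum_sub_distrib, hL]; simp
      _ ≤ _ := Finset.sum_le_sum fun z _ => Real.add_one_le_exp _
  have h2 : ∑ z ∈ S, Real.exp (∑ j, b j * bitSign (z j) - W) ≤
      2 ^ Fintype.card ι * Real.exp (-(W / 2)) := by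
    calc _ ≤ ∑ z : ι → Bool, Real.exp (∑ j, b j * bitSign (z j) - W) :=
          Finset.sum_le_sum_of_subset_of_nonneg (Finset.subset_univ _)
            fun _ _ _ => (Real.exp_pos _).le
      _ = (∑ z : ι → Bool, Real.exp (∑ j, b j * bitSign (z j))) * Real.exp (-W) := by
          rw [Finset.sum_mul]
          exact Finset.sum_congr rfl fun z _ => by rw [← Real.exp_add]; rfl
      _ ≤ (2 ^ Fintype.card ι * Real.exp (W / 2)) * Real.exp (-W) := by
          gcongr; exact sum_exp_linear_le b
      _ = _ := by rw [mul_assoc, ← Real.exp_add]; congr 2; ring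
  have h3 : Real.exp (W / 2) ≤ 2 ^ Fintype.card ι / #S := by
    rw [le_div_iff₀ hc]
    have := mul_le_mul_of_nonneg_left (h1.trans h2) (Real.exp_pos (W / 2)).le
    calc _ ≤ _ := this
      _ = 2 ^ Fintype.card ι * (Real.exp (W / 2) * Real.exp (-(W / 2))) := by ring
      _ = _ := by rw [← Real.exp_add]; simp
  have := Real.log_le_log (Real.exp_pos _) h3
  rw [Real.log_exp] at this
  linarith

/-- The fraction of the bit strings with the property `p`. -/
noncomputable def frac (p : (ι → Bool) → Prop) : ℝ := by
  classical exact (#{z | p z} : ℝ) / 2 ^ Fintype.card ι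

theorem frac_nonneg (p : (ι → Bool) → Prop) : 0 ≤ frac p := by
  unfold frac; positivity

theorem frac_eq (p : (ι → Bool) → Prop) [DecidablePred p] :
    frac p = (∑ z : ι → Bool, if p z then (1 : ℝ) else 0) / 2 ^ Fintype.card ι := by
  unfold frac
  rw [Finset.sum_boole]
  congr!

theorem sum_frac_eq_one {Λ : Type*} [Fintype Λ] (F : (ι → Bool) → Λ) :
    ∑ π, frac (fun z => F z = π) = 1 := by
  classical
  simp only [frac_eq, ← Finset.sum_div]
  rw [Finset.sum_comm]
  simp

/-- Pinning a coordinate to its two values. -/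
theorem frac_eq_add (p : (ι → Bool) → Prop) (j : ι) :
    2 * frac p = frac (fun z => p (Function.update z j false)) +
      frac (fun z => p (Function.update z j true)) := by
  classical
  simp only [frac_eq]
  rw [← add_div, ← Finset.sum_add_distrib, mul_div_assoc']
  congr 1
  -- flipping the coordinate `j` is an involution of the strings
  have h : ∑ z : ι → Bool, (if p z then (1 : ℝ) else 0) =
      ∑ z : ι → Bool, if p (Function.update z j (!z j)) then (1 : ℝ) else 0 := by
    refine Finset.sum_bij' (fun z _ => Function.update z j (!z j))
      (fun z _ => Function.update z j (!z j)) ?_ ?_ ?_ ?_ ?_ <;> simp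
  rw [two_mul]
  nth_rw 2 [h]
  rw [← Finset.sum_add_distrib]
  refine Finset.sum_congr rfl fun z _ => ?_
  have hz := Function.update_eq_self j z
  cases hzj : z j <;> rw [hzj] at hz <;> simp [hz, add_comm]

theorem frac_update_eq_sum (p : (ι → Bool) → Prop) [DecidablePred p] (j : ι) (c : Bool) :
    frac (fun z => p (Function.update z j c)) =
      2 * (∑ z : ι → Bool, if p z ∧ z j = c then (1 : ℝ) else 0) / 2 ^ Fintype.card ι := by
  have h := frac_eq_add (fun z => p z ∧ z j = c) j
  have h0 : frac (fun z => p (Function.update z j c)) = 2 * frac (fun z => p z ∧ z j = c) := by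
    rw [h]
    have : frac (fun _ : ι → Bool => False) = 0 := by simp [frac]
    cases c <;> simp [this]
  rw [h0, frac_eq, mul_div_assoc']

/-- For a function of `K` uniform bits with `N` values, the squared Hellinger distances between its
two conditional laws given one of the bits add up to at most `4 log N`. -/
theorem sum_hellinger_le {Λ : Type*} [Fintype Λ] [Nonempty Λ] (F : (ι → Bool) → Λ) :
    ∑ j, ∑ π, (√(frac fun z => F (Function.update z j false) = π) -
      √(frac fun z => F (Function.update z j true) = π)) ^ 2 ≤
      4 * Real.log (Fintype.card Λ) := by
  classical
  have hN : (0 : ℝ) < Fintype.card Λ := by exact_mod_cast Fintype.card_pos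
  have hq : (0 : ℝ) < 2 ^ Fintype.card ι := by positivity
  rw [Finset.sum_comm]
  have key : ∀ π, ∑ j, (√(frac fun z => F (Function.update z j false) = π) -
      √(frac fun z => F (Function.update z j true) = π)) ^ 2 ≤
      4 * (frac (fun z => F z = π) * Real.log (Fintype.card Λ) +
        (1 / Fintype.card Λ - frac (fun z => F z = π))) := by
    intro π
    set p := frac (fun z => F z = π) with hp
    set s : Bool → ι → ℝ := fun c j => frac fun z => F (Function.update z j c) = π with hs
    have hsum : ∀ j, 2 * p = s false j + s true j := fun j =>
      frac_eq_add (fun z => F z = π) j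
    have hs0 : ∀ c j, 0 ≤ s c j := fun c j => frac_nonneg _
    rcases (frac_nonneg (fun z => F z = π)).eq_or_lt with h0 | h0
    · rw [← hp] at h0
      have : ∀ c j, s c j = 0 := by
        intro c j
        have := hsum j; have h1 := hs0 false j; have h2 := hs0 true j
        cases c <;> linarith
      simp only [hs] at this
      simp only [this, ← h0]
      simp
    rw [← hp] at h0
    set S : Finset (ι → Bool) := {z | F z = π} with hS
    have hpS : p = #S / 2 ^ Fintype.card ι := by
      rw [hp]; unfold frac; congr!
    have hSne : S.Nonempty := by
      rw [← Finset.card_pos]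
      by_contra h
      have : #S = 0 := by omega
      rw [hpS, this] at h0; simp at h0
    set b : ι → ℝ := fun j => (s true j - s false j) / (2 * p) with hbdef
    have hb : ∀ j, ∑ z ∈ S, bitSign (z j) = #S * b j := by
      intro j
      have e1 : ∀ c, s c j = 2 * (∑ z ∈ S, if z j = c then (1 : ℝ) else 0) /
          2 ^ Fintype.card ι := by
        intro c
        simp only [hs]
        rw [frac_update_eq_sum (fun z => F z = π), hS, Finset.sum_filter]
        congr 2
        exact Finset.sum_congr rfl fun z _ => by by_cases h1 : F z = π <;> simp [h1]
      have e2 : ∑ z ∈ S, bitSign (z j) = (∑ z ∈ S, if z j = true then (1 : ℝ) else 0) -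
          ∑ z ∈ S, if z j = false then (1 : ℝ) else 0 := by
        rw [← Finset.sum_sub_distrib]
        exact Finset.sum_congr rfl fun z _ => by cases z j <;> simp [bitSign]
      have hcS : (0 : ℝ) < #S := by exact_mod_cast hSne.card_pos
      simp only [hbdef]
      rw [e2, e1, e1, hpS]
      field_simp
    have hW := sum_sq_bias_le S hSne b hb
    have hlog : Real.log (2 ^ Fintype.card ι / #S) = Real.log p⁻¹ := by
      rw [hpS, inv_div]
    rw [hlog] at hW
    have hpoint : ∀ j, (√(s false j) - √(s true j)) ^ 2 ≤ 2 * p * b j ^ 2 := by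
      intro j
      have ha := Real.sq_sqrt (hs0 false j)
      have hb' := Real.sq_sqrt (hs0 true j)
      have na := Real.sqrt_nonneg (s false j)
      have nb := Real.sqrt_nonneg (s true j)
      have e : 2 * p * b j ^ 2 = (s true j - s false j) ^ 2 / (2 * p) := by
        simp only [hbdef]; field_simp
      rw [e, le_div_iff₀ (by linarith), hsum j]
      set u := √(s false j)
      set v := √(s true j)
      rw [← ha, ← hb']
      have : (v ^ 2 - u ^ 2) ^ 2 = (u - v) ^ 2 * (u + v) ^ 2 := by ring
      rw [this]
      gcongr
      nlinarith [mul_nonneg na nb]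
    have hent : p * Real.log p⁻¹ ≤ p * Real.log (Fintype.card Λ) +
        (1 / Fintype.card Λ - p) := by
      have h1 := Real.log_le_sub_one_of_pos (x := (Fintype.card Λ * p)⁻¹) (by positivity)
      rw [Real.log_inv, Real.log_mul hN.ne' h0.ne'] at h1
      have h2 := mul_le_mul_of_nonneg_left h1 h0.le
      rw [Real.log_inv]
      have h3 : p * ((Fintype.card Λ * p)⁻¹ - 1) = 1 / Fintype.card Λ - p := by
        field_simp
      rw [h3] at h2
      linarith
    calc _ ≤ ∑ j, 2 * p * b j ^ 2 := Finset.sum_le_sum fun j _ => hpoint j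
      _ = 2 * p * ∑ j, b j ^ 2 := by rw [Finset.mul_sum]
      _ ≤ 2 * p * (2 * Real.log p⁻¹) := by gcongr
      _ = 4 * (p * Real.log p⁻¹) := by ring
      _ ≤ _ := by gcongr
  calc _ ≤ ∑ π, 4 * (frac (fun z => F z = π) * Real.log (Fintype.card Λ) +
        (1 / Fintype.card Λ - frac (fun z => F z = π))) := Finset.sum_le_sum fun π _ => key π
    _ = _ := by
      rw [← Finset.mul_sum, Finset.sum_add_distrib, ← Finset.sum_mul, Finset.sum_sub_distrib,
        sum_frac_eq_one F]
      simp

/-- The cut-and-paste argument: if the four laws on `Λ` are products `a s π * b t π`,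
then an event distinguishes the laws `(1, 1)` and `(0, 0)` only if the Hellinger distance
between `(0, 0)` and `(1, 0)` or `(0, 1)` is large. -/
theorem sq_advantage_le {Λ : Type*} [Fintype Λ] (a b : Bool → Λ → ℝ)
    (ha : ∀ s π, 0 ≤ a s π) (hb : ∀ t π, 0 ≤ b t π) (h1 : ∀ s t, ∑ π, a s π * b t π = 1)
    (acc : Finset Λ) :
    (∑ π ∈ acc, (a true π * b true π - a false π * b false π)) ^ 2 ≤
      8 * (∑ π, (√(a false π * b false π) - √(a true π * b false π)) ^ 2 +
        ∑ π, (√(a false π * b false π) - √(a false π * b true π)) ^ 2) := by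
  set r : Bool → Bool → Λ → ℝ := fun s t π => √(a s π * b t π) with hr
  have hsq : ∀ s t π, r s t π ^ 2 = a s π * b t π := fun s t π =>
    Real.sq_sqrt (mul_nonneg (ha _ _) (hb _ _))
  have hr0 : ∀ s t π, 0 ≤ r s t π := fun s t π => Real.sqrt_nonneg _
  have hH : ∀ s t s' t', ∑ π, (r s t π - r s' t' π) ^ 2 = 2 - 2 * ∑ π, r s t π * r s' t' π := by
    intro s t s' t'
    have : ∀ π, (r s t π - r s' t' π) ^ 2 =
        a s π * b t π + a s' π * b t' π - 2 * (r s t π * r s' t' π) := by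
      intro π; rw [← hsq, ← hsq]; ring
    simp only [this]
    rw [Finset.sum_sub_distrib, Finset.sum_add_distrib, h1, h1, ← Finset.mul_sum]; ring
  have hcut : ∑ π, (r true true π - r false false π) ^ 2 =
      ∑ π, (r true false π - r false true π) ^ 2 := by
    rw [hH, hH]
    congr 2
    refine Finset.sum_congr rfl fun π _ => ?_
    simp only [hr]
    rw [← Real.sqrt_mul (mul_nonneg (ha _ _) (hb _ _)),
      ← Real.sqrt_mul (mul_nonneg (ha _ _) (hb _ _))]
    congr 1; ring
  have htri : ∑ π, (r true false π - r false true π) ^ 2 ≤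
      2 * (∑ π, (r false false π - r true false π) ^ 2 +
        ∑ π, (r false false π - r false true π) ^ 2) := by
    rw [← Finset.sum_add_distrib, Finset.mul_sum]
    refine Finset.sum_le_sum fun π _ => ?_
    nlinarith [sq_nonneg ((r false false π - r true false π) +
      (r false false π - r false true π))]
  have hcs : (∑ π ∈ acc, (a true π * b true π - a false π * b false π)) ^ 2 ≤
      4 * ∑ π, (r true true π - r false false π) ^ 2 := by
    calc _ = (∑ π ∈ acc, (r true true π - r false false π) *
          (r true true π + r false false π)) ^ 2 := by
          congr 1
          refine Finset.sum_congr rfl fun π _ => ?_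
          rw [← hsq, ← hsq]; ring
      _ ≤ (∑ π ∈ acc, (r true true π - r false false π) ^ 2) *
          ∑ π ∈ acc, (r true true π + r false false π) ^ 2 := Finset.sum_mul_sq_le_sq_mul_sq _ _ _
      _ ≤ (∑ π, (r true true π - r false false π) ^ 2) *
          ∑ π, (r true true π + r false false π) ^ 2 := by
          gcongr <;> exact Finset.subset_univ _
      _ ≤ (∑ π, (r true true π - r false false π) ^ 2) * 4 := by
          gcongr
          calc _ ≤ ∑ π, 2 * (a true π * b true π + a false π * b false π) := by
                refine Finset.sum_le_sum fun π _ => ?_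
                rw [← hsq, ← hsq]
                nlinarith [sq_nonneg (r true true π - r false false π)]
            _ = 4 := by
                rw [← Finset.mul_sum, Finset.sum_add_distrib, h1, h1]; norm_num
      _ = _ := mul_comm _ _
  rw [hcut] at hcs
  simp only [hr] at *
  linarith

/-- The string of the first player, when the coordinates of the uniform string `z` are handed to
the first player where `d` is `true` and to the second player elsewhere, all missing bits
being `false`, and the first player's bit of coordinate `j` is reset to `s`. -/
def firstInput (d : ι → Bool) (j : ι) (s : Bool) (z : ι → Bool) : ι → Bool :=
  Function.update (fun i => d i && z i) j s

/-- The string of the second player, with the bit of coordinate `j` reset to `t`;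
see `firstInput`. -/
def secondInput (d : ι → Bool) (j : ι) (t : Bool) (z : ι → Bool) : ι → Bool :=
  Function.update (fun i => !d i && z i) j t

/-- The inputs of the two players are independent. -/
theorem frac_and_eq_mul (d : ι → Bool) (f g : (ι → Bool) → Prop) :
    frac (fun z => f (fun i => d i && z i) ∧ g (fun i => !d i && z i)) =
      frac (fun z => f (fun i => d i && z i)) * frac (fun z => g (fun i => !d i && z i)) := by
  classical
  simp only [frac_eq]
  have hq : (0 : ℝ) < 2 ^ Fintype.card ι := by positivity
  rw [div_mul_div_comm, Finset.sum_mul_sum, div_eq_div_iff hq.ne' (by positivity)]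
  -- exchanging the coordinates outside `d` of two strings
  let mix : (ι → Bool) × (ι → Bool) → (ι → Bool) × (ι → Bool) := fun w =>
    (fun i => if d i then w.1 i else w.2 i, fun i => if d i then w.2 i else w.1 i)
  have hmix : ∀ w, mix (mix w) = w := by
    rintro ⟨u, v⟩
    simp only [mix]
    ext i <;> dsimp only <;> split <;> rfl
  have h : ∑ w : (ι → Bool) × (ι → Bool),
      (if f (fun i => d i && w.1 i) then (1 : ℝ) else 0) *
        (if g (fun i => !d i && w.2 i) then (1 : ℝ) else 0) =
      ∑ w : (ι → Bool) × (ι → Bool),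
        (if f (fun i => d i && w.1 i) ∧ g (fun i => !d i && w.1 i) then (1 : ℝ) else 0) := by
    refine Finset.sum_bij' (fun w _ => mix w) (fun w _ => mix w) (by simp) (by simp)
      (fun w _ => hmix w) (fun w _ => hmix w) ?_
    rintro ⟨u, v⟩ -
    have e1 : (fun i => d i && (mix (u, v)).1 i) = fun i => d i && u i := by
      ext i; simp only [mix]; cases d i <;> simp
    have e2 : (fun i => !d i && (mix (u, v)).1 i) = fun i => !d i && v i := by
      ext i; simp only [mix]; cases d i <;> simp
    dsimp only
    rw [e1, e2, ite_and]
    split_ifs <;> simp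
  rw [Fintype.sum_prod_type, Fintype.sum_prod_type] at h
  rw [h]
  have hc : ∀ c : (ι → Bool) → ℝ, ∑ u : ι → Bool, ∑ _v : ι → Bool, c u =
      2 ^ Fintype.card ι * ∑ u, c u := by
    intro c
    simp [Finset.mul_sum]
  rw [hc fun u => if f (fun i => d i && u i) ∧ g (fun i => !d i && u i) then 1 else 0]
  ring

set_option maxHeartbeats 400000 in
/-- The linear lower bound for unique set disjointness, for deterministic protocols: `leaf` is the
leaf reached by a protocol, so that the inputs reaching a leaf form a combinatorial rectangle. If
acceptance separates, in the mean, the inputs meeting in `j` from the disjoint inputs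
obtained by clearing the bits of `j`, then there are exponentially many leaves. -/
theorem card_le_log_of_advantage {Λ : Type*} [Fintype Λ]
    (leaf : (ι → Bool) → (ι → Bool) → Λ)
    (hrect : ∀ x y x' y', leaf x y = leaf x' y' → leaf x y' = leaf x y)
    (acc : Λ → Prop) [DecidablePred acc]
    (hadv : (Fintype.card ι : ℝ) * (2 ^ Fintype.card ι * 2 ^ Fintype.card ι) / 3 ≤
      ∑ j : ι, ∑ d : ι → Bool, ∑ z : ι → Bool,
        ((if acc (leaf (firstInput d j true z) (secondInput d j true z)) then (1 : ℝ) else 0) -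
          if acc (leaf (firstInput d j false z) (secondInput d j false z)) then 1 else 0)) :
    (Fintype.card ι : ℝ) ≤ 576 * Real.log (Fintype.card Λ) := by
  classical
  have : Nonempty Λ := ⟨leaf (fun _ => false) (fun _ => false)⟩
  set K : ℝ := (Fintype.card ι : ℝ) with hK
  set q : ℝ := 2 ^ Fintype.card ι with hq
  have hq0 : 0 < q := by positivity
  -- the rectangle of a leaf
  have hR : ∀ x y π, leaf x y = π ↔ (∃ y', leaf x y' = π) ∧ ∃ x', leaf x' y = π := by
    intro x y π
    refine ⟨fun h => ⟨⟨y, h⟩, ⟨x, h⟩⟩, ?_⟩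
    rintro ⟨⟨y', h1⟩, ⟨x', h2⟩⟩
    rw [hrect x y' x' y (h1.trans h2.symm), h1]
  let a : ι → (ι → Bool) → Bool → Λ → ℝ := fun j d s π =>
    frac fun z => ∃ y', leaf (firstInput d j s z) y' = π
  let b : ι → (ι → Bool) → Bool → Λ → ℝ := fun j d t π =>
    frac fun z => ∃ x', leaf x' (secondInput d j t z) = π
  have hprod : ∀ j d s t π,
      frac (fun z => leaf (firstInput d j s z) (secondInput d j t z) = π) =
        a j d s π * b j d t π := by
    intro j d s t π
    have e : (fun z => leaf (firstInput d j s z) (secondInput d j t z) = π) = fun z =>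
        (∃ y', leaf (firstInput d j s z) y' = π) ∧ ∃ x', leaf x' (secondInput d j t z) = π :=
      funext fun z => propext (hR _ _ π)
    rw [e]
    exact frac_and_eq_mul d (fun x => ∃ y', leaf (Function.update x j s) y' = π)
      (fun y => ∃ x', leaf x' (Function.update y j t) = π)
  let H10 : ι → (ι → Bool) → ℝ := fun j d =>
    ∑ π, (√(a j d false π * b j d false π) - √(a j d true π * b j d false π)) ^ 2
  let H01 : ι → (ι → Bool) → ℝ := fun j d =>
    ∑ π, (√(a j d false π * b j d false π) - √(a j d false π * b j d true π)) ^ 2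
  let Δ : ι → (ι → Bool) → ℝ := fun j d =>
    ∑ π with acc π, (a j d true π * b j d true π - a j d false π * b j d false π)
  have hΔ : ∀ j d, Δ j d ^ 2 ≤ 8 * (H10 j d + H01 j d) := by
    intro j d
    refine sq_advantage_le (a j d) (b j d) (fun _ _ => frac_nonneg _) (fun _ _ => frac_nonneg _)
      (fun s t => ?_) _
    simp only [← hprod]
    exact sum_frac_eq_one _
  have hΔsum : ∀ j d, ∑ z : ι → Bool,
      ((if acc (leaf (firstInput d j true z) (secondInput d j true z)) then (1 : ℝ) else 0) -
        if acc (leaf (firstInput d j false z) (secondInput d j false z)) then 1 else 0) =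
      q * Δ j d := by
    intro j d
    have e : ∀ s, ∑ z : ι → Bool,
        (if acc (leaf (firstInput d j s z) (secondInput d j s z)) then (1 : ℝ) else 0) =
        q * ∑ π with acc π, a j d s π * b j d s π := by
      intro s
      simp only [← hprod, frac_eq]
      rw [← Finset.sum_div, mul_div_cancel₀ _ hq0.ne', Finset.sum_comm]
      refine Finset.sum_congr rfl fun z _ => ?_
      simp
    rw [Finset.sum_sub_distrib, e, e, ← mul_sub, ← Finset.sum_sub_distrib]
  -- the laws do not depend on `d j`
  have hflip : ∀ j d c, a j (Function.update d j c) = a j d ∧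
      b j (Function.update d j c) = b j d := by
    intro j d c
    have e1 : firstInput (Function.update d j c) j = firstInput d j := by
      funext s z i
      by_cases h : i = j
      · subst h; simp [firstInput]
      · simp [firstInput, h]
    have e2 : secondInput (Function.update d j c) j = secondInput d j := by
      funext s z i
      by_cases h : i = j
      · subst h; simp [secondInput]
      · simp [secondInput, h]
    exact ⟨by simp only [a, e1], by simp only [b, e2]⟩
  have hd : ∀ d, ∑ j, (if d j then H10 j d else H01 j d) ≤ 4 * Real.log (Fintype.card Λ) := by
    intro d
    refine le_trans (le_of_eq ?_)
      (sum_hellinger_le fun z => leaf (fun i => d i && z i) (fun i => !d i && z i))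
    refine Finset.sum_congr rfl fun j _ => ?_
    have e : ∀ c, (fun z : ι → Bool => leaf (fun i => d i && Function.update z j c i)
        (fun i => !d i && Function.update z j c i)) =
        fun z => leaf (firstInput d j (d j && c) z) (secondInput d j (!d j && c) z) := by
      intro c
      funext z
      congr 1 <;> funext i <;> by_cases h : i = j
      · subst h; simp [firstInput]
      · simp [firstInput, h]
      · subst h; simp [secondInput]
      · simp [secondInput, h]
    have e' : ∀ c π, frac (fun z : ι → Bool => leaf (fun i => d i && Function.update z j c i)
        (fun i => !d i && Function.update z j c i) = π) =
        a j d (d j && c) π * b j d (!d j && c) π := by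
      intro c π
      rw [← hprod]
      congr 1; funext z
      rw [congrFun (e c) z]
    simp only [e']
    cases d j <;> simp [H10, H01]
  have hhalf : ∀ j, ∑ d, (H10 j d + H01 j d) = 2 * ∑ d, (if d j then H10 j d else H01 j d) := by
    intro j
    have h : ∑ d : ι → Bool, (if d j then H10 j d else H01 j d) =
        ∑ d : ι → Bool, if d j then H01 j d else H10 j d := by
      refine Finset.sum_bij' (fun d _ => Function.update d j (!d j))
        (fun d _ => Function.update d j (!d j)) ?_ ?_ ?_ ?_ ?_
      · simp
      · simp
      · simp
      · simp
      · intro d _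
        have : H10 j (Function.update d j (!d j)) = H10 j d ∧
            H01 j (Function.update d j (!d j)) = H01 j d := by
          simp only [H10, H01, (hflip j d _).1, (hflip j d _).2, and_self]
        rw [this.1, this.2]
        cases hdj : d j <;> simp
    rw [two_mul]
    nth_rw 2 [h]
    rw [← Finset.sum_add_distrib]
    refine Finset.sum_congr rfl fun d _ => ?_
    cases d j
    · rw [if_neg Bool.false_ne_true, if_neg Bool.false_ne_true, add_comm]
    · rw [if_pos rfl, if_pos rfl]
  have htotal : ∑ j, ∑ d, Δ j d ^ 2 ≤ 64 * q * Real.log (Fintype.card Λ) := by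
    calc _ ≤ ∑ j, ∑ d, 8 * (H10 j d + H01 j d) :=
          Finset.sum_le_sum fun j _ => Finset.sum_le_sum fun d _ => hΔ j d
      _ = 16 * ∑ j, ∑ d : ι → Bool, (if d j then H10 j d else H01 j d) := by
          rw [Finset.mul_sum]
          refine Finset.sum_congr rfl fun j _ => ?_
          rw [← Finset.mul_sum, hhalf]; ring
      _ = 16 * ∑ d : ι → Bool, ∑ j, (if d j then H10 j d else H01 j d) := by
          rw [Finset.sum_comm]
      _ ≤ 16 * ∑ d : ι → Bool, 4 * Real.log (Fintype.card Λ) := by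
          gcongr with d; exact hd d
      _ = _ := by
          simp [hq]; ring
  have hcs : (∑ j, ∑ d, Δ j d) ^ 2 ≤ K * q * ∑ j, ∑ d, Δ j d ^ 2 := by
    have := sq_sum_le_card_mul_sum_sq (s := (univ : Finset (ι × (ι → Bool))))
      (f := fun w => Δ w.1 w.2)
    rw [Fintype.sum_prod_type, Fintype.sum_prod_type] at this
    refine this.trans (le_of_eq ?_)
    simp [hK, hq]
  simp only [hΔsum, ← Finset.mul_sum] at hadv
  have h1 : K * q / 3 ≤ ∑ j, ∑ d, Δ j d := by
    refine le_of_mul_le_mul_left ?_ hq0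
    linarith
  have hK0 : 0 ≤ K := by positivity
  have hlog : 0 ≤ Real.log (Fintype.card Λ) := Real.log_natCast_nonneg _
  rcases hK0.eq_or_lt with h0 | h0
  · rw [← h0]; positivity
  have h2 : (K * q / 3) ^ 2 ≤ K * q * (64 * q * Real.log (Fintype.card Λ)) :=
    (pow_le_pow_left₀ (by positivity) h1 2).trans
      (hcs.trans (mul_le_mul_of_nonneg_left htotal (by positivity)))
  have h3 : (K * q ^ 2) * K ≤ (K * q ^ 2) * (576 * Real.log (Fintype.card Λ)) := by
    have e1 : (K * q / 3) ^ 2 = K * q ^ 2 * K / 9 := by ring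
    have e2 : K * q * (64 * q * Real.log (Fintype.card Λ)) =
        K * q ^ 2 * (576 * Real.log (Fintype.card Λ)) / 9 := by ring
    rw [e1, e2] at h2
    linarith
  exact le_of_mul_le_mul_left h3 (by positivity)

end Disjointness

/-! ### Simulating a CONGEST algorithm by two players -/

section Simulation

open MeasureTheory

namespace CongestAlgorithm

variable {n B : ℕ} {P : DistributedProblem n} (A : CongestAlgorithm P B)

open Classical in
/-- The message that travels from `u` to `v` in round `t + 1`. -/
noncomputable def message (G : P.Instance) (ω : Fin n → ℕ → Bool) (t : ℕ) (u v : Fin n) :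
    CongestMsg B :=
  if (P.network G).Adj u v then A.send u (P.localInput G u) (ω u) (A.history G ω t u) v
  else CongestMsg.silent B

theorem history_succ (G : P.Instance) (ω : Fin n → ℕ → Bool) (t : ℕ) (v : Fin n) :
    A.history G ω (t + 1) v = (fun u => A.message G ω t u v) :: A.history G ω t v := rfl

theorem measurableSet_history (G : P.Instance) (t : ℕ) :
    ∀ v h, MeasurableSet {ω | A.history G ω t v = h} := by
  have : Finite (CongestMsg B) := (List.finite_length_le Bool B).to_subtype
  induction t with
  | zero =>
    intro v h
    exact MeasurableSet.const ([] = h)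
  | succ t ih =>
    intro v h
    simp only [history_succ]
    cases h with
    | nil => simp
    | cons m h =>
      simp only [List.cons.injEq, funext_iff, Set.ofPred_and, Set.ofPred_forall]
      refine (MeasurableSet.iInter fun u => ?_).inter (ih v h)
      by_cases hadj : (P.network G).Adj u v
      · have e : {ω | A.message G ω t u v = m u} = ⋃ h', ({ω | A.history G ω t u = h'} ∩
            (fun ω : Fin n → ℕ → Bool => ω u) ⁻¹'
              {τ | A.send u (P.localInput G u) τ h' v = m u}) := by
          ext ω
          simp [message, hadj]
        rw [e]
        exact MeasurableSet.iUnion fun h' => (ih u h').inter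
          (measurable_pi_apply u (A.send_measurable _ _ _ _ _))
      · simp only [message, hadj, if_false]
        exact MeasurableSet.const (CongestMsg.silent B = m u)

theorem measurableSet_outputs [Countable (Fin n → P.Output)] (G : P.Instance) (T : ℕ)
    (p : (Fin n → P.Output) → Prop) : MeasurableSet {ω | p (A.outputs G ω T)} := by
  have : Finite (CongestMsg B) := (List.finite_length_le Bool B).to_subtype
  have h1 : ∀ v o, MeasurableSet {ω | A.outputs G ω T v = o} := by
    intro v o
    have e : {ω | A.outputs G ω T v = o} = ⋃ h', ({ω | A.history G ω T v = h'} ∩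
        (fun ω : Fin n → ℕ → Bool => ω v) ⁻¹'
          {τ | A.output v (P.localInput G v) τ h' = o}) := by
      ext ω
      simp [outputs]
    rw [e]
    exact MeasurableSet.iUnion fun h' => (A.measurableSet_history G T v h').inter
      (measurable_pi_apply v (A.output_measurable _ _ _ _))
  have e : {ω | p (A.outputs G ω T)} =
      ⋃ o ∈ {o | p o}, ⋂ v, {ω | A.outputs G ω T v = o v} := by
    ext ω
    simp only [Set.mem_ofPred_eq, Set.mem_iUnion, Set.mem_iInter, exists_prop, ← funext_iff]
    simp
  rw [e]
  exact MeasurableSet.biUnion (Set.to_countable _) fun o _ => MeasurableSet.iInter fun v => h1 v _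

end CongestAlgorithm

/-- A family of instances indexed by the inputs of two players. The first player controls
the vertices on whose side `side` is `true`: their local inputs and incident edges depend on `x`
only. The second player controls the other vertices. The ordered pairs `cut e`
include all pairs of vertices on different sides which may be adjacent. -/
structure TwoPartyFamily {n : ℕ} (P : DistributedProblem n) (X Y E : Type) where
  inst : X → Y → P.Instance
  side : Fin n → Bool
  cut : E → Fin n × Fin n
  valid : ∀ x y, P.valid (inst x y)
  localInput_first : ∀ x y y' v, side v = true →
    P.localInput (inst x y) v = P.localInput (inst x y') v
  localInput_second : ∀ x x' y v, side v = false →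
    P.localInput (inst x y) v = P.localInput (inst x' y) v
  adj_first : ∀ x y y' u v, side v = true →
    ((P.network (inst x y)).Adj u v ↔ (P.network (inst x y')).Adj u v)
  adj_second : ∀ x x' y u v, side v = false →
    ((P.network (inst x y)).Adj u v ↔ (P.network (inst x' y)).Adj u v)
  exists_cut : ∀ x y u v, (P.network (inst x y)).Adj u v → side u ≠ side v →
    ∃ e, cut e = (u, v)

namespace TwoPartyFamily

variable {n B : ℕ} {P : DistributedProblem n} {X Y E : Type} (F : TwoPartyFamily P X Y E)
  (A : CongestAlgorithm P B) (ω : Fin n → ℕ → Bool) (T : ℕ)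

/-- The messages that cross the cut in the first `T` rounds. -/
noncomputable def transcript (x : X) (y : Y) : E → Fin T → CongestMsg B := fun e t =>
  A.message (F.inst x y) ω t (F.cut e).1 (F.cut e).2

variable {A ω T}

variable {F} in
theorem message_eq_of_first {x : X} {y y' : Y} {t : ℕ} {u v : Fin n} (hu : F.side u = true)
    (hh : A.history (F.inst x y') ω t u = A.history (F.inst x y) ω t u) :
    A.message (F.inst x y') ω t u v = A.message (F.inst x y) ω t u v := by
  have hadj := F.adj_first x y' y v u hu
  rw [SimpleGraph.adj_comm, (P.network (F.inst x y)).adj_comm] at hadj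
  simp only [CongestAlgorithm.message, hh, F.localInput_first x y' y u hu]
  by_cases h : (P.network (F.inst x y')).Adj u v
  · rw [if_pos h, if_pos (hadj.1 h)]
  · rw [if_neg h, if_neg (mt hadj.2 h)]

variable {F} in
theorem message_eq_of_second {x x' : X} {y' : Y} {t : ℕ} {u v : Fin n} (hu : F.side u = false)
    (hh : A.history (F.inst x y') ω t u = A.history (F.inst x' y') ω t u) :
    A.message (F.inst x y') ω t u v = A.message (F.inst x' y') ω t u v := by
  have hadj := F.adj_second x x' y' v u hu
  rw [SimpleGraph.adj_comm, (P.network (F.inst x' y')).adj_comm] at hadj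
  simp only [CongestAlgorithm.message, hh, F.localInput_second x x' y' u hu]
  by_cases h : (P.network (F.inst x y')).Adj u v
  · rw [if_pos h, if_pos (hadj.1 h)]
  · rw [if_neg h, if_neg (mt hadj.2 h)]

/-- If two executions have the same transcript, then in the execution on the mixed inputs
each player sees what it sees in the execution that has its own input. -/
theorem history_mixed {x x' : X} {y y' : Y}
    (htr : F.transcript A ω T x y = F.transcript A ω T x' y') {t : ℕ} (ht : t ≤ T) :
    ∀ v, (F.side v = true → A.history (F.inst x y') ω t v = A.history (F.inst x y) ω t v) ∧
      (F.side v = false → A.history (F.inst x y') ω t v = A.history (F.inst x' y') ω t v) := by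
  induction t with
  | zero => intro v; exact ⟨fun _ => rfl, fun _ => rfl⟩
  | succ t ih =>
    have ih := ih (by omega)
    have hcut : ∀ u v, (∃ e, F.cut e = (u, v)) →
        A.message (F.inst x y) ω t u v = A.message (F.inst x' y') ω t u v := by
      rintro u v ⟨e, he⟩
      have := congrFun (congrFun htr e) ⟨t, ht⟩
      simpa [transcript, he] using this
    intro v
    simp only [CongestAlgorithm.history_succ, List.cons.injEq]
    refine ⟨fun hv => ⟨funext fun u => ?_, (ih v).1 hv⟩,
      fun hv => ⟨funext fun u => ?_, (ih v).2 hv⟩⟩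
    · cases hu : F.side u with
      | true => exact message_eq_of_first hu ((ih u).1 hu)
      | false =>
        rw [message_eq_of_second hu ((ih u).2 hu)]
        by_cases hadj : (P.network (F.inst x y')).Adj u v
        · exact (hcut u v (F.exists_cut x y' u v hadj (by simp [hu, hv]))).symm
        · have h1 := hadj
          rw [F.adj_first x y' y u v hv] at h1
          have h2 := hadj
          rw [SimpleGraph.adj_comm, F.adj_second x x' y' v u hu, SimpleGraph.adj_comm] at h2
          simp [CongestAlgorithm.message, h1, h2]
    · cases hu : F.side u with
      | false => exact message_eq_of_second hu ((ih u).2 hu)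
      | true =>
        rw [message_eq_of_first hu ((ih u).1 hu)]
        by_cases hadj : (P.network (F.inst x y')).Adj u v
        · exact hcut u v (F.exists_cut x y' u v hadj (by simp [hu, hv]))
        · have h1 := hadj
          rw [F.adj_second x x' y' u v hv] at h1
          have h2 := hadj
          rw [SimpleGraph.adj_comm, F.adj_first x y' y v u hu, SimpleGraph.adj_comm] at h2
          simp [CongestAlgorithm.message, h1, h2]

theorem transcript_mixed {x x' : X} {y y' : Y}
    (htr : F.transcript A ω T x y = F.transcript A ω T x' y') :
    F.transcript A ω T x y' = F.transcript A ω T x y := by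
  funext e t
  have hh := F.history_mixed htr t.2.le (F.cut e).1
  cases hu : F.side (F.cut e).1 with
  | true => exact message_eq_of_first hu (hh.1 hu)
  | false =>
    refine (message_eq_of_second hu (hh.2 hu)).trans ?_
    exact (congrFun (congrFun htr e) t).symm

theorem outputs_first {x x' : X} {y y' : Y}
    (htr : F.transcript A ω T x y = F.transcript A ω T x' y') {v : Fin n}
    (hv : F.side v = true) :
    A.outputs (F.inst x y') ω T v = A.outputs (F.inst x y) ω T v := by
  simp only [CongestAlgorithm.outputs, (F.history_mixed htr le_rfl v).1 hv,
    F.localInput_first x y' y v hv]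

theorem outputs_second {x x' : X} {y y' : Y}
    (htr : F.transcript A ω T x y = F.transcript A ω T x' y') {v : Fin n}
    (hv : F.side v = false) :
    A.outputs (F.inst x y') ω T v = A.outputs (F.inst x' y') ω T v := by
  simp only [CongestAlgorithm.outputs, (F.history_mixed htr le_rfl v).2 hv,
    F.localInput_second x x' y' v hv]

end TwoPartyFamily

/-- A rule by which the two players learn from the outputs of their vertices whether their input
sets meet: the first player announces `announce x o`, the second player answers. -/
structure DisjointnessReduction {n : ℕ} (P : DistributedProblem n) (ι E Λ : Type) extends
    TwoPartyFamily P (ι → Bool) (ι → Bool) E where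
  announce : (ι → Bool) → (Fin n → P.Output) → Λ
  answer : (ι → Bool) → (Fin n → P.Output) → Λ → Bool
  announce_congr : ∀ x o o', (∀ v, side v = true → o v = o' v) → announce x o = announce x o'
  answer_congr : ∀ y o o' a, (∀ v, side v = false → o v = o' v) → answer y o a = answer y o' a
  answer_iff : ∀ x y o, P.correct (inst x y) o →
    (answer y o (announce x o) = true ↔ ∃ i, x i = true ∧ y i = true)

theorem card_congestMsg_le (B : ℕ) : Nat.card (CongestMsg B) ≤ 2 ^ (B + 1) := by
  -- a string is padded by a `true` and then by `false`s
  let f : CongestMsg B → (Fin (B + 1) → Bool) := fun w i =>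
    (w.1 ++ [true]).getD i false
  have hf : Function.Injective f := by
    rintro ⟨w, hw⟩ ⟨w', hw'⟩ h
    have hget : ∀ i, (w ++ [true]).getD i false = (w' ++ [true]).getD i false := by
      intro i
      by_cases hi : i < B + 1
      · exact congrFun h ⟨i, hi⟩
      · rw [List.getD_eq_default, List.getD_eq_default] <;> simp <;> omega
    have hlen : w.length = w'.length := by
      rcases lt_trichotomy w.length w'.length with hlt | heq | hlt
      · have := hget w'.length
        rw [List.getD_eq_default _ _ (by simp; omega)] at this
        simp at this
      · exact heq
      · have := hget w.length
        rw [List.getD_eq_default (w' ++ [true]) _ (by simp; omega)] at this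
        simp at this
    refine Subtype.ext (List.ext_getElem hlen fun i h1 h2 => ?_)
    have := hget i
    simpa [List.getD_eq_getElem?_getD, List.getElem?_append, h1, h2] using this
  calc _ ≤ Nat.card (Fin (B + 1) → Bool) := Nat.card_le_card_of_injective f hf
    _ = _ := by simp

namespace DisjointnessReduction

variable {n B : ℕ} {P : DistributedProblem n} {ι E Λ : Type} [Fintype ι] [DecidableEq ι]
  (F : DisjointnessReduction P ι E Λ) (A : CongestAlgorithm P B)

/-- The answer of the second player when the algorithm is simulated. -/
noncomputable def verdict (T : ℕ) (ω : Fin n → ℕ → Bool) (x y : ι → Bool) : Bool :=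
  F.answer y (A.outputs (F.inst x y) ω T) (F.announce x (A.outputs (F.inst x y) ω T))

/-- Some outcome of the random tapes does at least as well as the average on the hard
distribution of set disjointness. -/
theorem exists_tapes_advantage [Countable (Fin n → P.Output)] {T : ℕ} (hA : A.Solves T) :
    ∃ ω, (Fintype.card ι : ℝ) * (2 ^ Fintype.card ι * 2 ^ Fintype.card ι) / 3 ≤
      ∑ j : ι, ∑ d : ι → Bool, ∑ z : ι → Bool,
        ((if F.verdict A T ω (firstInput d j true z) (secondInput d j true z) = true
            then (1 : ℝ) else 0) -
          if F.verdict A T ω (firstInput d j false z) (secondInput d j false z) = true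
            then 1 else 0) := by
  have := A.law_prob
  have hmeas : ∀ x y, MeasurableSet {ω | F.verdict A T ω x y = true} := fun x y =>
    A.measurableSet_outputs (F.inst x y) T
      fun o => F.answer y o (F.announce x o) = true
  have hint : ∀ x y, Integrable
      (fun ω => if F.verdict A T ω x y = true then (1 : ℝ) else 0) A.law := by
    intro x y
    have : (fun ω => if F.verdict A T ω x y = true then (1 : ℝ) else 0) =
        Set.indicator {ω | F.verdict A T ω x y = true} fun _ => 1 := by
      funext ω; simp [Set.indicator]
    rw [this]
    exact (integrable_const _).indicator (hmeas x y)
  have hval : ∀ x y, ∫ ω, (if F.verdict A T ω x y = true then (1 : ℝ) else 0) ∂A.law =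
      A.law.real {ω | F.verdict A T ω x y = true} := by
    intro x y
    have : (fun ω => if F.verdict A T ω x y = true then (1 : ℝ) else 0) =
        Set.indicator {ω | F.verdict A T ω x y = true} 1 := by
      funext ω; simp [Set.indicator]
    rw [this, integral_indicator_one (hmeas x y)]
  have hyes : ∀ x y, (∃ i, x i = true ∧ y i = true) →
      2 / 3 ≤ A.law.real {ω | F.verdict A T ω x y = true} := by
    intro x y hxy
    refine (hA _ (F.valid x y)).trans (measureReal_mono ?_)
    exact fun ω hω => (F.answer_iff x y _ hω).2 hxy
  have hno : ∀ x y, (¬ ∃ i, x i = true ∧ y i = true) →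
      A.law.real {ω | F.verdict A T ω x y = true} ≤ 1 / 3 := by
    intro x y hxy
    have h1 : 2 / 3 ≤ A.law.real {ω | F.verdict A T ω x y = true}ᶜ := by
      refine (hA _ (F.valid x y)).trans (measureReal_mono ?_)
      exact fun ω hω h => hxy ((F.answer_iff x y _ hω).1 h)
    rw [probReal_compl_eq_one_sub (hmeas x y)] at h1
    linarith
  let V : (Fin n → ℕ → Bool) → ℝ := fun ω => ∑ j : ι, ∑ d : ι → Bool, ∑ z : ι → Bool,
        ((if F.verdict A T ω (firstInput d j true z) (secondInput d j true z) = true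
            then (1 : ℝ) else 0) -
          if F.verdict A T ω (firstInput d j false z) (secondInput d j false z) = true
            then 1 else 0)
  have hV1 : ∀ j d z, Integrable (fun ω =>
        ((if F.verdict A T ω (firstInput d j true z) (secondInput d j true z) = true
            then (1 : ℝ) else 0) -
          if F.verdict A T ω (firstInput d j false z) (secondInput d j false z) = true
            then 1 else 0)) A.law := fun j d z => (hint _ _).sub (hint _ _)
  have hV2 : ∀ j d, Integrable (fun ω => ∑ z : ι → Bool,
        ((if F.verdict A T ω (firstInput d j true z) (secondInput d j true z) = true
            then (1 : ℝ) else 0) -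
          if F.verdict A T ω (firstInput d j false z) (secondInput d j false z) = true
            then 1 else 0)) A.law :=
    fun j d => integrable_finsetSum _ fun z _ => hV1 j d z
  have hV3 : ∀ j, Integrable (fun ω => ∑ d : ι → Bool, ∑ z : ι → Bool,
        ((if F.verdict A T ω (firstInput d j true z) (secondInput d j true z) = true
            then (1 : ℝ) else 0) -
          if F.verdict A T ω (firstInput d j false z) (secondInput d j false z) = true
            then 1 else 0)) A.law :=
    fun j => integrable_finsetSum _ fun d _ => hV2 j d
  have hV : Integrable V A.law := integrable_finsetSum _ fun j _ => hV3 j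
  obtain ⟨ω, hω⟩ := exists_integral_le hV
  refine ⟨ω, le_trans ?_ hω⟩
  simp only [V]
  rw [integral_finsetSum _ fun j _ => hV3 j]
  calc (Fintype.card ι : ℝ) * (2 ^ Fintype.card ι * 2 ^ Fintype.card ι) / 3 =
      ∑ j : ι, ∑ d : ι → Bool, ∑ z : ι → Bool, (1 / 3 : ℝ) := by
        simp; ring
    _ ≤ _ := by
      refine Finset.sum_le_sum fun j _ => ?_
      rw [integral_finsetSum _ fun d _ => hV2 j d]
      refine Finset.sum_le_sum fun d _ => ?_
      rw [integral_finsetSum _ fun z _ => hV1 j d z]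
      refine Finset.sum_le_sum fun z _ => ?_
      rw [integral_sub (hint _ _) (hint _ _), hval, hval]
      have h1 := hyes (firstInput d j true z) (secondInput d j true z)
        ⟨j, by simp [firstInput], by simp [secondInput]⟩
      have h2 := hno (firstInput d j false z) (secondInput d j false z) (by
        rintro ⟨i, hi, hi'⟩
        by_cases h : i = j
        · subst h; simp [firstInput] at hi
        · simp only [firstInput, secondInput, ne_eq, h, not_false_eq_true,
            Function.update_of_ne] at hi hi'
          cases hd : d i <;> simp [hd] at hi hi')
      linarith

/-- The number of rounds times the capacity of the cut is linear in the size of the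
disjointness instance. -/
theorem card_le_of_solves (F : DisjointnessReduction P ι E Λ) (A : CongestAlgorithm P B)
    [Fintype E] [Fintype Λ] [Countable (Fin n → P.Output)] {T : ℕ} (hA : A.Solves T) :
    (Fintype.card ι : ℝ) ≤ 576 * (Fintype.card E * T * (B + 1) * Real.log 2 +
      Real.log (Fintype.card Λ) + Real.log 2) := by
  classical
  obtain ⟨ω, hω⟩ := F.exists_tapes_advantage A hA
  have hfin : Finite (CongestMsg B) := (List.finite_length_le Bool B).to_subtype
  let _ : Fintype (CongestMsg B) := Fintype.ofFinite _
  let tr := F.transcript A ω T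
  let ann : (ι → Bool) → (ι → Bool) → Λ := fun x y =>
    F.announce x (A.outputs (F.inst x y) ω T)
  let leaf : (ι → Bool) → (ι → Bool) → ((E → Fin T → CongestMsg B) × Λ) × Bool := fun x y =>
    ((tr x y, ann x y), F.verdict A T ω x y)
  have hrect : ∀ x y x' y', leaf x y = leaf x' y' → leaf x y' = leaf x y := by
    intro x y x' y' h
    simp only [leaf, Prod.mk.injEq] at h
    obtain ⟨⟨h1, h2⟩, h3⟩ := h
    have e1 : tr x y' = tr x y := F.transcript_mixed h1
    have e2 : ann x y' = ann x y := F.announce_congr _ _ _ fun v hv => F.outputs_first h1 hv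
    have e3 : F.verdict A T ω x y' = F.verdict A T ω x' y' := by
      have : ann x y' = ann x' y' := e2.trans h2
      simp only [ann] at this
      simp only [verdict, this]
      exact F.answer_congr _ _ _ _ fun v hv => F.outputs_second h1 hv
    simp only [leaf, e1, e2, e3, h3]
  have hmain := card_le_log_of_advantage leaf hrect (fun l => l.2 = true) (by
    simpa only [leaf] using hω)
  have hΛ : Nonempty Λ := ⟨ann (fun _ => false) fun _ => false⟩
  have hM : Nonempty (CongestMsg B) := ⟨CongestMsg.silent B⟩
  have hΛ0 : (Fintype.card Λ : ℝ) ≠ 0 := by exact_mod_cast Fintype.card_ne_zero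
  have hM0 : (0 : ℝ) < Fintype.card (CongestMsg B) := by exact_mod_cast Fintype.card_pos
  refine hmain.trans ?_
  gcongr
  rw [Fintype.card_prod, Fintype.card_prod, Fintype.card_fun, Fintype.card_fun, Fintype.card_bool,
    Fintype.card_fin]
  push_cast
  rw [Real.log_mul (by positivity) (by norm_num), Real.log_mul (by positivity) hΛ0,
    ← pow_mul, Real.log_pow]
  have h1 : Real.log (Fintype.card (CongestMsg B)) ≤ (B + 1) * Real.log 2 := by
    have := card_congestMsg_le B
    rw [Nat.card_eq_fintype_card] at this
    have h2 : (Fintype.card (CongestMsg B) : ℝ) ≤ 2 ^ (B + 1) := by exact_mod_cast this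
    have := Real.log_le_log hM0 h2
    rw [Real.log_pow] at this
    push_cast at this
    exact this
  have h2 := mul_le_mul_of_nonneg_left h1
    (by positivity : (0 : ℝ) ≤ Fintype.card E * T)
  push_cast
  linarith

end DisjointnessReduction

end Simulation

/-! ### The directed gadget -/

/-- A clause vertex: the player it belongs to (`true` is the first player), which of the two indices
it concerns, and a value of that index, in binary. -/
abbrev Clause (l : ℕ) : Type := Bool × Bool × (Fin l → Bool)

/-- The vertices of the directed gadget for pairs of `l`-bit indices. Each of the `2 * l` bits of a
pair has a row, a chain of vertices the traversal direction of which is the value of the bit;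
`gate ρ` precedes row `ρ` and `gate (2 * l)` follows all rows. -/
inductive GadgetVertex (l : ℕ) : Type
  | gate (ρ : Fin (2 * l + 1))
  | chain (ρ : Fin (2 * l)) (u : Fin (12 * 2 ^ l + 3))
  | clause (c : Clause l)
  | link (e : Fin 3)
  deriving DecidableEq

namespace GadgetVertex

variable {l : ℕ}

/-- The index and the bit of the index that a row stands for. -/
noncomputable def rowBit : Fin (2 * l) ≃ Bool × Fin l :=
  (Fintype.equivFinOfCardEq (by simp)).symm

/-- The number of the cell that each row has for the clause. The cells of the first player
come first. -/
noncomputable def cell (c : Clause l) : ℕ :=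
  (if c.1 then 0 else 2 * 2 ^ l) +
    (Fintype.equivFinOfCardEq (by simp) : Bool × (Fin l → Bool) ≃ Fin (2 * 2 ^ l)) c.2

theorem cell_injective : Function.Injective (cell (l := l)) := by
  rintro ⟨s, c⟩ ⟨s', c'⟩ h
  have h1 := ((Fintype.equivFinOfCardEq (by simp) : Bool × (Fin l → Bool) ≃ Fin (2 * 2 ^ l)) c).2
  have h2 := ((Fintype.equivFinOfCardEq (by simp) : Bool × (Fin l → Bool) ≃ Fin (2 * 2 ^ l)) c').2
  simp only [cell] at h
  have hs : s = s' := by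
    cases s <;> cases s' <;> simp at h ⊢ <;> omega
  subst hs
  have := Fin.ext (Nat.add_left_cancel h)
  rw [EmbeddingLike.apply_eq_iff_eq] at this
  rw [this]

theorem cell_lt (c : Clause l) : cell c < 4 * 2 ^ l := by
  have h1 := ((Fintype.equivFinOfCardEq (by simp) : Bool × (Fin l → Bool) ≃ Fin (2 * 2 ^ l)) c.2).2
  simp only [cell]
  split <;> omega

theorem cell_lt_iff (c : Clause l) : cell c < 2 * 2 ^ l ↔ c.1 = true := by
  have h1 := ((Fintype.equivFinOfCardEq (by simp) : Bool × (Fin l → Bool) ≃ Fin (2 * 2 ^ l)) c.2).2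
  simp only [cell]
  split <;> simp_all

/-- The direction (`true` is upwards) in which the row can visit the clause vertex, if any.
The clause says that its index differs from the one described by the rows. -/
noncomputable def literal (ρ : Fin (2 * l)) (c : Clause l) : Option Bool :=
  if (rowBit ρ).1 = c.2.1 then some (!c.2.2 (rowBit ρ).2) else none

/-- The arcs of the gadget. Cell `t` of a row consists of positions `3 * t + 2` and `3 * t + 3`,
with separators below and above, and can make a detour through its clause vertex. -/
def Arc (x y : (Fin l → Bool) × (Fin l → Bool) → Bool) : GadgetVertex l → GadgetVertex l → Prop
  | gate ρ, chain ρ' u => ρ.val = ρ'.val ∧ (u.val = 0 ∨ u.val = 12 * 2 ^ l + 2)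
  | gate ρ, clause c => ρ.val = 2 * l ∧ c.1 = true ∧ c.2.1 = false
  | chain ρ u, gate ρ' => ρ'.val = ρ.val + 1 ∧ (u.val = 0 ∨ u.val = 12 * 2 ^ l + 2)
  | chain ρ u, chain ρ' u' => ρ = ρ' ∧ (u.val + 1 = u'.val ∨ u'.val + 1 = u.val)
  | chain ρ u, clause c => (literal ρ c = some true ∧ u.val = 3 * cell c + 2) ∨
      (literal ρ c = some false ∧ u.val = 3 * cell c + 3)
  | clause c, chain ρ u => (literal ρ c = some true ∧ u.val = 3 * cell c + 3) ∨
      (literal ρ c = some false ∧ u.val = 3 * cell c + 2)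
  | clause c, clause c' => c.1 = c'.1 ∧ c.2.1 = false ∧ c'.2.1 = true ∧
      (if c.1 then x else y) (c.2.2, c'.2.2) = true
  | clause c, link e => c.2.1 = true ∧ ((c.1 = true ∧ e = 0) ∨ (c.1 = false ∧ e = 2))
  | link e, link e' => e = 0 ∧ e' = 1
  | link e, clause c => e = 1 ∧ c.1 = false ∧ c.2.1 = false
  | _, _ => False

/-- The vertex at position `u` of a row. -/
def pos (ρ : Fin (2 * l)) (u : ℕ) : GadgetVertex l := chain ρ (Fin.ofNat _ u)

theorem pos_eq_chain {ρ ρ' : Fin (2 * l)} {u : ℕ} {v : Fin (12 * 2 ^ l + 3)}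
    (hu : u < 12 * 2 ^ l + 3) : pos ρ u = chain ρ' v ↔ ρ = ρ' ∧ u = v.val := by
  simp [pos, Fin.ext_iff, Fin.ofNat, Nat.mod_eq_of_lt hu]

theorem chain_eq_pos {ρ : Fin (2 * l)} {v : Fin (12 * 2 ^ l + 3)} : chain ρ v = pos ρ v.val :=
  ((pos_eq_chain v.2).2 ⟨rfl, rfl⟩).symm

theorem pos_inj {ρ ρ' : Fin (2 * l)} {u v : ℕ} (hu : u < 12 * 2 ^ l + 3)
    (hv : v < 12 * 2 ^ l + 3) : pos ρ u = pos ρ' v ↔ ρ = ρ' ∧ u = v := by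
  simp [pos, Fin.ext_iff, Fin.ofNat, Nat.mod_eq_of_lt hu, Nat.mod_eq_of_lt hv]

variable {x y : (Fin l → Bool) × (Fin l → Bool) → Bool}

theorem arc_pos_clause {ρ : Fin (2 * l)} {u : ℕ} {c : Clause l} (hu : u < 12 * 2 ^ l + 3) :
    Arc x y (pos ρ u) (clause c) ↔ (literal ρ c = some true ∧ u = 3 * cell c + 2) ∨
      (literal ρ c = some false ∧ u = 3 * cell c + 3) := by
  simp [pos, Arc, Fin.ofNat, Nat.mod_eq_of_lt hu]

theorem arc_clause_pos {ρ : Fin (2 * l)} {u : ℕ} {c : Clause l} (hu : u < 12 * 2 ^ l + 3) :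
    Arc x y (clause c) (pos ρ u) ↔ (literal ρ c = some true ∧ u = 3 * cell c + 3) ∨
      (literal ρ c = some false ∧ u = 3 * cell c + 2) := by
  simp [pos, Arc, Fin.ofNat, Nat.mod_eq_of_lt hu]

theorem arc_pos_pos {ρ : Fin (2 * l)} {u v : ℕ} (hu : u < 12 * 2 ^ l + 3)
    (hv : v < 12 * 2 ^ l + 3) : Arc x y (pos ρ u) (pos ρ v) ↔ u + 1 = v ∨ v + 1 = u := by
  simp [pos, Arc, Fin.ofNat, Nat.mod_eq_of_lt hu, Nat.mod_eq_of_lt hv]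

end GadgetVertex

/-- The successor relation of a cyclic arrangement that has no cycle of length two. -/
structure IsSuccessor {V : Type*} (N : V → V → Prop) : Prop where
  exists_right : ∀ v, ∃ w, N v w
  exists_left : ∀ w, ∃ v, N v w
  right_unique : ∀ {v w w'}, N v w → N v w' → w = w'
  left_unique : ∀ {v v' w}, N v w → N v' w → v = v'
  asymm : ∀ {v w}, N v w → ¬ N w v

namespace IsSuccessor

variable {V : Type*} {N : V → V → Prop} (hN : IsSuccessor N)
include hN

/-- A separator with the two neighbours `a` and `p` is passed in one of the two directions. -/
theorem separator {a b p : V} (ho : ∀ w, N b w → w = a ∨ w = p)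
    (hi : ∀ w, N w b → w = a ∨ w = p) : (N a b ∧ N b p) ∨ (N p b ∧ N b a) := by
  obtain ⟨w, hw⟩ := hN.exists_right b
  obtain ⟨v, hv⟩ := hN.exists_left b
  rcases ho w hw with rfl | rfl <;> rcases hi v hv with rfl | rfl
  · exact absurd hw (hN.asymm hv)
  · exact Or.inr ⟨hv, hw⟩
  · exact Or.inl ⟨hv, hw⟩
  · exact absurd hw (hN.asymm hv)

/-- A cell `p`, `q` between separators `b` and `r`, in which a detour from `p` to `q` through the
vertices in `C` (at most one vertex) may be possible: it is traversed in the same direction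
at both ends, and a clause vertex is visited only by a complete detour in the direction
from `p` to `q`. -/
theorem cell_traversal {b p q r : V} {C : V → Prop} (hbp : N b p ∨ N p b) (hqr : N q r ∨ N r q)
    (hpo : ∀ w, N p w → w = b ∨ w = q ∨ C w) (hpi : ∀ w, N w p → w = b ∨ w = q)
    (hqo : ∀ w, N q w → w = p ∨ w = r) (hqi : ∀ w, N w q → w = p ∨ w = r ∨ C w)
    (hC : ∀ v w, C v → C w → v = w) (hCb : ¬ C b) (hCp : ¬ C p) (hCq : ¬ C q) (hCr : ¬ C r)
    (hbq : b ≠ q) (hpr : p ≠ r) :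
    (N b p → N q r) ∧ (N p b → N r q) ∧ (∀ w, C w → N p w → N b p ∧ N w q) ∧
      ∀ w, C w → N w q → N b p ∧ N p w := by
  have A1 : N b p → N q r := by
    intro h
    refine hqr.resolve_right fun h' => ?_
    obtain ⟨w, hw⟩ := hN.exists_right q
    rcases hqo w hw with rfl | rfl
    · exact hbq (hN.left_unique h hw)
    · exact hN.asymm h' hw
  have A2 : N p b → N r q := by
    intro h
    refine hqr.resolve_left fun h' => ?_
    obtain ⟨w, hw⟩ := hN.exists_left p
    rcases hpi w hw with rfl | rfl
    · exact hN.asymm h hw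
    · exact hpr (hN.right_unique hw h')
  refine ⟨A1, A2, fun w hCw hw => ?_, fun w hCw hw => ?_⟩
  · have h1 : N b p := hbp.resolve_right fun h => by
      rw [hN.right_unique hw h] at hCw; exact hCb hCw
    refine ⟨h1, ?_⟩
    obtain ⟨v, hv⟩ := hN.exists_left q
    rcases hqi v hv with rfl | rfl | hv'
    · rw [hN.right_unique hw hv] at hCw; exact absurd hCw hCq
    · exact absurd hv (hN.asymm (A1 h1))
    · rw [hC w v hCw hv']; exact hv
  · have h1 : N b p := hbp.resolve_right fun h => by
      rw [hN.left_unique hw (A2 h)] at hCw; exact hCr hCw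
    refine ⟨h1, ?_⟩
    obtain ⟨v, hv⟩ := hN.exists_right p
    rcases hpo v hv with rfl | rfl | hv'
    · exact absurd hv (hN.asymm h1)
    · rw [hN.left_unique hw hv] at hCw; exact absurd hCw hCp
    · rw [hC w v hCw hv']; exact hv

end IsSuccessor

namespace GadgetVertex

variable {l : ℕ} {x y : (Fin l → Bool) × (Fin l → Bool) → Bool}
  {N : GadgetVertex l → GadgetVertex l → Prop}

section Soundness

variable (hN : IsSuccessor N)
  (harc : ∀ v w, N v w → Arc x y v w ∨ (v = link 2 ∧ w = gate 0))
include harc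

theorem next_pos {ρ : Fin (2 * l)} {u : ℕ} (hu : u + 1 < 12 * 2 ^ l + 2) {w : GadgetVertex l}
    (hw : N (pos ρ (u + 1)) w) : w = pos ρ u ∨ w = pos ρ (u + 2) ∨
      ∃ c, w = clause c ∧ Arc x y (pos ρ (u + 1)) (clause c) := by
  rcases harc _ _ hw with h | ⟨h, -⟩
  · cases w with
    | gate ρ' =>
      simp [pos, Arc, Fin.ofNat, Nat.mod_eq_of_lt (show u + 1 < 12 * 2 ^ l + 3 by omega)] at h
      omega
    | chain ρ' v =>
      rw [chain_eq_pos] at h ⊢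
      have hρ := h
      obtain ⟨rfl, -⟩ := hρ
      rw [arc_pos_pos (by omega) v.2] at h
      rcases h with h | h
      · right; left; rw [← h]
      · left; congr 1; omega
    | clause c => exact Or.inr (Or.inr ⟨c, rfl, h⟩)
    | link e => exact h.elim
  · simp [pos] at h

theorem prev_pos {ρ : Fin (2 * l)} {u : ℕ} (hu : u + 1 < 12 * 2 ^ l + 2) {w : GadgetVertex l}
    (hw : N w (pos ρ (u + 1))) : w = pos ρ u ∨ w = pos ρ (u + 2) ∨
      ∃ c, w = clause c ∧ Arc x y (clause c) (pos ρ (u + 1)) := by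
  rcases harc _ _ hw with h | ⟨-, h⟩
  · cases w with
    | gate ρ' =>
      simp [pos, Arc, Fin.ofNat, Nat.mod_eq_of_lt (show u + 1 < 12 * 2 ^ l + 3 by omega)] at h
      omega
    | chain ρ' v =>
      rw [chain_eq_pos] at h ⊢
      have hρ := h
      obtain ⟨rfl, -⟩ := hρ
      rw [arc_pos_pos v.2 (by omega)] at h
      rcases h with h | h
      · left; congr 1; omega
      · right; left; rw [← h]
    | clause c => exact Or.inr (Or.inr ⟨c, rfl, h⟩)
    | link e => exact h.elim
  · simp [pos] at h

include hN

theorem separator_pos {ρ : Fin (2 * l)} {t : ℕ} (ht : t ≤ 4 * 2 ^ l) :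
    (N (pos ρ (3 * t)) (pos ρ (3 * t + 1)) ∧ N (pos ρ (3 * t + 1)) (pos ρ (3 * t + 2))) ∨
    (N (pos ρ (3 * t + 2)) (pos ρ (3 * t + 1)) ∧ N (pos ρ (3 * t + 1)) (pos ρ (3 * t))) := by
  refine hN.separator (fun w hw => ?_) fun w hw => ?_
  · rcases next_pos harc (by omega) hw with h | h | ⟨c, -, hc⟩
    · exact Or.inl h
    · exact Or.inr h
    · rw [arc_pos_clause (by omega)] at hc; omega
  · rcases prev_pos harc (by omega) hw with h | h | ⟨c, -, hc⟩
    · exact Or.inl h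
    · exact Or.inr h
    · rw [arc_clause_pos (by omega)] at hc; omega

/-- The traversal of cell `t` of a row: the direction is the same at both ends, and the clause
vertex of the cell is visited only in the direction of its literal. -/
theorem cell_pos {ρ : Fin (2 * l)} {t : ℕ} (ht : t < 4 * 2 ^ l) :
    (N (pos ρ (3 * t + 1)) (pos ρ (3 * t + 2)) → N (pos ρ (3 * t + 3)) (pos ρ (3 * t + 4))) ∧
    (N (pos ρ (3 * t + 2)) (pos ρ (3 * t + 1)) → N (pos ρ (3 * t + 4)) (pos ρ (3 * t + 3))) ∧
    ∀ c, cell c = t → ∀ u : Fin (12 * 2 ^ l + 3),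
      (N (chain ρ u) (clause c) ∨ N (clause c) (chain ρ u)) →
      (∃ v, N (chain ρ v) (clause c)) ∧ (∃ v, N (clause c) (chain ρ v)) ∧
      ((literal ρ c = some true ∧ N (pos ρ (3 * t + 1)) (pos ρ (3 * t + 2))) ∨
        (literal ρ c = some false ∧ N (pos ρ (3 * t + 2)) (pos ρ (3 * t + 1)))) := by
  have hsep := separator_pos hN harc (ρ := ρ) (t := t) ht.le
  have hsep' := separator_pos hN harc (ρ := ρ) (t := t + 1) ht
  rw [show 3 * (t + 1) = 3 * t + 3 by ring] at hsep'
  have hbp : N (pos ρ (3 * t + 1)) (pos ρ (3 * t + 2)) ∨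
      N (pos ρ (3 * t + 2)) (pos ρ (3 * t + 1)) := hsep.imp (·.2) (·.1)
  have hqr : N (pos ρ (3 * t + 3)) (pos ρ (3 * t + 4)) ∨
      N (pos ρ (3 * t + 4)) (pos ρ (3 * t + 3)) := hsep'.imp (·.1) (·.2)
  have hpo : ∀ w, N (pos ρ (3 * t + 2)) w → w = pos ρ (3 * t + 1) ∨ w = pos ρ (3 * t + 3) ∨
      ∃ c, w = clause c ∧ cell c = t ∧ literal ρ c = some true := by
    intro w hw
    rcases next_pos harc (by omega) hw with h | h | ⟨c, h, hc⟩
    · exact Or.inl h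
    · exact Or.inr (Or.inl h)
    · rw [arc_pos_clause (by omega)] at hc
      exact Or.inr (Or.inr ⟨c, h, by omega, (hc.resolve_right (by omega)).1⟩)
  have hqo : ∀ w, N (pos ρ (3 * t + 3)) w → w = pos ρ (3 * t + 2) ∨ w = pos ρ (3 * t + 4) ∨
      ∃ c, w = clause c ∧ cell c = t ∧ literal ρ c = some false := by
    intro w hw
    rcases next_pos harc (by omega) hw with h | h | ⟨c, h, hc⟩
    · exact Or.inl h
    · exact Or.inr (Or.inl h)
    · rw [arc_pos_clause (by omega)] at hc
      exact Or.inr (Or.inr ⟨c, h, by omega, (hc.resolve_left (by omega)).1⟩)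
  have hpi : ∀ w, N w (pos ρ (3 * t + 2)) → w = pos ρ (3 * t + 1) ∨ w = pos ρ (3 * t + 3) ∨
      ∃ c, w = clause c ∧ cell c = t ∧ literal ρ c = some false := by
    intro w hw
    rcases prev_pos harc (by omega) hw with h | h | ⟨c, h, hc⟩
    · exact Or.inl h
    · exact Or.inr (Or.inl h)
    · rw [arc_clause_pos (by omega)] at hc
      exact Or.inr (Or.inr ⟨c, h, by omega, (hc.resolve_left (by omega)).1⟩)
  have hqi : ∀ w, N w (pos ρ (3 * t + 3)) → w = pos ρ (3 * t + 2) ∨ w = pos ρ (3 * t + 4) ∨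
      ∃ c, w = clause c ∧ cell c = t ∧ literal ρ c = some true := by
    intro w hw
    rcases prev_pos harc (by omega) hw with h | h | ⟨c, h, hc⟩
    · exact Or.inl h
    · exact Or.inr (Or.inl h)
    · rw [arc_clause_pos (by omega)] at hc
      exact Or.inr (Or.inr ⟨c, h, by omega, (hc.resolve_right (by omega)).1⟩)
  have hne : ∀ s u, ¬ ∃ c, pos ρ u = clause c ∧ cell c = t ∧ literal ρ c = some s := by
    rintro s u ⟨c, h, -⟩; simp [pos] at h
  have huniq : ∀ s v w, (∃ c, v = clause c ∧ cell c = t ∧ literal ρ c = some s) →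
      (∃ c, w = clause c ∧ cell c = t ∧ literal ρ c = some s) → v = w := by
    rintro s v w ⟨c, rfl, hc, -⟩ ⟨c', rfl, hc', -⟩
    rw [cell_injective (hc.trans hc'.symm)]
  have hbq : pos ρ (3 * t + 1) ≠ pos ρ (3 * t + 3) := by
    rw [ne_eq, pos_inj (by omega) (by omega)]; omega
  have hpr : pos ρ (3 * t + 2) ≠ pos ρ (3 * t + 4) := by
    rw [ne_eq, pos_inj (by omega) (by omega)]; omega
  -- the position of an arc between the row and the clause vertex
  have harcs : ∀ c, cell c = t → ∀ u : Fin (12 * 2 ^ l + 3),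
      (N (chain ρ u) (clause c) → (literal ρ c = some true ∧ u.val = 3 * t + 2) ∨
        (literal ρ c = some false ∧ u.val = 3 * t + 3)) ∧
      (N (clause c) (chain ρ u) → (literal ρ c = some true ∧ u.val = 3 * t + 3) ∨
        (literal ρ c = some false ∧ u.val = 3 * t + 2)) := by
    rintro c rfl u
    exact ⟨fun h => (harc _ _ h).resolve_right (by simp),
      fun h => (harc _ _ h).resolve_right (by simp)⟩
  by_cases hlit : ∃ c, cell c = t ∧ literal ρ c = some false
  · -- seen from above, the detour goes from the first to the second vertex of the cell
    obtain ⟨c₀, hc₀, hl₀⟩ := hlit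
    have hno : ∀ w, ¬ ∃ c, w = clause c ∧ cell c = t ∧ literal ρ c = some true := by
      rintro w ⟨c, -, hc, hl⟩
      rw [cell_injective (hc.trans hc₀.symm), hl₀] at hl
      simp at hl
    simp only [hno, or_false] at hpo hqi
    obtain ⟨h1, h2, h3, h4⟩ := hN.cell_traversal (b := pos ρ (3 * t + 4))
      (p := pos ρ (3 * t + 3)) (q := pos ρ (3 * t + 2)) (r := pos ρ (3 * t + 1))
      (C := fun w => ∃ c, w = clause c ∧ cell c = t ∧ literal ρ c = some false)
      hqr.symm hbp.symm (fun w hw => or_left_comm.1 (hqo w hw))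
      (fun w hw => (hqi w hw).symm) (fun w hw => (hpo w hw).symm)
      (fun w hw => or_left_comm.1 (hpi w hw)) (huniq false) (hne _ _) (hne _ _)
      (hne _ _) (hne _ _) hpr.symm hbq.symm
    refine ⟨fun h => hqr.resolve_right fun h' => hN.asymm h (h1 h'),
      fun h => hqr.resolve_left fun h' => hN.asymm h (h2 h'), fun c hc u hu => ?_⟩
    obtain rfl : c = c₀ := cell_injective (hc.trans hc₀.symm)
    have hCc : ∃ c', clause c = clause c' ∧ cell c' = t ∧ literal ρ c' = some false :=
      ⟨c, rfl, hc, hl₀⟩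
    have key : N (pos ρ (3 * t + 3)) (clause c) ∧ N (clause c) (pos ρ (3 * t + 2)) ∧
        N (pos ρ (3 * t + 4)) (pos ρ (3 * t + 3)) := by
      rcases hu with hu | hu
      · have := (harcs c hc u).1 hu
        simp only [hl₀, Option.some.injEq, Bool.false_eq_true, false_and, true_and,
          false_or] at this
        rw [chain_eq_pos, this] at hu
        exact ⟨hu, (h3 _ hCc hu).2, (h3 _ hCc hu).1⟩
      · have := (harcs c hc u).2 hu
        simp only [hl₀, Option.some.injEq, Bool.false_eq_true, false_and, true_and,
          false_or] at this
        rw [chain_eq_pos, this] at hu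
        exact ⟨(h4 _ hCc hu).2, hu, (h4 _ hCc hu).1⟩
    exact ⟨⟨_, key.1⟩, ⟨_, key.2.1⟩, Or.inr ⟨hl₀, h1 key.2.2⟩⟩
  · have hno : ∀ w, ¬ ∃ c, w = clause c ∧ cell c = t ∧ literal ρ c = some false := by
      rintro w ⟨c, -, hc, hl⟩
      exact hlit ⟨c, hc, hl⟩
    simp only [hno, or_false] at hqo hpi
    obtain ⟨h1, h2, h3, h4⟩ := hN.cell_traversal
      (C := fun w => ∃ c, w = clause c ∧ cell c = t ∧ literal ρ c = some true)
      hbp hqr hpo hpi hqo hqi (huniq true) (hne _ _) (hne _ _) (hne _ _) (hne _ _) hbq hpr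
    refine ⟨h1, h2, fun c hc u hu => ?_⟩
    have hcf : literal ρ c ≠ some false := fun h => hlit ⟨c, hc, h⟩
    have key : literal ρ c = some true ∧ N (pos ρ (3 * t + 2)) (clause c) ∧
        N (clause c) (pos ρ (3 * t + 3)) ∧ N (pos ρ (3 * t + 1)) (pos ρ (3 * t + 2)) := by
      rcases hu with hu | hu
      · obtain ⟨hl, hu'⟩ := ((harcs c hc u).1 hu).resolve_right fun h => hcf h.1
        rw [chain_eq_pos, hu'] at hu
        have := h3 _ ⟨c, rfl, hc, hl⟩ hu
        exact ⟨hl, hu, this.2, this.1⟩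
      · obtain ⟨hl, hu'⟩ := ((harcs c hc u).2 hu).resolve_right fun h => hcf h.1
        rw [chain_eq_pos, hu'] at hu
        have := h4 _ ⟨c, rfl, hc, hl⟩ hu
        exact ⟨hl, this.2, hu, this.1⟩
    exact ⟨⟨_, key.2.1⟩, ⟨_, key.2.2.1⟩, Or.inl ⟨key.1, key.2.2.2⟩⟩

/-- Each row is traversed in one direction, and it visits only clause vertices that it can visit
in this direction. -/
theorem exists_direction (ρ : Fin (2 * l)) : ∃ s : Bool, ∀ c u,
    (N (chain ρ u) (clause c) ∨ N (clause c) (chain ρ u)) →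
      (∃ v, N (chain ρ v) (clause c)) ∧ (∃ v, N (clause c) (chain ρ v)) ∧
        literal ρ c = some s := by
  have hup : ∀ {t}, t < 4 * 2 ^ l → N (pos ρ (3 * t + 3)) (pos ρ (3 * t + 4)) →
      N (pos ρ (3 * (t + 1) + 1)) (pos ρ (3 * (t + 1) + 2)) := by
    intro t ht h
    rcases separator_pos hN harc (ρ := ρ) (t := t + 1) ht with h' | h'
    · exact h'.2
    · exact absurd h (hN.asymm h'.2)
  have hdown : ∀ {t}, t < 4 * 2 ^ l → N (pos ρ (3 * t + 4)) (pos ρ (3 * t + 3)) →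
      N (pos ρ (3 * (t + 1) + 2)) (pos ρ (3 * (t + 1) + 1)) := by
    intro t ht h
    rcases separator_pos hN harc (ρ := ρ) (t := t + 1) ht with h' | h'
    · exact absurd h (hN.asymm h'.1)
    · exact h'.1
  rcases separator_pos hN harc (ρ := ρ) (t := 0) (by omega) with h0 | h0
  · have hall : ∀ t, t < 4 * 2 ^ l → N (pos ρ (3 * t + 1)) (pos ρ (3 * t + 2)) := by
      intro t
      induction t with
      | zero => exact fun _ => h0.2
      | succ t ih =>
        intro ht
        exact hup (by omega) ((cell_pos hN harc (by omega)).1 (ih (by omega)))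
    refine ⟨true, fun c u h => ?_⟩
    obtain ⟨h1, h2, h3⟩ := (cell_pos hN harc (cell_lt c)).2.2 c rfl u h
    exact ⟨h1, h2, (h3.resolve_right fun h => hN.asymm h.2 (hall _ (cell_lt c))).1⟩
  · have hall : ∀ t, t < 4 * 2 ^ l → N (pos ρ (3 * t + 2)) (pos ρ (3 * t + 1)) := by
      intro t
      induction t with
      | zero => exact fun _ => h0.1
      | succ t ih =>
        intro ht
        exact hdown (by omega) ((cell_pos hN harc (by omega)).2.1 (ih (by omega)))
    refine ⟨false, fun c u h => ?_⟩
    obtain ⟨h1, h2, h3⟩ := (cell_pos hN harc (cell_lt c)).2.2 c rfl u h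
    exact ⟨h1, h2, (h3.resolve_left fun h => hN.asymm h.2 (hall _ (cell_lt c))).1⟩

/-- The tour determines a pair of indices, the bits of which are the directions of the rows. The
rows cannot visit the clause vertices of this pair, which the tour must visit on the way from the
last gate to the links: there it uses the arcs of this pair, and no others, between
clause vertices. -/
theorem exists_mem_of_isSuccessor : ∃ i j, x (i, j) = true ∧ y (i, j) = true ∧
    ∀ i' j', N (clause (true, false, i')) (clause (true, true, j')) ↔ i' = i ∧ j' = j := by
  choose s hs using exists_direction hN harc
  let S : Bool → Fin l → Bool := fun k b => s (rowBit.symm (k, b))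
  have hlit : ∀ ρ side k i, literal ρ (side, k, i) = some (s ρ) → i ≠ S k := by
    intro ρ side k i h hi
    subst hi
    unfold literal at h
    split at h
    · rename_i hk
      dsimp only at hk
      have : rowBit.symm (k, (rowBit ρ).2) = ρ := by
        rw [← hk]; simp
      simp [S, this] at h
    · simp at h
  have key : ∀ side, (if side then x else y) (S false, S true) = true ∧
      ∀ i' j', N (clause (side, false, i')) (clause (side, true, j')) ↔
        i' = S false ∧ j' = S true := by
    intro side
    let entry : GadgetVertex l := if side then gate (Fin.last _) else link 1
    -- what can precede or follow the clause vertices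
    have hprev0 : ∀ i v, N v (clause (side, false, i)) →
        (∃ ρ u, v = chain ρ u) ∨ v = entry := by
      intro i v hv
      have h := (harc _ _ hv).resolve_right (by simp)
      cases v with
      | gate ρ =>
        obtain ⟨h1, h2, -⟩ := h
        have h2 : side = true := h2
        right
        simp only [entry, h2, if_true]
        congr 1
        exact Fin.ext h1
      | chain ρ u => exact Or.inl ⟨ρ, u, rfl⟩
      | clause c => obtain ⟨-, -, h, -⟩ := h; simp at h
      | link e =>
        obtain ⟨rfl, h2, -⟩ := h
        have h2 : side = false := h2
        right
        simp [entry, h2]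
    have hnext0 : ∀ i w, N (clause (side, false, i)) w →
        (∃ ρ u, w = chain ρ u) ∨ ∃ j, w = clause (side, true, j) ∧
          (if side then x else y) (i, j) = true := by
      intro i w hw
      have h := (harc _ _ hw).resolve_right (by simp)
      cases w with
      | gate ρ => exact h.elim
      | chain ρ u => exact Or.inl ⟨ρ, u, rfl⟩
      | clause c =>
        obtain ⟨side', k, j⟩ := c
        obtain ⟨h1, -, h3, h4⟩ := h
        dsimp only at h1 h3 h4
        subst h1 h3
        exact Or.inr ⟨j, rfl, h4⟩
      | link e => obtain ⟨h, -⟩ := h; simp at h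
    have hprev1 : ∀ j v, N v (clause (side, true, j)) →
        (∃ ρ u, v = chain ρ u) ∨ ∃ i, v = clause (side, false, i) ∧
          (if side then x else y) (i, j) = true := by
      intro j v hv
      have h := (harc _ _ hv).resolve_right (by simp)
      cases v with
      | gate ρ => obtain ⟨-, -, h⟩ := h; simp at h
      | chain ρ u => exact Or.inl ⟨ρ, u, rfl⟩
      | clause c =>
        obtain ⟨side', k, i⟩ := c
        obtain ⟨h1, h2, -, h4⟩ := h
        dsimp only at h1 h2 h4
        subst h1 h2
        exact Or.inr ⟨i, rfl, h4⟩
      | link e => obtain ⟨-, -, h⟩ := h; simp at h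
    have hrow : ∀ k ρ u, ¬ N (chain ρ u) (clause (side, k, S k)) := fun k ρ u h =>
      hlit ρ side k _ (hs ρ _ u (Or.inl h)).2.2 rfl
    have hin0 : N entry (clause (side, false, S false)) := by
      obtain ⟨v, hv⟩ := hN.exists_left (clause (side, false, S false))
      rcases hprev0 _ v hv with ⟨ρ, u, rfl⟩ | rfl
      · exact absurd hv (hrow _ _ _)
      · exact hv
    have huniq : ∀ i j, N (clause (side, false, i)) (clause (side, true, j)) → i = S false := by
      intro i j hij
      obtain ⟨v, hv⟩ := hN.exists_left (clause (side, false, i))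
      rcases hprev0 _ v hv with ⟨ρ, u, rfl⟩ | rfl
      · obtain ⟨v, hv'⟩ := (hs ρ _ u (Or.inl hv)).2.1
        have := hN.right_unique hij hv'
        simp at this
      · simpa using hN.right_unique hv hin0
    obtain ⟨v, hv⟩ := hN.exists_left (clause (side, true, S true))
    rcases hprev1 _ v hv with ⟨ρ, u, rfl⟩ | ⟨i, rfl, hi⟩
    · exact absurd hv (hrow _ _ _)
    · obtain rfl := huniq _ _ hv
      refine ⟨hi, fun i' j' => ⟨fun h => ?_, ?_⟩⟩
      · obtain rfl := huniq _ _ h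
        exact ⟨rfl, by simpa using hN.right_unique h hv⟩
      · rintro ⟨rfl, rfl⟩
        exact hv
  exact ⟨S false, S true, (key true).1, (key false).1, (key true).2⟩

end Soundness

end GadgetVertex

/-! ### Traversing the gadget -/

/-- Some path along `r` from `a` to `b` visits each element with the property `S` exactly once, and
nothing else. -/
def Traverses {V : Type*} (r : V → V → Prop) (a b : V) (S : V → Prop) : Prop :=
  ∃ p : List V, p.IsChain r ∧ p.Nodup ∧ p.head? = some a ∧ p.getLast? = some b ∧ ∀ v, v ∈ p ↔ S v

namespace Traverses

variable {V : Type*} {r : V → V → Prop} {a b c d : V} {S S' U : V → Prop}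

theorem single (h : ∀ v, v = a ↔ S v) : Traverses r a a S :=
  ⟨[a], by simp, by simp, by simp, by simp, by simpa using h⟩

theorem append (h : Traverses r a b S) (h' : Traverses r c d S') (hbc : r b c)
    (hdisj : ∀ v, S v → ¬ S' v) (hU : ∀ v, S v ∨ S' v ↔ U v) : Traverses r a d U := by
  obtain ⟨p, p1, p2, p3, p4, p5⟩ := h
  obtain ⟨q, q1, q2, q3, q4, q5⟩ := h'
  refine ⟨p ++ q, ?_, ?_, ?_, ?_, fun v => ?_⟩
  · rw [List.isChain_append]
    exact ⟨p1, q1, by simp [p4, q3, hbc]⟩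
  · rw [List.nodup_append]
    refine ⟨p2, q2, fun v hv w hw => ?_⟩
    rintro rfl
    exact hdisj v ((p5 v).1 hv) ((q5 v).1 hw)
  · simp [List.head?_append, p3]
  · simp [List.getLast?_append, q4]
  · rw [List.mem_append, p5, q5, hU]

/-- Extending a path by one vertex. -/
theorem concat (h : Traverses r a b S) (hbc : r b c) (hc : ¬ S c)
    (hU : ∀ v, S v ∨ v = c ↔ U v) : Traverses r a c U :=
  h.append (single fun _ => Iff.rfl) hbc (fun _ hv hvc => hc (hvc ▸ hv)) hU

end Traverses

namespace GadgetVertex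

variable {l : ℕ} {x y : (Fin l → Bool) × (Fin l → Bool) → Bool}

theorem chain_eq_pos_iff {ρ ρ' : Fin (2 * l)} {u : Fin (12 * 2 ^ l + 3)} {v : ℕ}
    (hv : v < 12 * 2 ^ l + 3) : chain ρ' u = pos ρ v ↔ ρ' = ρ ∧ u.val = v := by
  rw [eq_comm, pos_eq_chain hv, eq_comm, @eq_comm _ v]

section Completeness

variable {f : Clause l → Option (Fin (2 * l))} {ρ : Fin (2 * l)}

/-- The vertices that are visited by row `ρ` up to the separator above the first `t` cells, when row
`ρ` visits the clause vertices `c` with `f c = some ρ`. -/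
def RowPrefix (f : Clause l → Option (Fin (2 * l))) (ρ : Fin (2 * l)) (t : ℕ) :
    GadgetVertex l → Prop
  | chain ρ' u => ρ' = ρ ∧ u.val ≤ 3 * t + 1
  | clause c => f c = some ρ ∧ cell c < t
  | _ => False

/-- The vertices that are visited in cell `t` and the separator above it. -/
def RowCell (f : Clause l → Option (Fin (2 * l))) (ρ : Fin (2 * l)) (t : ℕ) :
    GadgetVertex l → Prop
  | chain ρ' u => ρ' = ρ ∧ 3 * t + 2 ≤ u.val ∧ u.val ≤ 3 * t + 4
  | clause c => f c = some ρ ∧ cell c = t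
  | _ => False

/-- The vertices that are visited by row `ρ`. -/
def RowAll (f : Clause l → Option (Fin (2 * l))) (ρ : Fin (2 * l)) : GadgetVertex l → Prop
  | chain ρ' _ => ρ' = ρ
  | clause c => f c = some ρ
  | _ => False

theorem rowPrefix_or_rowCell (t : ℕ) (v : GadgetVertex l) :
    RowPrefix f ρ t v ∨ RowCell f ρ t v ↔ RowPrefix f ρ (t + 1) v := by
  cases v with
  | gate _ => simp [RowPrefix, RowCell]
  | link _ => simp [RowPrefix, RowCell]
  | chain ρ' u =>
    simp only [RowPrefix, RowCell, ← and_or_left]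
    refine and_congr_right fun _ => ?_
    omega
  | clause c =>
    simp only [RowPrefix, RowCell, ← and_or_left]
    refine and_congr_right fun _ => ?_
    omega

theorem not_rowCell_of_rowPrefix (t : ℕ) (v : GadgetVertex l) (h : RowPrefix f ρ t v) :
    ¬ RowCell f ρ t v := by
  cases v with
  | gate _ => simp [RowCell]
  | link _ => simp [RowCell]
  | chain ρ' u =>
    simp only [RowPrefix, RowCell] at h ⊢
    omega
  | clause c =>
    simp only [RowPrefix, RowCell] at h ⊢
    omega

theorem traverses_rowCell_up {t : ℕ} (ht : t < 4 * 2 ^ l)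
    (hf : ∀ c, f c = some ρ → literal ρ c = some true) :
    Traverses (Arc x y) (pos ρ (3 * t + 2)) (pos ρ (3 * t + 4)) (RowCell f ρ t) := by
  have hpp : ∀ u v, u < 12 * 2 ^ l + 3 → v < 12 * 2 ^ l + 3 → u + 1 = v →
      Arc x y (pos ρ u) (pos ρ v) := fun u v hu hv h => (arc_pos_pos hu hv).2 (Or.inl h)
  by_cases hc : ∃ c, f c = some ρ ∧ cell c = t
  · obtain ⟨c, hc, rfl⟩ := hc
    refine ⟨[pos ρ (3 * cell c + 2), clause c, pos ρ (3 * cell c + 3), pos ρ (3 * cell c + 4)],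
      ?_, ?_, by simp, by simp, fun v => ?_⟩
    · simp only [List.isChain_cons_cons, List.isChain_singleton, and_true]
      refine ⟨?_, ?_, hpp _ _ (by omega) (by omega) rfl⟩
      · rw [arc_pos_clause (by omega)]
        exact Or.inl ⟨hf c hc, rfl⟩
      · rw [arc_clause_pos (by omega)]
        exact Or.inl ⟨hf c hc, rfl⟩
    · simp (disch := omega) only [List.nodup_cons, List.mem_cons, pos_inj, List.not_mem_nil,
        or_false, not_false_eq_true, List.nodup_nil, and_true]
      simp [pos]
    · cases v with
      | gate _ => simp [RowCell, pos]
      | link _ => simp [RowCell, pos]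
      | chain ρ' u =>
        simp (disch := omega) only [List.mem_cons, chain_eq_pos_iff, List.not_mem_nil, RowCell,
          reduceCtorEq, or_false, false_or, ← and_or_left]
        refine and_congr_right fun _ => ?_
        omega
      | clause c' =>
        simp only [List.mem_cons, pos, reduceCtorEq, clause.injEq, List.not_mem_nil, RowCell,
          or_false, false_or]
        constructor
        · rintro rfl; exact ⟨hc, rfl⟩
        · exact fun h => cell_injective h.2
  · refine ⟨[pos ρ (3 * t + 2), pos ρ (3 * t + 3), pos ρ (3 * t + 4)],
      ?_, ?_, by simp, by simp, fun v => ?_⟩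
    · simp only [List.isChain_cons_cons, List.isChain_singleton, and_true]
      exact ⟨hpp _ _ (by omega) (by omega) rfl, hpp _ _ (by omega) (by omega) rfl⟩
    · simp (disch := omega) only [List.nodup_cons, List.mem_cons, pos_inj, List.not_mem_nil,
        or_false, not_false_eq_true, List.nodup_nil, and_true]
      omega
    · cases v with
      | gate _ => simp [RowCell, pos]
      | link _ => simp [RowCell, pos]
      | chain ρ' u =>
        simp (disch := omega) only [List.mem_cons, chain_eq_pos_iff, List.not_mem_nil, RowCell,
          or_false, ← and_or_left]
        refine and_congr_right fun _ => ?_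
        omega
      | clause c' =>
        simp only [List.mem_cons, pos, reduceCtorEq, List.not_mem_nil, RowCell, or_false,
          false_iff]
        exact fun h => hc ⟨c', h⟩

theorem traverses_rowCell_down {t : ℕ} (ht : t < 4 * 2 ^ l)
    (hf : ∀ c, f c = some ρ → literal ρ c = some false) :
    Traverses (Arc x y) (pos ρ (3 * t + 4)) (pos ρ (3 * t + 2)) (RowCell f ρ t) := by
  have hpp : ∀ u v, u < 12 * 2 ^ l + 3 → v < 12 * 2 ^ l + 3 → v + 1 = u →
      Arc x y (pos ρ u) (pos ρ v) := fun u v hu hv h => (arc_pos_pos hu hv).2 (Or.inr h)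
  by_cases hc : ∃ c, f c = some ρ ∧ cell c = t
  · obtain ⟨c, hc, rfl⟩ := hc
    refine ⟨[pos ρ (3 * cell c + 4), pos ρ (3 * cell c + 3), clause c, pos ρ (3 * cell c + 2)],
      ?_, ?_, by simp, by simp, fun v => ?_⟩
    · simp only [List.isChain_cons_cons, List.isChain_singleton, and_true]
      refine ⟨hpp _ _ (by omega) (by omega) rfl, ?_, ?_⟩
      · rw [arc_pos_clause (by omega)]
        exact Or.inr ⟨hf c hc, rfl⟩
      · rw [arc_clause_pos (by omega)]
        exact Or.inr ⟨hf c hc, rfl⟩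
    · simp (disch := omega) only [List.nodup_cons, List.mem_cons, pos_inj, List.not_mem_nil,
        or_false, not_false_eq_true, List.nodup_nil, and_true]
      simp [pos]
    · cases v with
      | gate _ => simp [RowCell, pos]
      | link _ => simp [RowCell, pos]
      | chain ρ' u =>
        simp (disch := omega) only [List.mem_cons, chain_eq_pos_iff, List.not_mem_nil, RowCell,
          reduceCtorEq, or_false, false_or, ← and_or_left]
        refine and_congr_right fun _ => ?_
        omega
      | clause c' =>
        simp only [List.mem_cons, pos, reduceCtorEq, clause.injEq, List.not_mem_nil, RowCell,
          or_false, false_or]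
        constructor
        · rintro rfl; exact ⟨hc, rfl⟩
        · exact fun h => cell_injective h.2
  · refine ⟨[pos ρ (3 * t + 4), pos ρ (3 * t + 3), pos ρ (3 * t + 2)],
      ?_, ?_, by simp, by simp, fun v => ?_⟩
    · simp only [List.isChain_cons_cons, List.isChain_singleton, and_true]
      exact ⟨hpp _ _ (by omega) (by omega) rfl, hpp _ _ (by omega) (by omega) rfl⟩
    · simp (disch := omega) only [List.nodup_cons, List.mem_cons, pos_inj, List.not_mem_nil,
        or_false, not_false_eq_true, List.nodup_nil, and_true]
      omega
    · cases v with
      | gate _ => simp [RowCell, pos]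
      | link _ => simp [RowCell, pos]
      | chain ρ' u =>
        simp (disch := omega) only [List.mem_cons, chain_eq_pos_iff, List.not_mem_nil, RowCell,
          or_false, ← and_or_left]
        refine and_congr_right fun _ => ?_
        omega
      | clause c' =>
        simp only [List.mem_cons, pos, reduceCtorEq, List.not_mem_nil, RowCell, or_false,
          false_iff]
        exact fun h => hc ⟨c', h⟩

theorem rowPrefix_zero (v : GadgetVertex l) :
    v = pos ρ 0 ∨ v = pos ρ 1 ↔ RowPrefix f ρ 0 v := by
  cases v with
  | gate _ => simp [RowPrefix, pos]
  | link _ => simp [RowPrefix, pos]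
  | chain ρ' u =>
    simp (disch := omega) only [chain_eq_pos_iff, RowPrefix, ← and_or_left]
    refine and_congr_right fun _ => ?_
    omega
  | clause c => simp [RowPrefix, pos]

theorem rowPrefix_last (v : GadgetVertex l) :
    RowPrefix f ρ (4 * 2 ^ l) v ∨ v = pos ρ (12 * 2 ^ l + 2) ↔ RowAll f ρ v := by
  cases v with
  | gate _ => simp [RowPrefix, RowAll, pos]
  | link _ => simp [RowPrefix, RowAll, pos]
  | chain ρ' u =>
    have := u.2
    simp (disch := omega) only [chain_eq_pos_iff, RowPrefix, RowAll, ← and_or_left]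
    refine and_iff_left ?_
    omega
  | clause c => simp [RowPrefix, RowAll, pos, cell_lt c]

/-- A row can be traversed in both directions, visiting on the way any set of clause vertices the
literals of which agree with the direction. -/
theorem traverses_row (s : Bool) (hf : ∀ c, f c = some ρ → literal ρ c = some s) :
    ∃ a b, (a = 0 ∨ a = 12 * 2 ^ l + 2) ∧ (b = 0 ∨ b = 12 * 2 ^ l + 2) ∧
      Traverses (Arc x y) (pos ρ a) (pos ρ b) (RowAll f ρ) := by
  have hlast : ¬ RowPrefix f ρ (4 * 2 ^ l) (pos ρ (12 * 2 ^ l + 2)) := by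
    simp [pos, RowPrefix, Fin.ofNat]
    omega
  have h01 : pos ρ 1 ≠ pos ρ 0 := by
    rw [ne_eq, pos_inj (by omega) (by omega)]; omega
  cases s with
  | true =>
    have h : ∀ t ≤ 4 * 2 ^ l,
        Traverses (Arc x y) (pos ρ 0) (pos ρ (3 * t + 1)) (RowPrefix f ρ t) := by
      intro t
      induction t with
      | zero =>
        intro _
        refine Traverses.concat (b := pos ρ 0) (.single fun _ => Iff.rfl) ?_ h01 rowPrefix_zero
        exact (arc_pos_pos (by omega) (by omega)).2 (Or.inl rfl)
      | succ t ih =>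
        intro ht
        refine (ih (by omega)).append (traverses_rowCell_up (by omega) hf) ?_
          (not_rowCell_of_rowPrefix t) (rowPrefix_or_rowCell t)
        exact (arc_pos_pos (by omega) (by omega)).2 (Or.inl rfl)
    refine ⟨0, 12 * 2 ^ l + 2, Or.inl rfl, Or.inr rfl,
      (h _ le_rfl).concat ?_ hlast rowPrefix_last⟩
    exact (arc_pos_pos (by omega) (by omega)).2 (Or.inl (by omega))
  | false =>
    have h : ∀ t ≤ 4 * 2 ^ l,
        Traverses (Arc x y) (pos ρ (3 * t + 1)) (pos ρ 0) (RowPrefix f ρ t) := by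
      intro t
      induction t with
      | zero =>
        intro _
        refine Traverses.concat (b := pos ρ 1) (.single fun _ => Iff.rfl) ?_ h01.symm
          fun v => or_comm.trans (rowPrefix_zero v)
        exact (arc_pos_pos (by omega) (by omega)).2 (Or.inr rfl)
      | succ t ih =>
        intro ht
        refine (traverses_rowCell_down (t := t) (by omega) hf).append (ih (by omega)) ?_
          (fun v h h' => not_rowCell_of_rowPrefix t v h' h)
          fun v => or_comm.trans (rowPrefix_or_rowCell t v)
        exact (arc_pos_pos (by omega) (by omega)).2 (Or.inr rfl)
    refine ⟨12 * 2 ^ l + 2, 0, Or.inr rfl, Or.inl rfl,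
      Traverses.append (.single fun _ => Iff.rfl) (h _ le_rfl) ?_
        (fun v h h' => hlast (h ▸ h')) fun v => or_comm.trans (rowPrefix_last v)⟩
    exact (arc_pos_pos (by omega) (by omega)).2 (Or.inr (by omega))

/-- The vertices that are visited before row `r`. -/
def GatePrefix (f : Clause l → Option (Fin (2 * l))) (r : ℕ) : GadgetVertex l → Prop
  | gate ρ => ρ.val ≤ r
  | chain ρ _ => ρ.val < r
  | clause c => ∃ ρ, f c = some ρ ∧ ρ.val < r
  | link _ => False

theorem traverses_gates (s : Fin (2 * l) → Bool)
    (hf : ∀ ρ c, f c = some ρ → literal ρ c = some (s ρ)) :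
    Traverses (Arc x y) (gate 0) (gate (Fin.last _)) (GatePrefix f (2 * l)) := by
  have h : ∀ r (hr : r < 2 * l + 1),
      Traverses (Arc x y) (gate 0) (gate ⟨r, hr⟩) (GatePrefix f r) := by
    intro r
    induction r with
    | zero =>
      intro hr
      refine .single fun v => ?_
      cases v with
      | gate ρ =>
        simp only [GatePrefix, gate.injEq, Fin.ext_iff, Nat.le_zero]
        rfl
      | chain ρ u => simp [GatePrefix]
      | clause c => simp [GatePrefix]
      | link e => simp [GatePrefix]
    | succ r ih =>
      intro hr
      obtain ⟨a, b, ha, hb, hab⟩ := traverses_row (x := x) (y := y)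
        (s ⟨r, by omega⟩) (hf ⟨r, by omega⟩)
      refine ((ih (by omega)).append (U := fun v => GatePrefix f r v ∨ RowAll f ⟨r, by omega⟩ v)
        hab ?_ (fun v => ?_) fun v => Iff.rfl).concat ?_ ?_ fun v => ?_
      · refine ⟨rfl, ?_⟩
        rcases ha with rfl | rfl <;> simp [Fin.ofNat]
      · cases v with
        | gate _ => simp [RowAll]
        | link _ => simp [RowAll]
        | chain ρ u =>
          simp only [GatePrefix, RowAll]
          rintro h rfl
          simp at h
        | clause c =>
          simp only [GatePrefix, RowAll]
          rintro ⟨ρ, h, h'⟩ h''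
          rw [h, Option.some_inj] at h''
          subst h''
          simp at h'
      · refine ⟨rfl, ?_⟩
        rcases hb with rfl | rfl <;> simp [Fin.ofNat]
      · simp [GatePrefix, RowAll]
      · cases v with
        | gate ρ => simp only [GatePrefix, RowAll, gate.injEq, Fin.ext_iff, or_false]; omega
        | link _ => simp [GatePrefix, RowAll]
        | chain ρ u => simp only [GatePrefix, RowAll, reduceCtorEq, Fin.ext_iff, or_false]; omega
        | clause c =>
          simp only [GatePrefix, RowAll, reduceCtorEq, or_false]
          constructor
          · rintro (⟨ρ, h, h'⟩ | h)
            · exact ⟨ρ, h, by omega⟩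
            · exact ⟨_, h, by simp⟩
          · rintro ⟨ρ, h, h'⟩
            by_cases hρ : ρ.val < r
            · exact Or.inl ⟨ρ, h, hρ⟩
            · right
              rw [h, Option.some_inj, Fin.ext_iff]
              dsimp only
              omega
  exact h (2 * l) (by omega)

/-- If the inputs meet in a pair of indices, then the rows can be traversed in the directions given
by its bits. This leaves unvisited only the clause vertices of this pair, through which
the path goes on. -/
theorem traverses_of_mem {i j : Fin l → Bool} (hx : x (i, j) = true) (hy : y (i, j) = true) :
    Traverses (Arc x y) (gate 0) (link 2) fun _ => True := by
  classical
  let S : Bool → Fin l → Bool := fun k => if k then j else i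
  have hf : ∀ c : Clause l, ∃ o : Option (Fin (2 * l)),
      (o = none ↔ c.2.2 = S c.2.1) ∧
      ∀ ρ, o = some ρ → literal ρ c = some (S (rowBit ρ).1 (rowBit ρ).2) := by
    intro c
    by_cases hc : c.2.2 = S c.2.1
    · exact ⟨none, by simp [hc], by simp⟩
    · obtain ⟨b, hb⟩ := Function.ne_iff.1 hc
      refine ⟨some (rowBit.symm (c.2.1, b)), by simp [hc], fun ρ hρ => ?_⟩
      rw [Option.some_inj] at hρ
      subst hρ
      simp only [literal, Equiv.apply_symm_apply, if_true, Option.some_inj]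
      cases h1 : c.2.2 b <;> cases h2 : S c.2.1 b <;> simp_all
  choose f hf1 hf2 using hf
  have hnone : ∀ side k, f (side, k, S k) = none := fun side k => (hf1 _).2 rfl
  have harc : ∀ side : Bool, (if side then x else y) (S false, S true) = true := by
    intro side; cases side <;> simp [S, hx, hy]
  have hA : ∀ side, Traverses (Arc x y) (clause (side, false, S false))
      (clause (side, true, S true)) fun v => ∃ k, v = clause (side, k, S k) := by
    intro side
    refine Traverses.concat (.single fun _ => Iff.rfl) ⟨rfl, rfl, rfl, harc side⟩ (by simp)
      fun v => ?_
    simp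
  have hrows := traverses_gates (x := x) (y := y) (fun ρ => S (rowBit ρ).1 (rowBit ρ).2)
    fun ρ c => hf2 c ρ
  refine (((((hrows.append (hA true) ⟨rfl, rfl, rfl⟩ ?_ fun _ => Iff.rfl).concat (c := link 0)
    ⟨rfl, Or.inl ⟨rfl, rfl⟩⟩ ?_ fun _ => Iff.rfl).concat (c := link 1) ⟨rfl, rfl⟩ ?_
    fun _ => Iff.rfl).append (hA false) ⟨rfl, rfl, rfl⟩ ?_ fun _ => Iff.rfl).concat
    (c := link 2) ⟨rfl, Or.inr ⟨rfl, rfl⟩⟩ ?_ fun v => ?_)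
  · rintro v hv ⟨k, rfl⟩
    simp [GatePrefix, hnone] at hv
  · simp [GatePrefix]
  · simp [GatePrefix]
  · rintro v hv ⟨k, rfl⟩
    simp [GatePrefix, hnone] at hv
  · simp [GatePrefix]
  · refine iff_true_intro ?_
    cases v with
    | gate ρ => have := ρ.2; simp [GatePrefix]; omega
    | chain ρ u => simp [GatePrefix]
    | link e => fin_cases e <;> simp
    | clause c =>
      obtain ⟨side, k, i'⟩ := c
      rcases h : f (side, k, i') with _ | ρ
      · have h1 := (hf1 _).1 h
        dsimp only at h1
        subst h1
        cases side <;> cases k <;> simp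
      · simp [GatePrefix, h]

end Completeness

/-- The gadget is connected for all inputs. -/
theorem eqvGen_gate_zero (hl : 0 < l) (v : GadgetVertex l) :
    Relation.EqvGen (Arc x y) (gate 0) v := by
  have hstep : ∀ {u v : GadgetVertex l}, Relation.EqvGen (Arc x y) (gate 0) u →
      (Arc x y u v ∨ Arc x y v u) → Relation.EqvGen (Arc x y) (gate 0) v := by
    rintro u v hu (h | h)
    · exact hu.trans _ _ _ (.rel _ _ h)
    · exact hu.trans _ _ _ (.symm _ _ (.rel _ _ h))
  have hgate : ∀ r (hr : r < 2 * l + 1), Relation.EqvGen (Arc x y) (gate 0) (gate ⟨r, hr⟩) := by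
    intro r
    induction r with
    | zero => exact fun _ => .refl _
    | succ r ih =>
      intro hr
      refine hstep (u := chain ⟨r, by omega⟩ 0) (hstep (ih (by omega)) (Or.inl ?_)) (Or.inl ?_)
      · exact ⟨rfl, Or.inl rfl⟩
      · exact ⟨rfl, Or.inl rfl⟩
  have hchain : ∀ (ρ : Fin (2 * l)) u (hu : u < 12 * 2 ^ l + 3),
      Relation.EqvGen (Arc x y) (gate 0) (chain ρ ⟨u, hu⟩) := by
    intro ρ u
    induction u with
    | zero => exact fun _ => hstep (hgate ρ.val (by omega)) (Or.inl ⟨rfl, Or.inl rfl⟩)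
    | succ u ih => exact fun hu => hstep (ih (by omega)) (Or.inl ⟨rfl, Or.inl rfl⟩)
  have hclause : ∀ c : Clause l, Relation.EqvGen (Arc x y) (gate 0) (clause c) := by
    intro c
    have hc := cell_lt c
    have hlit : literal (rowBit.symm (c.2.1, ⟨0, hl⟩)) c = some (!c.2.2 ⟨0, hl⟩) := by
      simp [literal]
    cases hb : (!c.2.2 ⟨0, hl⟩) with
    | true =>
      exact hstep (hchain _ (3 * cell c + 2) (by omega))
        (Or.inl (Or.inl ⟨hlit.trans (by rw [hb]), rfl⟩))
    | false =>
      exact hstep (hchain _ (3 * cell c + 3) (by omega))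
        (Or.inl (Or.inr ⟨hlit.trans (by rw [hb]), rfl⟩))
  have hlink0 := hstep (v := link 0) (hclause (true, true, fun _ => false))
    (Or.inl ⟨rfl, Or.inl ⟨rfl, rfl⟩⟩)
  cases v with
  | gate ρ => exact hgate ρ.1 ρ.2
  | chain ρ u => exact hchain ρ u.1 u.2
  | clause c => exact hclause c
  | link e =>
    fin_cases e
    · exact hlink0
    · exact hstep hlink0 (Or.inl ⟨rfl, rfl⟩)
    · exact hstep (hclause (false, true, fun _ => false)) (Or.inl ⟨rfl, Or.inr ⟨rfl, rfl⟩⟩)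

end GadgetVertex

/-! ### From directed to undirected graphs -/

/-- A spanning cycle, described by the graph of its edges. -/
structure IsTour {W : Type*} (S : SimpleGraph W) : Prop where
  ncard_neighborSet : ∀ a, (S.neighborSet a).ncard = 2
  preconnected : S.Preconnected

theorem IsTour.comap {W W' : Type*} {S : SimpleGraph W} (hS : IsTour S) (e : W' ≃ W) :
    IsTour (S.comap e) := by
  refine ⟨fun a => ?_, ?_⟩
  · rw [← hS.ncard_neighborSet (e a), ← Set.ncard_image_of_injective _ e.injective]
    congr 1
    ext b
    simp only [Set.mem_image, SimpleGraph.mem_neighborSet, SimpleGraph.comap_adj]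
    exact ⟨by rintro ⟨c, hc, rfl⟩; exact hc, fun h => ⟨e.symm b, by simpa using h, by simp⟩⟩
  · exact ((SimpleGraph.Iso.comap e S).preconnected_iff).2 hS.preconnected

theorem Set.mem_of_ncard_eq_two_of_subset {α : Type*} {s : Set α} {a b : α} (h : s.ncard = 2)
    (hs : s ⊆ {a, b}) : a ∈ s ∧ b ∈ s := by
  have hfin : ({a, b} : Set α).Finite := Set.toFinite _
  have : s = {a, b} := Set.eq_of_subset_of_ncard_le hs (by
    rw [h]; exact (Set.ncard_insert_le _ _).trans (by simp)) hfin
  rw [this]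
  simp

theorem Set.exists_other_of_ncard_eq_two {α : Type*} {s : Set α} {a : α} (h : s.ncard = 2)
    (ha : a ∈ s) : ∃ b ∈ s, b ≠ a ∧ ∀ c ∈ s, c = a ∨ c = b := by
  obtain ⟨u, v, huv, rfl⟩ := Set.ncard_eq_two.1 h
  rcases ha with rfl | rfl
  · exact ⟨v, by simp, huv.symm, by simp⟩
  · exact ⟨u, by simp, huv, fun c hc => hc.symm⟩

section Expansion

variable {V : Type*} (width : V → ℕ) (r : V → V → Prop)

/-- The undirected graph in which each vertex `v` is replaced by a path with `width v` vertices, and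
each arc by an edge from the last vertex of a path to the first vertex of a path. If all paths
have inner vertices, then a tour has to follow the paths and to respect the directions. -/
def expansion : SimpleGraph (Σ v, Fin (width v)) :=
  SimpleGraph.fromRel fun a b => (a.1 = b.1 ∧ a.2.val + 1 = b.2.val) ∨
    (a.2.val + 1 = width a.1 ∧ b.2.val = 0 ∧ r a.1 b.1)

variable {width r}

theorem expansion_adj_inner {v : V} {t : ℕ} (ht : t + 1 < width v) :
    (expansion width r).Adj ⟨v, ⟨t, by omega⟩⟩ ⟨v, ⟨t + 1, ht⟩⟩ := by
  rw [expansion, SimpleGraph.fromRel_adj]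
  exact ⟨by simp, Or.inl (Or.inl ⟨rfl, rfl⟩)⟩

theorem sigma_fin_ext {a b : Σ v, Fin (width v)} (h : a.1 = b.1) (h' : a.2.val = b.2.val) :
    a = b := by
  obtain ⟨v, s⟩ := a
  obtain ⟨w, t⟩ := b
  dsimp only at h h'
  subst h
  rw [Fin.ext h']

theorem expansion_mono {r' : V → V → Prop} (h : ∀ v w, r v w → r' v w) :
    expansion width r ≤ expansion width r' := by
  intro a b hab
  rw [expansion, SimpleGraph.fromRel_adj] at hab ⊢
  refine ⟨hab.1, hab.2.imp (Or.imp_right ?_) (Or.imp_right ?_)⟩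
  · exact fun h' => ⟨h'.1, h'.2.1, h _ _ h'.2.2⟩
  · exact fun h' => ⟨h'.1, h'.2.1, h _ _ h'.2.2⟩

variable (hw : ∀ v, 3 ≤ width v)

/-- The vertex of the expansion at which arcs to `v` end. -/
def entrance (v : V) : Σ v, Fin (width v) := ⟨v, ⟨0, by have := hw v; omega⟩⟩

/-- The vertex of the expansion at which arcs from `v` start. -/
def exit (v : V) : Σ v, Fin (width v) := ⟨v, ⟨width v - 1, by have := hw v; omega⟩⟩

theorem expansion_adj_exit_entrance {v w : V} (h : r v w) :
    (expansion width r).Adj (exit hw v) (entrance hw w) := by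
  have := hw v
  rw [expansion, SimpleGraph.fromRel_adj]
  refine ⟨fun h' => ?_, Or.inl (Or.inr ⟨?_, rfl, h⟩)⟩
  · simp only [exit, entrance] at h'
    rw [Sigma.mk.injEq] at h'
    obtain ⟨rfl, h'⟩ := h'
    have := congrArg Fin.val (eq_of_heq h')
    simp only at this
    omega
  · simp only [exit]; omega

theorem traverses_expansion_single (v : V) :
    Traverses (expansion width r).Adj (entrance hw v) (exit hw v) fun a => a.1 = v := by
  have hv := hw v
  have h : ∀ t (ht : t < width v), Traverses (expansion width r).Adj (entrance hw v) ⟨v, ⟨t, ht⟩⟩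
      fun a => a.1 = v ∧ a.2.val ≤ t := by
    intro t
    induction t with
    | zero =>
      intro ht
      refine .single fun a => ⟨?_, fun h => sigma_fin_ext h.1 (by simpa [entrance] using h.2)⟩
      rintro rfl
      exact ⟨rfl, le_rfl⟩
    | succ t ih =>
      intro ht
      refine (ih (by omega)).concat (expansion_adj_inner ht) (by simp) fun a => ?_
      constructor
      · rintro (h | rfl)
        · exact ⟨h.1, by omega⟩
        · exact ⟨rfl, le_rfl⟩
      · rintro ⟨h1, h2⟩
        by_cases h3 : a.2.val ≤ t
        · exact Or.inl ⟨h1, h3⟩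
        · exact Or.inr (sigma_fin_ext h1 (by simp only; omega))
  obtain ⟨p, p1, p2, p3, p4, p5⟩ := h (width v - 1) (by omega)
  refine ⟨p, p1, p2, p3, p4, fun a => (p5 a).trans (and_iff_left_of_imp ?_)⟩
  rintro rfl
  omega

theorem Traverses.expansion {a b : V} {U : V → Prop} (h : Traverses r a b U) :
    Traverses (expansion width r).Adj (entrance hw a) (exit hw b) fun c => U c.1 := by
  obtain ⟨p, p1, p2, p3, p4, p5⟩ := h
  have key : ∀ (p : List V) a b, p.IsChain r → p.Nodup → p.head? = some a → p.getLast? = some b →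
      Traverses (_root_.expansion width r).Adj (entrance hw a) (exit hw b) fun c => c.1 ∈ p := by
    intro p
    induction p with
    | nil => simp
    | cons v p ih =>
      intro a b hc hn ha hb
      obtain rfl : v = a := by simpa using ha
      cases p with
      | nil =>
        obtain rfl : v = b := by simpa using hb
        simpa using traverses_expansion_single hw v
      | cons u p =>
        rw [List.isChain_cons_cons] at hc
        rw [List.nodup_cons] at hn
        refine (traverses_expansion_single hw v).append
          (ih u b hc.2 hn.2 (by simp) (by simpa using hb))
          (expansion_adj_exit_entrance hw hc.1) ?_ fun c => ?_
        · rintro c rfl hc'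
          exact hn.1 hc'
        · simp [List.mem_cons]
  obtain ⟨q, q1, q2, q3, q4, q5⟩ := key p a b p1 p2 p3 p4
  exact ⟨q, q1, q2, q3, q4, fun c => (q5 c).trans (p5 _)⟩

include hw in
theorem expansion_connected {v₀ : V} (h : ∀ v, Relation.EqvGen r v₀ v) :
    (expansion width r).Connected := by
  have hpath : ∀ v t (ht : t < width v),
      (expansion width r).Reachable (entrance hw v) ⟨v, ⟨t, ht⟩⟩ := by
    intro v t
    induction t with
    | zero => exact fun _ => .refl _
    | succ t ih => exact fun ht => (ih (by omega)).trans (expansion_adj_inner ht).reachable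
  have hreach : ∀ {v w}, Relation.EqvGen r v w →
      (expansion width r).Reachable (entrance hw v) (entrance hw w) := by
    intro v w hvw
    induction hvw with
    | rel v w hvw =>
      exact (hpath v _ (by have := hw v; omega)).trans
        (expansion_adj_exit_entrance hw hvw).reachable
    | refl => exact .refl _
    | symm _ _ _ ih => exact ih.symm
    | trans _ _ _ _ _ ih ih' => exact ih.trans ih'
  rw [SimpleGraph.connected_iff_exists_forall_reachable]
  exact ⟨entrance hw v₀, fun a => (hreach (h a.1)).trans (hpath a.1 _ a.2.2)⟩

theorem adj_inner_of_expansion {a : Σ v, Fin (width v)} {v : V} {t : ℕ} (ht : t + 2 < width v)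
    (h : (expansion width r).Adj ⟨v, ⟨t + 1, by omega⟩⟩ a) :
    a = ⟨v, ⟨t, by omega⟩⟩ ∨ a = ⟨v, ⟨t + 2, ht⟩⟩ := by
  rw [expansion, SimpleGraph.fromRel_adj] at h
  obtain ⟨-, (⟨h1, h2⟩ | ⟨h1, -⟩) | (⟨h1, h2⟩ | ⟨-, h2, -⟩)⟩ := h
  · exact Or.inr (sigma_fin_ext h1.symm h2.symm)
  · simp only at h1; omega
  · exact Or.inl (sigma_fin_ext h1 (by simp only at h2 ⊢; omega))
  · simp at h2

theorem adj_exit_of_expansion {a : Σ v, Fin (width v)} {v : V}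
    (h : (expansion width r).Adj (exit hw v) a) :
    a = ⟨v, ⟨width v - 2, by have := hw v; omega⟩⟩ ∨ ∃ w, a = entrance hw w ∧ r v w := by
  have := hw v
  rw [expansion, SimpleGraph.fromRel_adj] at h
  obtain ⟨-, (⟨h1, h2⟩ | ⟨-, h1, h2⟩) | (⟨h1, h2⟩ | ⟨-, h2, -⟩)⟩ := h
  · obtain ⟨w, t⟩ := a
    simp only [exit] at h1 h2
    subst h1
    omega
  · exact Or.inr ⟨a.1, sigma_fin_ext rfl h1, h2⟩
  · exact Or.inl (sigma_fin_ext h1 (by simp only [exit] at h2 ⊢; omega))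
  · simp only [exit] at h2
    omega

theorem adj_entrance_of_expansion {a : Σ v, Fin (width v)} {w : V}
    (h : (expansion width r).Adj (entrance hw w) a) :
    a = ⟨w, ⟨1, by have := hw w; omega⟩⟩ ∨ ∃ v, a = exit hw v ∧ r v w := by
  have := hw w
  rw [expansion, SimpleGraph.fromRel_adj] at h
  obtain ⟨-, (⟨h1, h2⟩ | ⟨h1, -⟩) | (⟨h1, h2⟩ | ⟨h1, -, h2⟩)⟩ := h
  · exact Or.inl (sigma_fin_ext h1.symm h2.symm)
  · simp only [entrance] at h1
    omega
  · simp [entrance] at h2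
  · exact Or.inr ⟨a.1, sigma_fin_ext rfl (by simp only [exit]; omega), h2⟩

/-- A tour of the expansion enters and leaves each of the paths exactly once. -/
theorem IsTour.isSuccessor {S : SimpleGraph (Σ v, Fin (width v))} (hS : IsTour S)
    (hle : S ≤ expansion width r) (h3 : ∀ v w : V, ∃ u, u ≠ v ∧ u ≠ w) :
    IsSuccessor (fun v w => S.Adj (exit hw v) (entrance hw w)) ∧
      ∀ v w, S.Adj (exit hw v) (entrance hw w) → r v w := by
  -- inner vertices have no choice
  have hinner : ∀ (v : V) (t : ℕ) (ht : t + 2 < width v),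
      S.Adj ⟨v, ⟨t + 1, by omega⟩⟩ ⟨v, ⟨t, by omega⟩⟩ ∧
      S.Adj ⟨v, ⟨t + 1, by omega⟩⟩ ⟨v, ⟨t + 2, ht⟩⟩ := by
    intro v t ht
    exact Set.mem_of_ncard_eq_two_of_subset (hS.ncard_neighborSet ⟨v, ⟨t + 1, by omega⟩⟩)
      fun a ha => adj_inner_of_expansion ht (hle ha)
  have hfirst : ∀ v, S.Adj (entrance hw v) ⟨v, ⟨1, by have := hw v; omega⟩⟩ := fun v =>
    (hinner v 0 (by have := hw v; omega)).1.symm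
  have hlast : ∀ v, S.Adj (exit hw v) ⟨v, ⟨width v - 2, by have := hw v; omega⟩⟩ := by
    intro v
    have hv := hw v
    have h := (hinner v (width v - 3) (by omega)).2.symm
    simp only [show width v - 3 + 2 = width v - 1 by omega,
      show width v - 3 + 1 = width v - 2 by omega] at h
    exact h
  have hright : ∀ v, ∃ w, S.Adj (exit hw v) (entrance hw w) ∧ r v w ∧
      ∀ w', S.Adj (exit hw v) (entrance hw w') → w' = w := by
    intro v
    have hv := hw v
    obtain ⟨a, ha, hne, hall⟩ :=
      Set.exists_other_of_ncard_eq_two (hS.ncard_neighborSet (exit hw v)) (hlast v)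
    obtain ⟨w, rfl, hr⟩ := (adj_exit_of_expansion hw (hle ha)).resolve_left hne
    refine ⟨w, ha, hr, fun w' hw' => ?_⟩
    rcases hall _ hw' with h | h
    · simp only [entrance] at h
      rw [Sigma.mk.injEq] at h
      obtain ⟨rfl, h⟩ := h
      have := congrArg Fin.val (eq_of_heq h)
      simp only at this
      omega
    · exact congrArg Sigma.fst h
  have hleft : ∀ w, ∃ v, S.Adj (exit hw v) (entrance hw w) ∧
      ∀ v', S.Adj (exit hw v') (entrance hw w) → v' = v := by
    intro w
    have hw' := hw w
    obtain ⟨a, ha, hne, hall⟩ :=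
      Set.exists_other_of_ncard_eq_two (hS.ncard_neighborSet (entrance hw w)) (hfirst w)
    obtain ⟨v, rfl, hr⟩ := (adj_entrance_of_expansion hw (hle ha)).resolve_left hne
    refine ⟨v, ha.symm, fun v' hv' => ?_⟩
    rcases hall _ hv'.symm with h | h
    · simp only [exit] at h
      rw [Sigma.mk.injEq] at h
      obtain ⟨rfl, h⟩ := h
      have := congrArg Fin.val (eq_of_heq h)
      simp only at this
      omega
    · exact congrArg Sigma.fst h
  have hru : ∀ {v w w'}, S.Adj (exit hw v) (entrance hw w) →
      S.Adj (exit hw v) (entrance hw w') → w = w' := by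
    intro v w w' h h'
    obtain ⟨u, -, -, hu⟩ := hright v
    rw [hu _ h, hu _ h']
  have hlu : ∀ {v v' w}, S.Adj (exit hw v) (entrance hw w) →
      S.Adj (exit hw v') (entrance hw w) → v = v' := by
    intro v v' w h h'
    obtain ⟨u, -, hu⟩ := hleft w
    rw [hu _ h, hu _ h']
  refine ⟨⟨fun v => ?_, fun w => ?_, hru, hlu, fun {v w} hvw hwv => ?_⟩, fun v w h => ?_⟩
  · obtain ⟨w, hw, -⟩ := hright v
    exact ⟨w, hw⟩
  · obtain ⟨v, hv, -⟩ := hleft w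
    exact ⟨v, hv⟩
  · -- the paths of `v` and `w` would be a component of the tour
    obtain ⟨u, huv, huw⟩ := h3 v w
    obtain ⟨p⟩ := hS.preconnected (entrance hw v) (entrance hw u)
    obtain ⟨d, -, hd1, hd2⟩ := p.exists_boundary_dart {a | a.1 = v ∨ a.1 = w} (Or.inl rfl) (by
      rintro (h | h)
      · exact huv h
      · exact huw h)
    have hadj := d.adj
    have hexp := hle hadj
    rw [expansion, SimpleGraph.fromRel_adj] at hexp
    refine hd2 ?_
    obtain ⟨-, (⟨h1, h2⟩ | ⟨h1, h2, -⟩) | (⟨h1, h2⟩ | ⟨h1, h2, -⟩)⟩ := hexp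
    · change d.snd.1 = v ∨ d.snd.1 = w
      rw [← h1]; exact hd1
    · have e1 : d.fst = exit hw d.fst.1 := sigma_fin_ext rfl (by simp only [exit]; omega)
      have e2 : d.snd = entrance hw d.snd.1 := sigma_fin_ext rfl h2
      rw [e1, e2] at hadj
      rcases hd1 with hd | hd
      · rw [hd] at hadj
        exact Or.inr (hru hadj hvw)
      · rw [hd] at hadj
        exact Or.inl (hru hadj hwv)
    · change d.snd.1 = v ∨ d.snd.1 = w
      rw [h1]; exact hd1
    · have e1 : d.snd = exit hw d.snd.1 := sigma_fin_ext rfl (by simp only [exit]; omega)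
      have e2 : d.fst = entrance hw d.fst.1 := sigma_fin_ext rfl h2
      rw [e1, e2] at hadj
      rcases hd1 with hd | hd
      · rw [hd] at hadj
        exact Or.inr (hlu hadj.symm hwv)
      · rw [hd] at hadj
        exact Or.inl (hlu hadj.symm hvw)
  · obtain ⟨u, -, hu, hu'⟩ := hright v
    rw [hu' w h]
    exact hu

end Expansion

/-! ### Hamiltonian paths and cycles as tours -/

section Hamiltonian

variable {n : ℕ} {G G' : SimpleGraph (Fin n)}

theorem exists_isTour_of_isHamCycleEdgeSet {E : Set (Sym2 (Fin n))} (h : IsHamCycleEdgeSet G E) :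
    ∃ S ≤ G, IsTour S ∧ ∀ a b, S.Adj a b ↔ s(a, b) ∈ E := by
  obtain ⟨a, p, hp, rfl⟩ := h
  have hspan : p.toSubgraph.IsSpanning := fun v =>
    (p.mem_verts_toSubgraph).2 (hp.mem_support v)
  refine ⟨p.toSubgraph.spanningCoe, p.toSubgraph.spanningCoe_le, ⟨fun v => ?_, ?_⟩, fun u v => ?_⟩
  · exact hp.isCycle.ncard_neighborSet_toSubgraph_eq_two (hp.mem_support v)
  · exact ((p.toSubgraph.spanningCoeEquivCoeOfSpanning hspan).preconnected_iff).2
      p.toSubgraph_connected.preconnected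
  · rw [SimpleGraph.Subgraph.spanningCoe_adj, SimpleGraph.Walk.adj_toSubgraph_iff_mem_edges]
    rfl

theorem SimpleGraph.Walk.IsHamiltonian.isHamiltonianCycle_cons_mapLe (hle : G ≤ G') {a b : Fin n}
    {p : G.Walk a b} (hp : p.IsHamiltonian) (hadj : G'.Adj b a) (hn : ¬ G.Adj b a) :
    (SimpleGraph.Walk.cons hadj (p.mapLe hle)).IsHamiltonianCycle := by
  rw [isHamiltonianCycle_iff_isCycle_and_support_count_tail_eq_one, cons_isCycle_iff]
  refine ⟨⟨?_, fun h => ?_⟩, fun v => ?_⟩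
  · rw [isPath_def, support_mapLe_eq_support]
    exact hp.isPath.support_nodup
  · rw [edges_mapLe_eq_edges] at h
    exact hn (p.adj_of_mem_edges h)
  · rw [support_cons, List.tail_cons, support_mapLe_eq_support]
    exact hp v

/-- A vertex with at most one neighbour is an end of each Hamiltonian path. -/
theorem SimpleGraph.Walk.IsHamiltonian.eq_or_eq_of_leaf {a b z : Fin n} {p : G.Walk a b}
    (hp : p.IsHamiltonian) (hz : ∃ u, ∀ v, G.Adj z v → v = u) : z = a ∨ z = b := by
  obtain ⟨u, hu⟩ := hz
  obtain ⟨i, hi, hil⟩ := mem_support_iff_exists_getVert.1 (hp.mem_support z)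
  by_cases h0 : i = 0
  · left; rw [← hi, h0, getVert_zero]
  by_cases hl : i = p.length
  · right; rw [← hi, hl, getVert_length]
  have h2 := hp.isPath.ncard_neighborSet_toSubgraph_internal_eq_two h0 (by omega)
  rw [hi] at h2
  have hsub : p.toSubgraph.neighborSet z ⊆ {u} := fun v hv => hu v hv.adj_sub
  have := Set.ncard_le_ncard hsub
  rw [h2, Set.ncard_singleton] at this
  omega

/-- Joining its two leaves turns each Hamiltonian path of a graph into a tour. -/
theorem exists_isTour_of_isHamPathEdgeSet (hle : G ≤ G') {z z' : Fin n} (hne : z ≠ z')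
    (hz : ∃ u, ∀ v, G.Adj z v → v = u) (hz' : ∃ u, ∀ v, G.Adj z' v → v = u)
    (hadj : G'.Adj z z') (hn : ¬ G.Adj z z') {E : Set (Sym2 (Fin n))}
    (h : IsHamPathEdgeSet G E) :
    ∃ S ≤ G', IsTour S ∧ ∀ a b, S.Adj a b ↔ s(a, b) ∈ E ∨ s(a, b) = s(z, z') := by
  obtain ⟨a, b, p, hp, rfl⟩ := h
  have hends : s(b, a) = s(z, z') := by
    rcases hp.eq_or_eq_of_leaf hz with rfl | rfl <;> rcases hp.eq_or_eq_of_leaf hz' with rfl | rfl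
    · exact absurd rfl hne
    · exact Sym2.eq_swap
    · rfl
    · exact absurd rfl hne
  have hadj' : G'.Adj b a := by
    rw [← SimpleGraph.mem_edgeSet, hends]; exact hadj
  have hn' : ¬ G.Adj b a := by
    rw [← SimpleGraph.mem_edgeSet, hends]; exact hn
  have hc := hp.isHamiltonianCycle_cons_mapLe hle hadj' hn'
  obtain ⟨S, hS, hS', hSE⟩ := exists_isTour_of_isHamCycleEdgeSet ⟨b, _, hc, rfl⟩
  refine ⟨S, hS, hS', fun u v => (hSE u v).trans ?_⟩
  rw [Set.mem_ofPred_eq, SimpleGraph.Walk.edges_cons, List.mem_cons,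
    SimpleGraph.Walk.edges_mapLe_eq_edges, hends, or_comm]
  rfl

theorem exists_isTour_of_isDirectedHamCycleArcSet (h3 : 3 ≤ n) {D : Digraph (Fin n)}
    (hD : ∀ a b, D.Adj a b → G.Adj a b) {E : Set (Fin n × Fin n)}
    (h : IsDirectedHamCycleArcSet D E) :
    ∃ S ≤ G, IsTour S ∧ ∀ a b, S.Adj a b ↔ (a, b) ∈ E ∨ (b, a) ∈ E := by
  obtain ⟨p, hp, rfl⟩ := h
  obtain ⟨m, rfl⟩ : ∃ m, n = m + 1 := ⟨n - 1, by omega⟩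
  have hmem : ∀ i b, (p i, b) ∈ Set.range (fun i => (p i, p (finRotate (m + 1) i))) ↔
      b = p (finRotate (m + 1) i) := by
    intro i b
    simp only [Set.mem_range, Prod.mk.injEq, EmbeddingLike.apply_eq_iff_eq]
    exact ⟨by rintro ⟨j, rfl, rfl⟩; rfl, fun h => ⟨i, rfl, h.symm⟩⟩
  have hmem' : ∀ i b, (b, p i) ∈ Set.range (fun i => (p i, p (finRotate (m + 1) i))) ↔
      b = p ((finRotate (m + 1)).symm i) := by
    intro i b
    simp only [Set.mem_range, Prod.mk.injEq, EmbeddingLike.apply_eq_iff_eq]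
    constructor
    · rintro ⟨j, rfl, rfl⟩; simp
    · rintro rfl; exact ⟨_, rfl, by simp⟩
  set E := Set.range fun i => (p i, p (finRotate (m + 1) i)) with hE
  have hG : ∀ a b, (a, b) ∈ E → G.Adj a b := by
    rintro a b ⟨i, hi⟩
    simp only [Prod.mk.injEq] at hi
    rw [← hi.1, ← hi.2]
    exact hD _ _ (hp i)
  let S : SimpleGraph (Fin (m + 1)) :=
    { Adj := fun a b => (a, b) ∈ E ∨ (b, a) ∈ E
      symm := ⟨fun _ _ h => h.symm⟩
      loopless := ⟨fun a h => G.irrefl (hG a a (h.elim id id))⟩ }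
  refine ⟨S, ?_, ⟨fun a => ?_, ?_⟩, fun a b => Iff.rfl⟩
  · rintro a b (h | h)
    · exact hG _ _ h
    · exact (hG _ _ h).symm
  · obtain ⟨i, rfl⟩ := p.surjective a
    have : S.neighborSet (p i) =
        {p (finRotate (m + 1) i), p ((finRotate (m + 1)).symm i)} := by
      ext b
      change (p i, b) ∈ E ∨ (b, p i) ∈ E ↔ _
      rw [hmem, hmem']
      simp
    rw [this]
    refine Set.ncard_pair fun heq => ?_
    have h2 : finRotate (m + 1) (finRotate (m + 1) i) = i := by
      rw [p.injective heq]; simp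
    simp only [finRotate_apply] at h2
    have h2 := congrArg Fin.val h2
    have hi := i.2
    rw [Fin.val_add, Fin.val_add] at h2
    rw [show ((1 : Fin (m + 1)) : ℕ) = 1 from by
      rw [Fin.val_one']; exact Nat.mod_eq_of_lt (by omega)] at h2
    rcases Nat.lt_or_ge (i.val + 1) (m + 1) with hlt | hge
    · rw [Nat.mod_eq_of_lt hlt] at h2
      rcases Nat.lt_or_ge (i.val + 1 + 1) (m + 1) with hlt' | hge'
      · rw [Nat.mod_eq_of_lt hlt'] at h2; omega
      · rw [show i.val + 1 + 1 = m + 1 by omega, Nat.mod_self] at h2; omega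
    · rw [show i.val + 1 = m + 1 by omega, Nat.mod_self, Nat.mod_eq_of_lt (by omega)] at h2
      omega
  · have hreach : ∀ i (hi : i < m + 1), S.Reachable (p 0) (p ⟨i, hi⟩) := by
      intro i
      induction i with
      | zero => exact fun _ => .refl _
      | succ i ih =>
        intro hi
        refine (ih (by omega)).trans (SimpleGraph.Adj.reachable (Or.inl ?_))
        rw [hmem, finRotate_of_lt (show i < m by omega)]
    intro a b
    obtain ⟨i, rfl⟩ := p.surjective a
    obtain ⟨j, rfl⟩ := p.surjective b
    exact (hreach i.1 i.2).symm.trans (hreach j.1 j.2)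

theorem exists_isHamiltonian_of_traverses {a b : Fin n}
    (h : Traverses G.Adj a b fun _ => True) : ∃ p : G.Walk a b, p.IsHamiltonian := by
  obtain ⟨l, h1, h2, h3, h4, h5⟩ := h
  have hne : l ≠ [] := by rintro rfl; simp at h3
  rw [List.head?_eq_some_head hne, Option.some_inj] at h3
  rw [List.getLast?_eq_some_getLast hne, Option.some_inj] at h4
  subst h3 h4
  refine ⟨SimpleGraph.Walk.ofSupport l hne h1, ?_⟩
  refine SimpleGraph.Walk.IsPath.isHamiltonian_of_mem ?_ fun v => ?_
  · rw [SimpleGraph.Walk.isPath_def, SimpleGraph.Walk.support_ofSupport]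
    exact h2
  · rw [SimpleGraph.Walk.support_ofSupport]
    exact (h5 v).2 trivial

theorem exists_isHamPathEdgeSet {a b : Fin n} (h : Traverses G.Adj a b fun _ => True) :
    ∃ E, IsHamPathEdgeSet G E := by
  obtain ⟨p, hp⟩ := exists_isHamiltonian_of_traverses h
  exact ⟨_, a, b, p, hp, rfl⟩

theorem exists_isHamCycleEdgeSet (hle : G ≤ G') {a b : Fin n}
    (h : Traverses G.Adj a b fun _ => True) (hadj : G'.Adj b a) (hn : ¬ G.Adj b a) :
    ∃ E, IsHamCycleEdgeSet G' E := by
  obtain ⟨p, hp⟩ := exists_isHamiltonian_of_traverses h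
  exact ⟨_, b, _, hp.isHamiltonianCycle_cons_mapLe hle hadj hn, rfl⟩

theorem exists_isDirectedHamCycleArcSet (hle : G ≤ G') {D : Digraph (Fin n)}
    (hD : ∀ a b, G'.Adj a b → D.Adj a b) {a b : Fin n}
    (h : Traverses G.Adj a b fun _ => True) (hadj : G'.Adj b a) :
    ∃ E, IsDirectedHamCycleArcSet D E := by
  obtain ⟨l, h1, h2, h3, h4, h5⟩ := h
  have hlen : l.length = n := by
    rw [← List.toFinset_card_of_nodup h2, Finset.card_eq_of_equiv_fin]
    exact (Equiv.subtypeUnivEquiv fun v => List.mem_toFinset.2 ((h5 v).2 trivial))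
  have hbij : Function.Bijective l.get :=
    (Fintype.bijective_iff_injective_and_card _).2
      ⟨List.nodup_iff_injective_get.1 h2, by simp [hlen]⟩
  obtain ⟨m, rfl⟩ : ∃ m, n = m + 1 := ⟨n - 1, by have := a.2; omega⟩
  refine ⟨_, (finCongr hlen.symm).trans (Equiv.ofBijective _ hbij), fun i => hD _ _ ?_, rfl⟩
  simp only [Equiv.trans_apply, finCongr_apply, Equiv.ofBijective_apply, List.get_eq_getElem,
    Fin.val_cast]
  obtain ⟨i, hi⟩ := i
  rcases Nat.lt_or_ge i m with him | him
  · simp only [finRotate_of_lt him]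
    exact hle (List.isChain_iff_getElem.1 h1 i (by omega))
  · obtain rfl : i = m := by omega
    simp only [finRotate_last']
    have e1 : l[i] = b := by
      rw [List.getLast?_eq_getElem?, hlen] at h4
      simpa [hlen] using h4
    have e2 : l[0] = a := by
      rw [List.head?_eq_getElem?] at h3
      simpa [hlen] using h3
    rw [e1, e2]
    exact hadj

end Hamiltonian

/-! ### The family of graphs -/

namespace GadgetVertex

variable {l : ℕ}

/-- The vertices of the gadget, by kind. -/
def equivSum (l : ℕ) : GadgetVertex l ≃
    (Fin (2 * l + 1) ⊕ Fin (2 * l) × Fin (12 * 2 ^ l + 3)) ⊕ (Clause l ⊕ Fin 3) where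
  toFun
    | gate ρ => Sum.inl (Sum.inl ρ)
    | chain ρ u => Sum.inl (Sum.inr (ρ, u))
    | clause c => Sum.inr (Sum.inl c)
    | link e => Sum.inr (Sum.inr e)
  invFun
    | Sum.inl (Sum.inl ρ) => gate ρ
    | Sum.inl (Sum.inr (ρ, u)) => chain ρ u
    | Sum.inr (Sum.inl c) => clause c
    | Sum.inr (Sum.inr e) => link e
  left_inv v := by cases v <;> rfl
  right_inv v := by rcases v with (_ | ⟨_, _⟩) | (_ | _) <;> rfl

instance : Fintype (GadgetVertex l) := Fintype.ofEquiv _ (equivSum l).symm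

theorem card_eq (l : ℕ) :
    Fintype.card (GadgetVertex l) = 24 * l * 2 ^ l + 8 * l + 4 * 2 ^ l + 4 := by
  rw [Fintype.card_congr (equivSum l)]
  simp
  ring

/-- The lengths of the paths that replace the vertices: the excess goes into the last path. -/
def width (m : ℕ) (v : GadgetVertex l) : ℕ := if v = link 2 then 3 + m else 3

theorem three_le_width (m : ℕ) (v : GadgetVertex l) : 3 ≤ width m v := by
  unfold width; split <;> omega

theorem card_sigma_width (m : ℕ) : Fintype.card (Σ v : GadgetVertex l, Fin (width m v)) =
    3 * Fintype.card (GadgetVertex l) + m := by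
  have h : ∀ v : GadgetVertex l, width m v = 3 + if v = link 2 then m else 0 := by
    intro v; unfold width; split <;> simp
  rw [Fintype.card_sigma]
  simp only [Fintype.card_fin, h]
  rw [Finset.sum_add_distrib]
  simp [mul_comm]

/-- Whether the first player controls the vertex. -/
def side : GadgetVertex l → Bool
  | gate _ => true
  | chain _ u => decide (u.val ≤ 6 * 2 ^ l)
  | clause c => c.1
  | link e => decide (e = 0)

variable (x y x' y' : (Fin l → Bool) × (Fin l → Bool) → Bool)

/-- The arcs of the gadget together with, if `closed`, the arc from its end to its start. -/
def ClosedArc (closed : Bool) (v w : GadgetVertex l) : Prop :=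
  Arc x y v w ∨ (closed = true ∧ v = link 2 ∧ w = gate 0)

variable {x y x' y'}

theorem arc_congr {v w : GadgetVertex l} (h : ∀ c, v = clause c →
    ∀ c', w = clause c' → (if c.1 then x else y) = (if c'.1 then x' else y')) :
    Arc x y v w ↔ Arc x' y' v w := by
  cases v with
  | clause c =>
    cases w with
    | clause c' =>
      have h := h c rfl c' rfl
      simp only [Arc]
      refine and_congr_right fun hc => ?_
      rw [h, hc]
    | _ => exact Iff.rfl
  | _ => cases w <;> exact Iff.rfl

theorem arc_congr_first {v w : GadgetVertex l} (h : side v = true ∨ side w = true) :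
    Arc x y v w ↔ Arc x y' v w := by
  constructor <;> intro ha
  · refine (arc_congr ?_).1 ha
    rintro c rfl c' rfl
    obtain ⟨h1, -⟩ := ha
    simp only [side, ← h1, or_self] at h
    simp [← h1, h]
  · refine (arc_congr ?_).2 ha
    rintro c rfl c' rfl
    obtain ⟨h1, -⟩ := ha
    simp only [side, ← h1, or_self] at h
    simp [← h1, h]

theorem arc_congr_second {v w : GadgetVertex l} (h : side v = false ∨ side w = false) :
    Arc x y v w ↔ Arc x' y v w := by
  constructor <;> intro ha
  · refine (arc_congr ?_).1 ha
    rintro c rfl c' rfl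
    obtain ⟨h1, -⟩ := ha
    simp only [side, ← h1, or_self] at h
    simp [← h1, h]
  · refine (arc_congr ?_).2 ha
    rintro c rfl c' rfl
    obtain ⟨h1, -⟩ := ha
    simp only [side, ← h1, or_self] at h
    simp [← h1, h]

/-- The arcs between the two sides: four for each row and two more. -/
def arcCut : (Fin (2 * l) × Fin 4) ⊕ Fin 2 → GadgetVertex l × GadgetVertex l
  | Sum.inl (ρ, 0) => (gate ρ.castSucc, pos ρ (12 * 2 ^ l + 2))
  | Sum.inl (ρ, 1) => (pos ρ (12 * 2 ^ l + 2), gate ρ.succ)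
  | Sum.inl (ρ, 2) => (pos ρ (6 * 2 ^ l), pos ρ (6 * 2 ^ l + 1))
  | Sum.inl (ρ, 3) => (pos ρ (6 * 2 ^ l + 1), pos ρ (6 * 2 ^ l))
  | Sum.inr 0 => (link 0, link 1)
  | Sum.inr 1 => (link 2, gate 0)

theorem exists_arcCut {closed : Bool} {v w : GadgetVertex l} (h : ClosedArc x y closed v w)
    (hside : side v ≠ side w) : ∃ c, arcCut c = (v, w) := by
  rcases h with h | ⟨-, rfl, rfl⟩
  swap
  · exact ⟨Sum.inr 1, rfl⟩
  cases v with
  | gate ρ =>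
    cases w with
    | gate _ => exact h.elim
    | chain ρ' u =>
      obtain ⟨h1, h2⟩ := h
      have h2 : u.val = 12 * 2 ^ l + 2 := h2.resolve_left fun h0 => by simp [side, h0] at hside
      refine ⟨Sum.inl (ρ', 0), Prod.ext ?_ ?_⟩
      · simp only [arcCut]
        congr 1
        exact Fin.ext h1.symm
      · simp only [arcCut]
        rw [chain_eq_pos, h2]
    | clause c => obtain ⟨-, h, -⟩ := h; simp [side, h] at hside
    | link _ => exact h.elim
  | chain ρ u =>
    cases w with
    | gate ρ' =>
      obtain ⟨h1, h2⟩ := h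
      have h2 : u.val = 12 * 2 ^ l + 2 := h2.resolve_left fun h0 => by simp [side, h0] at hside
      refine ⟨Sum.inl (ρ, 1), Prod.ext ?_ ?_⟩
      · simp only [arcCut]
        rw [chain_eq_pos, h2]
      · simp only [arcCut]
        congr 1
        exact Fin.ext h1.symm
    | chain ρ' u' =>
      obtain ⟨rfl, h⟩ := h
      simp only [side, ne_eq, decide_eq_decide] at hside
      rcases h with h | h
      · refine ⟨Sum.inl (ρ, 2), Prod.ext ?_ ?_⟩ <;> simp only [arcCut] <;> rw [chain_eq_pos] <;>
          congr 1 <;> omega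
      · refine ⟨Sum.inl (ρ, 3), Prod.ext ?_ ?_⟩ <;> simp only [arcCut] <;> rw [chain_eq_pos] <;>
          congr 1 <;> omega
    | clause c =>
      have hc := cell_lt_iff c
      refine absurd ?_ hside
      simp only [side]
      rw [eq_comm, Bool.eq_iff_iff, ← hc, decide_eq_true_eq]
      rcases h with ⟨-, h⟩ | ⟨-, h⟩ <;> omega
    | link _ => exact h.elim
  | clause c =>
    cases w with
    | gate _ => exact h.elim
    | chain ρ u =>
      have hc := cell_lt_iff c
      refine absurd ?_ hside
      simp only [side]
      rw [Bool.eq_iff_iff, ← hc, decide_eq_true_eq]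
      rcases h with ⟨-, h⟩ | ⟨-, h⟩ <;> omega
    | clause c' => exact absurd h.1 hside
    | link e => obtain ⟨-, ⟨h, rfl⟩ | ⟨h, rfl⟩⟩ := h <;> simp [side, h] at hside
  | link e =>
    cases w with
    | gate _ => exact h.elim
    | chain _ _ => exact h.elim
    | clause c => obtain ⟨rfl, h, -⟩ := h; simp [side, h] at hside
    | link e' =>
      obtain ⟨rfl, rfl⟩ := h
      exact ⟨Sum.inr 0, rfl⟩

end GadgetVertex

section GadgetGraph

open GadgetVertex

variable {l n : ℕ} (hn : 3 * Fintype.card (GadgetVertex l) ≤ n)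

/-- The pairs of indices: the disjointness instances are sets of such pairs. -/
abbrev IndexPair (l : ℕ) : Type := (Fin l → Bool) × (Fin l → Bool)

/-- The edges between the two sides of the expanded gadget, with their directions. -/
abbrev GadgetCut (l : ℕ) : Type := ((Fin (2 * l) × Fin 4) ⊕ Fin 2) × Bool

/-- A numbering of the vertices of the expanded gadget. -/
noncomputable def gadgetEquiv :
    (Σ v : GadgetVertex l, Fin (width (n - 3 * Fintype.card (GadgetVertex l)) v)) ≃ Fin n :=
  Fintype.equivFinOfCardEq (by rw [card_sigma_width]; omega)

/-- The undirected graph on `n` vertices that is obtained from the gadget, with or without the edge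
that closes its Hamiltonian paths. -/
noncomputable def gadgetGraph (closed : Bool) (x y : IndexPair l → Bool) : SimpleGraph (Fin n) :=
  (expansion (width (n - 3 * Fintype.card (GadgetVertex l))) (ClosedArc x y closed)).comap
    (gadgetEquiv hn).symm

/-- The side of a vertex of the expanded gadget. -/
noncomputable def gadgetSide (a : Fin n) : Bool := side ((gadgetEquiv hn).symm a).1

/-- The vertex at which the arcs to `v` end. -/
noncomputable def gadgetIn (v : GadgetVertex l) : Fin n :=
  gadgetEquiv hn (entrance (three_le_width _) v)

/-- The vertex at which the arcs from `v` start. -/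
noncomputable def gadgetOut (v : GadgetVertex l) : Fin n :=
  gadgetEquiv hn (exit (three_le_width _) v)

variable {closed : Bool} {x y x' y' : IndexPair l → Bool}

theorem gadgetSide_gadgetIn (v : GadgetVertex l) : gadgetSide hn (gadgetIn hn v) = side v := by
  simp [gadgetSide, gadgetIn, entrance]

theorem gadgetSide_gadgetOut (v : GadgetVertex l) : gadgetSide hn (gadgetOut hn v) = side v := by
  simp [gadgetSide, gadgetOut, exit]

theorem gadgetGraph_adj_congr {a b : Fin n}
    (h : ∀ v w : GadgetVertex l, (side v = gadgetSide hn b ∨ side w = gadgetSide hn b) →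
      (Arc x y v w ↔ Arc x' y' v w)) :
    (gadgetGraph hn closed x y).Adj a b ↔ (gadgetGraph hn closed x' y').Adj a b := by
  simp only [gadgetGraph, SimpleGraph.comap_adj, expansion, SimpleGraph.fromRel_adj, ClosedArc]
  rw [h ((gadgetEquiv hn).symm a).1 ((gadgetEquiv hn).symm b).1 (Or.inr rfl),
    h ((gadgetEquiv hn).symm b).1 ((gadgetEquiv hn).symm a).1 (Or.inl rfl)]

theorem gadgetGraph_mono : gadgetGraph hn false x y ≤ gadgetGraph hn true x y :=
  fun _ _ hab => expansion_mono (fun _ _ h => h.imp_right fun h => ⟨rfl, h.2⟩) hab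

theorem gadgetGraph_connected (hl : 0 < l) : (gadgetGraph hn closed x y).Connected := by
  rw [gadgetGraph, (SimpleGraph.Iso.comap (gadgetEquiv hn).symm _).connected_iff]
  refine expansion_connected (three_le_width _) (v₀ := gate 0) fun v => ?_
  exact (eqvGen_gate_zero hl v).mono fun _ _ h => Or.inl h

/-- An edge between the two sides, in one of its directions. -/
noncomputable def gadgetCut (c : GadgetCut l) : Fin n × Fin n :=
  let e := (gadgetOut hn (arcCut c.1).1, gadgetIn hn (arcCut c.1).2)
  if c.2 then e else e.swap

theorem exists_gadgetCut {a b : Fin n} (h : (gadgetGraph hn closed x y).Adj a b)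
    (hab : gadgetSide hn a ≠ gadgetSide hn b) : ∃ c, gadgetCut hn c = (a, b) := by
  obtain ⟨a, rfl⟩ := (gadgetEquiv hn).surjective a
  obtain ⟨b, rfl⟩ := (gadgetEquiv hn).surjective b
  have key : ∀ a b : Σ v : GadgetVertex l, Fin (width (n - 3 * Fintype.card (GadgetVertex l)) v),
      side a.1 ≠ side b.1 →
      ((a.1 = b.1 ∧ a.2.val + 1 = b.2.val) ∨
        (a.2.val + 1 = width (n - 3 * Fintype.card (GadgetVertex l)) a.1 ∧ b.2.val = 0 ∧
          ClosedArc x y closed a.1 b.1)) →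
      ∃ c, gadgetOut hn (arcCut c).1 = gadgetEquiv hn a ∧
        gadgetIn hn (arcCut c).2 = gadgetEquiv hn b := by
    rintro a b hab (⟨h, -⟩ | ⟨h1, h2, h3⟩)
    · rw [h] at hab
      exact absurd rfl hab
    · obtain ⟨c, hc⟩ := exists_arcCut h3 hab
      refine ⟨c, ?_, ?_⟩
      · rw [hc, gadgetOut]
        congr 1
        exact sigma_fin_ext rfl (by simp only [exit]; omega)
      · rw [hc, gadgetIn]
        congr 1
        exact sigma_fin_ext rfl h2.symm
  simp only [gadgetSide, Equiv.symm_apply_apply] at hab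
  simp only [gadgetGraph, SimpleGraph.comap_adj, expansion, SimpleGraph.fromRel_adj,
    Equiv.symm_apply_apply] at h
  rcases h.2 with h | h
  · obtain ⟨c, h1, h2⟩ := key a b hab h
    exact ⟨(c, true), by simp [gadgetCut, h1, h2]⟩
  · obtain ⟨c, h1, h2⟩ := key b a hab.symm h
    exact ⟨(c, false), by simp [gadgetCut, h1, h2]⟩

/-- Each tour gives away a pair of indices in which the inputs meet, by the only edge between clause
vertices of the first player that it uses. -/
theorem exists_mem_of_isTour {S : SimpleGraph (Fin n)} (hS : IsTour S)
    (hle : S ≤ gadgetGraph hn true x y) : ∃ i j, x (i, j) = true ∧ y (i, j) = true ∧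
    ∀ i' j', S.Adj (gadgetOut hn (clause (true, false, i')))
      (gadgetIn hn (clause (true, true, j'))) ↔ i' = i ∧ j' = j := by
  have h3 : ∀ v w : GadgetVertex l, ∃ u, u ≠ v ∧ u ≠ w := by
    intro v w
    by_contra! h
    have h0 := h (link 0)
    have h1 := h (link 1)
    have h2 := h (link 2)
    by_cases e0 : link 0 = v
    · subst e0
      have e1 := h1 (by simp)
      have e2 := h2 (by simp)
      rw [← e1] at e2
      simp at e2
    · have e0 := h0 e0
      subst e0
      by_cases e1 : link 1 = v
      · subst e1
        simpa using h2 (by simp)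
      · simpa using h1 e1
  have hle' : S.comap (gadgetEquiv hn) ≤
      expansion (width (n - 3 * Fintype.card (GadgetVertex l))) (ClosedArc x y true) := by
    intro a b hab
    have := hle hab
    simpa [gadgetGraph] using this
  obtain ⟨h1, h2⟩ := (hS.comap (gadgetEquiv hn)).isSuccessor (three_le_width _) hle' h3
  exact exists_mem_of_isSuccessor h1 fun v w hvw => (h2 v w hvw).imp_right fun h => h.2

theorem traverses_gadgetGraph {i : IndexPair l} (hx : x i = true) (hy : y i = true) :
    Traverses (gadgetGraph hn false x y).Adj (gadgetIn hn (gate 0)) (gadgetOut hn (link 2))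
      fun _ => True := by
  have h1 : Traverses (ClosedArc x y false) (gate 0) (link 2) fun _ => True := by
    obtain ⟨p, p1, p2⟩ := traverses_of_mem hx hy
    exact ⟨p, p1.imp fun _ _ h => Or.inl h, p2⟩
  obtain ⟨p, p1, p2, p3, p4, p5⟩ := h1.expansion
    (three_le_width (n - 3 * Fintype.card (GadgetVertex l)))
  refine ⟨p.map (gadgetEquiv hn), ?_, p2.map (gadgetEquiv hn).injective, ?_, ?_, fun a => ?_⟩
  · rw [List.isChain_map]
    exact p1.imp fun a b h => by simpa [gadgetGraph] using h
  · simp [p3, gadgetIn]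
  · simp [p4, gadgetOut]
  · rw [List.mem_map]
    exact iff_of_true ⟨_, (p5 _).2 trivial, (gadgetEquiv hn).apply_symm_apply a⟩ trivial

theorem gadgetGraph_adj_closing :
    (gadgetGraph hn true x y).Adj (gadgetOut hn (link 2)) (gadgetIn hn (gate 0)) := by
  simp only [gadgetGraph, SimpleGraph.comap_adj, gadgetOut, gadgetIn, Equiv.symm_apply_apply]
  exact expansion_adj_exit_entrance _ (Or.inr ⟨rfl, rfl, rfl⟩)

theorem gadgetOut_leaf : ∃ b, ∀ a, (gadgetGraph hn false x y).Adj (gadgetOut hn (link 2)) a →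
    a = b := by
  refine ⟨gadgetEquiv hn ⟨link 2, ⟨width _ (link 2) - 2, Nat.sub_lt
    (lt_of_lt_of_le three_pos (three_le_width _ _)) two_pos⟩⟩, fun a ha => ?_⟩
  obtain ⟨a, rfl⟩ := (gadgetEquiv hn).surjective a
  congr 1
  simp only [gadgetGraph, SimpleGraph.comap_adj, gadgetOut, Equiv.symm_apply_apply] at ha
  refine (adj_exit_of_expansion _ ha).resolve_right ?_
  rintro ⟨w, -, h⟩
  rcases h with h | h
  · cases w with
    | clause c => exact absurd h.1 (by decide)
    | link e => exact absurd h.1 (by decide)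
    | _ => exact h
  · simp at h

theorem gadgetIn_leaf : ∃ b, ∀ a, (gadgetGraph hn false x y).Adj (gadgetIn hn (gate 0)) a →
    a = b := by
  refine ⟨gadgetEquiv hn ⟨gate 0, ⟨1, lt_of_lt_of_le (by omega) (three_le_width _ _)⟩⟩,
    fun a ha => ?_⟩
  obtain ⟨a, rfl⟩ := (gadgetEquiv hn).surjective a
  congr 1
  simp only [gadgetGraph, SimpleGraph.comap_adj, gadgetIn, Equiv.symm_apply_apply] at ha
  refine (adj_entrance_of_expansion _ ha).resolve_right ?_
  rintro ⟨w, -, h⟩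
  rcases h with h | h
  · cases w with
    | chain ρ u => exact absurd h.1 (by simp)
    | _ => exact h
  · simp at h

theorem gadgetOut_ne_gadgetIn (v w : GadgetVertex l) : gadgetOut hn v ≠ gadgetIn hn w := by
  intro h
  have h := (gadgetEquiv hn).injective h
  simp only [exit, entrance] at h
  rw [Sigma.mk.injEq] at h
  obtain ⟨rfl, h⟩ := h
  have := congrArg Fin.val (eq_of_heq h)
  have := three_le_width (n - 3 * Fintype.card (GadgetVertex l)) v
  simp only at *
  omega

theorem gadgetOut_injective : Function.Injective (gadgetOut hn) := fun v w h => by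
  have h := (gadgetEquiv hn).injective h
  exact congrArg Sigma.fst h

theorem not_gadgetGraph_adj_closing :
    ¬ (gadgetGraph hn false x y).Adj (gadgetOut hn (link 2)) (gadgetIn hn (gate 0)) := by
  intro h
  simp only [gadgetGraph, SimpleGraph.comap_adj, gadgetOut, gadgetIn, Equiv.symm_apply_apply] at h
  rcases adj_exit_of_expansion _ h with h | ⟨w, h, h'⟩
  · have := congrArg Sigma.fst h
    simp [entrance] at this
  · have := congrArg Sigma.fst h
    simp only [entrance] at this
    subst this
    rcases h' with h' | h'
    · exact h'
    · simp at h'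

end GadgetGraph

/-! ### The reductions -/

section Reductions

open GadgetVertex

variable {l n : ℕ} (hl : 0 < l) (hn : 3 * Fintype.card (GadgetVertex l) ≤ n)

/-- The gadget graphs as instances of a distributed problem on graphs. -/
noncomputable def gadgetFamily {P : DistributedProblem n} (closed : Bool)
    (toInstance : SimpleGraph (Fin n) → P.Instance)
    (network_eq : ∀ G, P.network (toInstance G) = G)
    (localInput_congr : ∀ G G' v, (∀ u, G.Adj u v ↔ G'.Adj u v) →
      P.localInput (toInstance G) v = P.localInput (toInstance G') v)
    (valid_of_connected : ∀ G, G.Connected → P.valid (toInstance G)) :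
    TwoPartyFamily P (IndexPair l → Bool) (IndexPair l → Bool) (GadgetCut l) where
  inst x y := toInstance (gadgetGraph hn closed x y)
  side := gadgetSide hn
  cut := gadgetCut hn
  valid x y := valid_of_connected _ (gadgetGraph_connected hn hl)
  localInput_first x y y' v hv := localInput_congr _ _ _ fun u =>
    gadgetGraph_adj_congr hn fun a b h => arc_congr_first (by rwa [hv] at h)
  localInput_second x x' y v hv := localInput_congr _ _ _ fun u =>
    gadgetGraph_adj_congr hn fun a b h => arc_congr_second (by rwa [hv] at h)
  adj_first x y y' u v hv := by
    rw [network_eq, network_eq]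
    exact gadgetGraph_adj_congr hn fun a b h => arc_congr_first (by rwa [hv] at h)
  adj_second x x' y u v hv := by
    rw [network_eq, network_eq]
    exact gadgetGraph_adj_congr hn fun a b h => arc_congr_second (by rwa [hv] at h)
  exists_cut x y u v h huv := by
    rw [network_eq] at h
    exact exists_gadgetCut hn h huv

end Reductions

namespace TwoPartyFamily

variable {n : ℕ} {P : DistributedProblem n} {ι E : Type}
  (F : TwoPartyFamily P (ι → Bool) (ι → Bool) E)

open Classical in
/-- To decide whether their sets meet, the first player announces whether its vertices accept. -/
noncomputable def ofDecision (accepts : P.Output → Bool)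
    (h : ∀ x y o, P.correct (F.inst x y) o →
      ((∀ v, accepts (o v) = true) ↔ ∃ i, x i = true ∧ y i = true)) :
    DisjointnessReduction P ι E Bool where
  toTwoPartyFamily := F
  announce _ o := decide (∀ v, F.side v = true → accepts (o v) = true)
  answer _ o a := a && decide (∀ v, F.side v = false → accepts (o v) = true)
  announce_congr x o o' ho := by
    rw [decide_eq_decide]
    exact forall_congr' fun v => imp_congr_right fun hv => by rw [ho v hv]
  answer_congr y o o' a ho := by
    congr 1
    rw [decide_eq_decide]
    exact forall_congr' fun v => imp_congr_right fun hv => by rw [ho v hv]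
  answer_iff x y o ho := by
    rw [← h x y o ho, Bool.and_eq_true, decide_eq_true_iff, decide_eq_true_iff]
    constructor
    · rintro ⟨h1, h2⟩ v
      cases hv : F.side v with
      | true => exact h1 v hv
      | false => exact h2 v hv
    · exact fun h => ⟨fun v _ => h v, fun v _ => h v⟩

open Classical in
/-- If a correct output makes the first player's vertices name an element common to the two sets,
provided that there is one, then the first player announces the named element after checking
that it is in its own set, and the second player checks that it is in the other set. -/
noncomputable def ofFinding (named : (Fin n → P.Output) → ι → Prop)
    (named_congr : ∀ o o', (∀ v, F.side v = true → o v = o' v) → named o = named o')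
    (h : ∀ x y o, P.correct (F.inst x y) o → (∃ i, x i = true ∧ y i = true) →
      (∃ i, named o i) ∧ ∀ i, named o i → x i = true ∧ y i = true) :
    DisjointnessReduction P ι E (Option ι) where
  toTwoPartyFamily := F
  announce x o := if h : ∃ i, named o i ∧ x i = true then some h.choose else none
  answer y _ a := a.elim false y
  announce_congr x o o' ho := by simp only [named_congr o o' ho]
  answer_congr _ _ _ _ _ := rfl
  answer_iff x y o ho := by
    by_cases hi : ∃ i, named o i ∧ x i = true
    · rw [dif_pos hi, Option.elim_some]
      refine ⟨fun hy => ⟨_, hi.choose_spec.2, hy⟩, fun hxy => ?_⟩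
      exact ((h x y o ho hxy).2 _ hi.choose_spec.1).2
    · rw [dif_neg hi, Option.elim_none]
      refine iff_of_false (by simp) fun hxy => hi ?_
      obtain ⟨⟨i, hi⟩, h2⟩ := h x y o ho hxy
      exact ⟨i, hi, (h2 i hi).1⟩

end TwoPartyFamily

section HamiltonianReductions

open GadgetVertex

variable {l n : ℕ} (hl : 0 < l) (hn : 3 * Fintype.card (GadgetVertex l) ≤ n)

/-- The tail of the edge that a Hamiltonian path or cycle uses if it gives away the index
pair `p`. -/
noncomputable def nameTail (p : IndexPair l) : Fin n := gadgetOut hn (clause (true, false, p.1))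

/-- The head of the edge with the tail `nameTail hn p`. -/
noncomputable def nameHead (p : IndexPair l) : Fin n := gadgetIn hn (clause (true, true, p.2))

variable {hn} in
include hn in
theorem three_le_of_card_le : 3 ≤ n := by
  rw [card_eq] at hn
  omega

theorem exists_index_of_isTour {x y : IndexPair l → Bool} {S : SimpleGraph (Fin n)}
    (hS : IsTour S) (hle : S ≤ gadgetGraph hn true x y) :
    ∃ p, x p = true ∧ y p = true ∧ ∀ p', S.Adj (nameTail hn p') (nameHead hn p') ↔ p' = p := by
  obtain ⟨i, j, h1, h2, h3⟩ := exists_mem_of_isTour hn hS hle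
  exact ⟨(i, j), h1, h2, fun p' => (h3 _ _).trans (by rw [Prod.ext_iff])⟩

/-- The edge sets described by `Q` of the gadget graphs exist only if the inputs meet, and they
name a common element. -/
def NamesIndex (closed : Bool)
    (Q : {n : ℕ} → SimpleGraph (Fin n) → Set (Sym2 (Fin n)) → Prop) : Prop :=
  ∀ x y : IndexPair l → Bool,
    (∀ E, Q (gadgetGraph hn closed x y) E → ∃ p, x p = true ∧ y p = true ∧
      ∀ p', s(nameTail hn p', nameHead hn p') ∈ E ↔ p' = p) ∧
    ∀ p, x p = true → y p = true → ∃ E, Q (gadgetGraph hn closed x y) E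

theorem namesIndex_isHamPathEdgeSet : NamesIndex hn false IsHamPathEdgeSet := by
  refine fun x y => ⟨fun E hE => ?_, fun p hx hy =>
    exists_isHamPathEdgeSet (traverses_gadgetGraph hn hx hy)⟩
  obtain ⟨S, hle, hS, hSE⟩ := exists_isTour_of_isHamPathEdgeSet (gadgetGraph_mono hn)
    (gadgetOut_ne_gadgetIn hn _ _) (gadgetOut_leaf hn) (gadgetIn_leaf hn)
    (gadgetGraph_adj_closing hn) (not_gadgetGraph_adj_closing hn) hE
  obtain ⟨p, h1, h2, h3⟩ := exists_index_of_isTour hn hS hle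
  refine ⟨p, h1, h2, fun p' => ?_⟩
  rw [← h3, hSE]
  refine (or_iff_left ?_).symm
  rw [Sym2.eq_iff]
  rintro (⟨h, -⟩ | ⟨h, -⟩)
  · simpa using gadgetOut_injective hn h
  · exact gadgetOut_ne_gadgetIn hn _ _ h

theorem namesIndex_isHamCycleEdgeSet : NamesIndex hn true IsHamCycleEdgeSet := by
  refine fun x y => ⟨fun E hE => ?_, fun p hx hy =>
    exists_isHamCycleEdgeSet (gadgetGraph_mono hn) (traverses_gadgetGraph hn hx hy)
      (gadgetGraph_adj_closing hn) (not_gadgetGraph_adj_closing hn)⟩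
  obtain ⟨S, hle, hS, hSE⟩ := exists_isTour_of_isHamCycleEdgeSet hE
  obtain ⟨p, h1, h2, h3⟩ := exists_index_of_isTour hn hS hle
  exact ⟨p, h1, h2, fun p' => by rw [← h3, hSE]⟩

variable {Q : {n : ℕ} → SimpleGraph (Fin n) → Set (Sym2 (Fin n)) → Prop} {closed : Bool}

include hl hn in
theorem nonempty_reduction_undirectedDecision (hQ : NamesIndex hn closed Q) :
    Nonempty (DisjointnessReduction (undirectedDecision Q n) (IndexPair l) (GadgetCut l) Bool) := by
  let F := gadgetFamily (P := undirectedDecision Q n) hl hn closed id (fun _ => rfl)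
    (fun G G' v h => Set.ext fun u => by
      change G.Adj v u ↔ G'.Adj v u
      rw [G.adj_comm, G'.adj_comm]
      exact h u) fun _ h => h
  refine ⟨F.ofDecision id fun x y o ho => ?_⟩
  refine Iff.trans ho ⟨?_, ?_⟩
  · rintro ⟨E, hE⟩
    obtain ⟨p, h1, h2, -⟩ := (hQ x y).1 E hE
    exact ⟨p, h1, h2⟩
  · rintro ⟨p, h1, h2⟩
    exact (hQ x y).2 p h1 h2

include hl hn in
theorem nonempty_reduction_undirectedFinding (hQ : NamesIndex hn closed Q) :
    Nonempty (DisjointnessReduction (undirectedFinding Q n) (IndexPair l) (GadgetCut l)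
      (Option (IndexPair l))) := by
  let F := gadgetFamily (P := undirectedFinding Q n) hl hn closed id (fun _ => rfl)
    (fun G G' v h => Set.ext fun u => by
      change G.Adj v u ↔ G'.Adj v u
      rw [G.adj_comm, G'.adj_comm]
      exact h u) fun _ h => h
  let named : (Fin n → Set (Fin n)) → IndexPair l → Prop := fun o p =>
    nameHead hn p ∈ o (nameTail hn p) ∨ nameTail hn p ∈ o (nameHead hn p)
  have hnamed : ∀ o p, named o p ↔ s(nameTail hn p, nameHead hn p) ∈ selectedEdges o := by
    intro o p
    constructor
    · rintro (h | h)
      · exact ⟨_, _, h, rfl⟩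
      · exact ⟨_, _, h, Sym2.eq_swap⟩
    · rintro ⟨v, u, h, he⟩
      rw [Sym2.eq_iff] at he
      obtain ⟨h1, h2⟩ | ⟨h1, h2⟩ := he
      · rw [← h1, ← h2] at h; exact Or.inl h
      · rw [← h1, ← h2] at h; exact Or.inr h
  refine ⟨F.ofFinding named (fun o o' ho => ?_) fun x y o ho hxy => ?_⟩
  · funext p
    simp only [named]
    rw [ho (nameTail hn p) (gadgetSide_gadgetOut hn _),
      ho (nameHead hn p) (gadgetSide_gadgetIn hn _)]
  · obtain ⟨p, h1, h2⟩ := hxy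
    obtain ⟨q, h1, h2, h3⟩ := (hQ x y).1 _ (ho ((hQ x y).2 p h1 h2))
    refine ⟨⟨q, (hnamed _ _).2 ((h3 q).2 rfl)⟩, fun i hi => ?_⟩
    rw [(h3 i).1 ((hnamed _ _).1 hi)]
    exact ⟨h1, h2⟩

/-- An undirected graph as a directed graph with arcs in both directions. -/
def bidirected (G : SimpleGraph (Fin n)) : Digraph (Fin n) := ⟨G.Adj⟩

theorem underlyingGraph_bidirected (G : SimpleGraph (Fin n)) :
    underlyingGraph (bidirected G) = G := by
  ext a b
  rw [underlyingGraph, SimpleGraph.fromRel_adj]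
  simp only [bidirected, G.adj_comm b a, or_self]
  exact and_iff_right_of_imp fun h => h.ne

theorem namesIndex_isDirectedHamCycleArcSet (x y : IndexPair l → Bool) :
    (∀ E, IsDirectedHamCycleArcSet (bidirected (gadgetGraph hn true x y)) E →
      ∃ p, x p = true ∧ y p = true ∧ ∀ p', ((nameTail hn p', nameHead hn p') ∈ E ∨
        (nameHead hn p', nameTail hn p') ∈ E) ↔ p' = p) ∧
    ∀ p, x p = true → y p = true →
      ∃ E, IsDirectedHamCycleArcSet (bidirected (gadgetGraph hn true x y)) E := by
  refine ⟨fun E hE => ?_, fun p hx hy =>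
    exists_isDirectedHamCycleArcSet (gadgetGraph_mono hn) (fun _ _ h => h)
      (traverses_gadgetGraph hn hx hy) (gadgetGraph_adj_closing hn)⟩
  obtain ⟨S, hle, hS, hSE⟩ := exists_isTour_of_isDirectedHamCycleArcSet
    (G := gadgetGraph hn true x y) (three_le_of_card_le (hn := hn)) (fun _ _ h => h) hE
  obtain ⟨p, h1, h2, h3⟩ := exists_index_of_isTour hn hS hle
  exact ⟨p, h1, h2, fun p' => by rw [← h3, hSE]⟩

include hl hn in
theorem nonempty_reduction_directedHamCycleDecision :
    Nonempty (DisjointnessReduction (directedHamCycleDecision n) (IndexPair l) (GadgetCut l)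
      Bool) := by
  let F := gadgetFamily (P := directedHamCycleDecision n) hl hn true bidirected
    underlyingGraph_bidirected
    (fun G G' v h => Prod.ext (Set.ext fun u => by
        change G.Adj v u ↔ G'.Adj v u
        rw [G.adj_comm, G'.adj_comm]; exact h u) (Set.ext h))
    fun G h => ⟨fun _ => G.irrefl, by rwa [underlyingGraph_bidirected]⟩
  refine ⟨F.ofDecision id fun x y o ho => ?_⟩
  have hQ := namesIndex_isDirectedHamCycleArcSet hn x y
  refine Iff.trans ho ⟨?_, ?_⟩
  · rintro ⟨E, hE⟩
    obtain ⟨p, h1, h2, -⟩ := hQ.1 E hE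
    exact ⟨p, h1, h2⟩
  · rintro ⟨p, h1, h2⟩
    exact hQ.2 p h1 h2

include hl hn in
theorem nonempty_reduction_directedHamCycleFinding :
    Nonempty (DisjointnessReduction (directedHamCycleFinding n) (IndexPair l) (GadgetCut l)
      (Option (IndexPair l))) := by
  let F := gadgetFamily (P := directedHamCycleFinding n) hl hn true bidirected
    underlyingGraph_bidirected
    (fun G G' v h => Prod.ext (Set.ext fun u => by
        change G.Adj v u ↔ G'.Adj v u
        rw [G.adj_comm, G'.adj_comm]; exact h u) (Set.ext h))
    fun G h => ⟨fun _ => G.irrefl, by rwa [underlyingGraph_bidirected]⟩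
  let named : (Fin n → Set (Fin n) × Set (Fin n)) → IndexPair l → Prop := fun o p =>
    (nameTail hn p, nameHead hn p) ∈ selectedArcs o ∨
      (nameHead hn p, nameTail hn p) ∈ selectedArcs o
  refine ⟨F.ofFinding named (fun o o' ho => ?_) fun x y o ho hxy => ?_⟩
  · funext p
    simp only [named, selectedArcs, Set.mem_ofPred_eq]
    rw [ho (nameTail hn p) (gadgetSide_gadgetOut hn _),
      ho (nameHead hn p) (gadgetSide_gadgetIn hn _)]
  · obtain ⟨p, h1, h2⟩ := hxy
    have hQ := namesIndex_isDirectedHamCycleArcSet hn x y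
    obtain ⟨q, h1, h2, h3⟩ := hQ.1 _ (ho (hQ.2 p h1 h2))
    refine ⟨⟨q, (h3 q).2 rfl⟩, fun i hi => ?_⟩
    rw [(h3 i).1 hi]
    exact ⟨h1, h2⟩

end HamiltonianReductions

/-! ### The asymptotic bound -/

theorem two_thousand_mul_le_four_pow {l : ℕ} (hl : 7 ≤ l) : 2000 * (l + 1) ≤ 4 ^ l := by
  induction l, hl using Nat.le_induction with
  | base => norm_num
  | succ l hl ih => rw [pow_succ]; omega

theorem four_pow_le_of_solves {l n B : ℕ} {P : DistributedProblem n} {Λ : Type} [Fintype Λ]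
    [Countable (Fin n → P.Output)] (hΛ : Fintype.card Λ ≤ 4 ^ l + 1) (hl : 7 ≤ l)
    (F : DisjointnessReduction P (IndexPair l) (GadgetCut l) Λ) (A : CongestAlgorithm P B) {T : ℕ}
    (hA : A.Solves T) : (4 : ℝ) ^ l ≤ 23040 * (l * (B + 1) * T) := by
  have h := F.card_le_of_solves A hA
  have hcard : (Fintype.card (IndexPair l) : ℝ) = 4 ^ l := by
    simp [← mul_pow]
  have hcut : (Fintype.card (GadgetCut l) : ℝ) = 16 * l + 4 := by
    simp; ring
  rw [hcard, hcut] at h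
  have hl' : (7 : ℝ) ≤ l := by exact_mod_cast hl
  have hpow : (2000 : ℝ) * (l + 1) ≤ 4 ^ l := by exact_mod_cast two_thousand_mul_le_four_pow hl
  have hlog2 : Real.log 2 ≤ 0.7 := Real.log_two_lt_d9.le.trans (by norm_num)
  have hlog2' : 0 < Real.log 2 := Real.log_pos (by norm_num)
  have hlogΛ : Real.log (Fintype.card Λ) + Real.log 2 ≤ 1.4 * (l + 1) := by
    have h1 : Real.log (Fintype.card Λ) ≤ Real.log (2 ^ (2 * l + 1)) := by
      rcases (Nat.zero_le (Fintype.card Λ)).eq_or_lt with h0 | h0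
      · rw [← h0]
        simp only [CharP.cast_eq_zero, Real.log_zero]
        exact Real.log_nonneg (one_le_pow₀ (by norm_num))
      · refine Real.log_le_log (by exact_mod_cast h0) ?_
        have h1 : (Fintype.card Λ : ℝ) ≤ 4 ^ l + 1 := by exact_mod_cast hΛ
        rw [pow_succ, pow_mul]
        norm_num
        have : (1 : ℝ) ≤ 4 ^ l := one_le_pow₀ (by norm_num)
        linarith
    rw [Real.log_pow] at h1
    push_cast at h1
    nlinarith
  have hmain : (16 * (l : ℝ) + 4) * T * (B + 1) * Real.log 2 ≤ 20 * (l * (B + 1) * T) := by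
    have h0 : (0 : ℝ) ≤ T * (B + 1) := by positivity
    calc (16 * (l : ℝ) + 4) * T * (B + 1) * Real.log 2 =
        (16 * l + 4) * (T * (B + 1)) * Real.log 2 := by ring
      _ ≤ (20 * l) * (T * (B + 1)) * 1 := by
        gcongr
        · linarith
        · linarith
      _ = _ := by ring
  linarith

/-- A suitable number of bits for graphs with `n` vertices: the gadget fits, and it
is not much smaller than the graph. -/
theorem exists_index_length : ∀ᶠ n : ℕ in atTop, 1 ≤ Real.log n ∧
    ∃ l, 7 ≤ l ∧ 3 * Fintype.card (GadgetVertex l) ≤ n ∧ (l : ℝ) ≤ 2 * Real.log n ∧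
      (n : ℝ) ≤ 480 * Real.log n * 2 ^ l := by
  have hlog : Tendsto (fun n : ℕ => Real.log n) atTop atTop :=
    Real.tendsto_log_atTop.comp tendsto_natCast_atTop_atTop
  have hsmall : ∀ᶠ n : ℕ in atTop, ‖Real.log n‖ ≤ (1 / 30720 : ℝ) * ‖(n : ℝ)‖ :=
    tendsto_natCast_atTop_atTop.eventually
      (Real.isLittleO_log_id_atTop.bound (by norm_num : (0 : ℝ) < 1 / 30720))
  filter_upwards [hlog.eventually_ge_atTop 1, hsmall] with n h1 h2
  refine ⟨h1, ?_⟩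
  rw [Real.norm_of_nonneg (by linarith), Real.norm_of_nonneg (by positivity)] at h2
  have hn0 : n ≠ 0 := by rintro rfl; simp at h1; linarith
  have hn2 : 2 ≤ n := by
    by_contra h
    have : n = 1 := by omega
    subst this
    simp at h1
    linarith
  set L := Nat.log 2 n with hL
  have hL1 : 1 ≤ L := Nat.log_pos (by norm_num) hn2
  have hLlog : (L : ℝ) ≤ 2 * Real.log n := by
    have h3 : (2 : ℝ) ^ L ≤ n := by exact_mod_cast Nat.pow_log_le_self 2 hn0
    have h4 := Real.log_le_log (by positivity) h3
    rw [Real.log_pow] at h4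
    have h5 : (0.5 : ℝ) ≤ Real.log 2 := by linarith [Real.log_two_gt_d9]
    have h6 : (L : ℝ) * 0.5 ≤ L * Real.log 2 := by gcongr
    linarith
  have hdiv : 2 ^ 7 ≤ n / (120 * L) := by
    rw [Nat.le_div_iff_mul_le (by omega)]
    have : (2 ^ 7 * (120 * L) : ℝ) ≤ n := by linarith
    exact_mod_cast this
  set l := Nat.log 2 (n / (120 * L)) with hl
  have hl7 : 7 ≤ l := Nat.le_log_of_pow_le (by norm_num) hdiv
  have hlL : l ≤ L := Nat.log_mono_right (Nat.div_le_self _ _)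
  have hk : 2 ^ l ≤ n / (120 * L) := Nat.pow_log_le_self 2 (by positivity)
  have hk' : n / (120 * L) < 2 ^ (l + 1) := Nat.lt_pow_succ_log_self (by norm_num) _
  refine ⟨l, hl7, ?_, ?_, ?_⟩
  · rw [Nat.le_div_iff_mul_le (by omega)] at hk
    rw [GadgetVertex.card_eq]
    have hpos : 1 ≤ 2 ^ l := Nat.one_le_two_pow
    have e1 : l * 2 ^ l ≤ 2 ^ l * L := by rw [mul_comm]; gcongr
    have e2 : 2 ^ l ≤ 2 ^ l * L := Nat.le_mul_of_pos_right _ hL1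
    have e3 : L ≤ 2 ^ l * L := Nat.le_mul_of_pos_left _ hpos
    have e4 : 24 * l * 2 ^ l = 24 * (l * 2 ^ l) := by ring
    have e5 : 2 ^ l * (120 * L) = 120 * (2 ^ l * L) := by ring
    have e6 : l + 4 ≤ 2 ^ l * L + 4 := by omega
    have e7 : 7 ≤ 2 ^ l * L := by omega
    omega
  · exact le_trans (by exact_mod_cast hlL) hLlog
  · rw [Nat.div_lt_iff_lt_mul (by omega)] at hk'
    have h3 : (n : ℝ) ≤ 2 ^ (l + 1) * (120 * L) := by exact_mod_cast hk'.le
    calc (n : ℝ) ≤ 2 ^ (l + 1) * (120 * L) := h3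
      _ ≤ 2 ^ (l + 1) * (120 * (2 * Real.log n)) := by gcongr
      _ = _ := by ring

/-- Reductions from disjointness on the pairs of `l`-bit indices, to a problem on as few vertices as
the gadget allows, imply the near-quadratic bound. -/
theorem requiresRounds_of_reductions (P : (n : ℕ) → DistributedProblem n)
    (hP : ∀ n, Countable (Fin n → (P n).Output))
    (H : ∀ l n, 0 < l → 3 * Fintype.card (GadgetVertex l) ≤ n →
      ∃ (Λ : Type) (_ : Fintype Λ), Fintype.card Λ ≤ 4 ^ l + 1 ∧
        Nonempty (DisjointnessReduction (P n) (IndexPair l) (GadgetCut l) Λ)) :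
    RequiresRounds P (fun n => (n : ℝ) ^ 2 / Real.log n ^ 4) := by
  intro B hB
  obtain ⟨C, hC, hBC⟩ := hB.exists_pos
  refine ⟨1 / (480 ^ 2 * 46080 * (C + 1)), by positivity, ?_⟩
  filter_upwards [hBC.bound, exists_index_length] with n hBn hn A T hA
  obtain ⟨hlog, l, hl, hcard, hlL, hnl⟩ := hn
  obtain ⟨Λ, _, hΛ, ⟨F⟩⟩ := H l n (by omega) hcard
  have := hP n
  have h := four_pow_le_of_solves hΛ hl F A hA
  rw [Real.norm_of_nonneg (by positivity), Real.norm_of_nonneg (by linarith)] at hBn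
  set g := Real.log n with hg
  have hg0 : 0 < g := by linarith
  have h1 : (4 : ℝ) ^ l ≤ 46080 * (C + 1) * g ^ 2 * T := by
    calc (4 : ℝ) ^ l ≤ 23040 * (l * (B n + 1) * T) := h
      _ ≤ 23040 * ((2 * g) * ((C + 1) * g) * T) := by
        gcongr
        linarith
      _ = _ := by ring
  have h2 : (n : ℝ) ^ 2 ≤ 480 ^ 2 * g ^ 2 * 4 ^ l := by
    calc (n : ℝ) ^ 2 ≤ (480 * g * 2 ^ l) ^ 2 := by gcongr
      _ = 480 ^ 2 * g ^ 2 * (2 ^ l) ^ 2 := by ring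
      _ = _ := by rw [← pow_mul, mul_comm l 2, pow_mul]; norm_num
  have h3 : (n : ℝ) ^ 2 ≤ 480 ^ 2 * 46080 * (C + 1) * g ^ 4 * T := by
    calc (n : ℝ) ^ 2 ≤ 480 ^ 2 * g ^ 2 * 4 ^ l := h2
      _ ≤ 480 ^ 2 * g ^ 2 * (46080 * (C + 1) * g ^ 2 * T) := by gcongr
      _ = _ := by ring
  rw [div_mul_div_comm, one_mul, div_le_iff₀ (by positivity)]
  linarith

theorem card_option_indexPair (l : ℕ) : Fintype.card (Option (IndexPair l)) ≤ 4 ^ l + 1 := by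
  simp [← mul_pow]

theorem card_bool_le (l : ℕ) : Fintype.card Bool ≤ 4 ^ l + 1 := by
  have : 1 ≤ 4 ^ l := Nat.one_le_pow _ _ (by norm_num)
  rw [Fintype.card_bool]
  omega

theorem mainTheorem3 :
    RequiresRounds hamPathDecision (fun n => (n : ℝ) ^ 2 / Real.log n ^ 4) ∧
    RequiresRounds hamPathFinding (fun n => (n : ℝ) ^ 2 / Real.log n ^ 4) ∧
    RequiresRounds hamCycleDecision (fun n => (n : ℝ) ^ 2 / Real.log n ^ 4) ∧
    RequiresRounds hamCycleFinding (fun n => (n : ℝ) ^ 2 / Real.log n ^ 4) ∧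
    RequiresRounds directedHamCycleDecision (fun n => (n : ℝ) ^ 2 / Real.log n ^ 4) ∧
    RequiresRounds directedHamCycleFinding (fun n => (n : ℝ) ^ 2 / Real.log n ^ 4) := by
  refine ⟨?_, ?_, ?_, ?_, ?_, ?_⟩
  · exact requiresRounds_of_reductions _ (fun n => inferInstanceAs (Countable (Fin n → Bool)))
      fun l n hl hn => ⟨Bool, inferInstance, card_bool_le l,
        nonempty_reduction_undirectedDecision hl hn (namesIndex_isHamPathEdgeSet hn)⟩
  · exact requiresRounds_of_reductions _
      (fun n => inferInstanceAs (Countable (Fin n → Set (Fin n))))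
      fun l n hl hn => ⟨_, inferInstance, card_option_indexPair l,
        nonempty_reduction_undirectedFinding hl hn (namesIndex_isHamPathEdgeSet hn)⟩
  · exact requiresRounds_of_reductions _ (fun n => inferInstanceAs (Countable (Fin n → Bool)))
      fun l n hl hn => ⟨Bool, inferInstance, card_bool_le l,
        nonempty_reduction_undirectedDecision hl hn (namesIndex_isHamCycleEdgeSet hn)⟩
  · exact requiresRounds_of_reductions _
      (fun n => inferInstanceAs (Countable (Fin n → Set (Fin n))))
      fun l n hl hn => ⟨_, inferInstance, card_option_indexPair l,
        nonempty_reduction_undirectedFinding hl hn (namesIndex_isHamCycleEdgeSet hn)⟩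
  · exact requiresRounds_of_reductions _ (fun n => inferInstanceAs (Countable (Fin n → Bool)))
      fun l n hl hn => ⟨Bool, inferInstance, card_bool_le l,
        nonempty_reduction_directedHamCycleDecision hl hn⟩
  · exact requiresRounds_of_reductions _
      (fun n => inferInstanceAs (Countable (Fin n → Set (Fin n) × Set (Fin n))))
      fun l n hl hn => ⟨_, inferInstance, card_option_indexPair l,
        nonempty_reduction_directedHamCycleFinding hl hn⟩
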